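/- **Setting.** Robots are disks of radius $r>0$, $d=\frac{2r}{\sqrt3-1}$, and $L$ is the hexagonal (triangular) lattice of spacing $d$ containing the origin $O$, with adjacency graph $\Gamma$ (points at distance $d$). Let $p_1,\dots,p_6$ be the neighbours of $O$, numbered clockwise, with $p_1,p_2$ above, $p_3$ to the right, $p_4,p_5$ below and $p_6$ to the left of $O$. Five stationary seed robots occupy $O,p_1,p_2,p_4,p_5$. Let $H_1$ (resp. $H_2$) be the set of lattice points at height $\ge\sqrt3\,d$ (resp. $\le-\sqrt3\,d$). *Ribbons.* For $P\subseteq H_1$ or $P\subseteq H_2$ the hop count $h(x)$ of $x\in P$ is the length of a shortest path in $\Gamma$ from $x$ to $O$ through $P\cup\{p_1,\dots,p_6\}$ ($-1$ if there is none). A ribbon is a connected component of the points of $P$ with equal hop count (its gradient), directed so that each arc turns clockwise about a common neighbour with hop count one less. A vertex $x$ is in front of $y$ (and $x<y$) if there is a directed path from $y$ to $x$; the first vertex has none in front of it. $R(x)$ is the ribbon of $x$. $Q$ is the parent of $R$ if its gradient is one less and every vertex of $R$ is adjacent to a vertex of $Q$; for $P\subseteq H_1$, $(p_2,p_1)$ counts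 as the parent of the ribbon of gradient $2$. Ancestors precede descendants in the tree order. The ribbons of $H_2$ are the idle ribbons. *Shape.* $S\subset L$ is a finite set with $N$ points, $D\subseteq S$ is the set of hole points, and the ribbonization of $S$ is proper: $S\subseteq H_1$; $S$ is simply connected ($L\setminus S$ is connected in $\Gamma$); all points of $S$ have positive hop count; every ribbon has at least two vertices; there is exactly one ribbon of gradient $2$ and it has three vertices; a point of $S$ adjacent to a lattice point outside $S$ is not in $D$; if $x,y\in S$ have distance $2d$, the lattice point between them is in $S$; if they have distance $\sqrt3\,d$, at least one of their two common neighbours is in $S$. A strict total order of the ribbons of $S$ extending the tree order (a complete tree order) is fixed. *Movement.* Initially idle robots occupy a finite set $I\subset H_2$ with $|I|\ge N$ such that each idle ribbon is contained in $I$ or disjoint from it, and every ancestor of a filled idle ribbon is filled. For $1\le k\le N$, choosing each time among points not chosen before in the same sequence: $s[k]$ is the largest point of $I$ on the largest idle ribbon; $t[k]$ is the smallest point on the smallest ribbon of $S$; $s_r[k]$ is the smallest point on the largest ribbon of $S$. Call the robot starting at $s_r[k]$ recycled if fewer than $c(R)=|R\cap D|$ vertices of $R=R(s_r[k])$ are in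 front of $s_r[k]$, and rearranged otherwise. If it is recycled, $t_r[k]$ is the smallest point of $\{s[1],\dots,s[N]\}$ on the smallest idle ribbon not in $t_r[1],\dots,t_r[k-1]$; if it is rearranged, $t_r[k]$ is the smallest point of $S\setminus D$ on the largest ribbon of $S$ not in $t_r[1],\dots,t_r[k-1]$. In epoch $T\le N$ the robot at $s[T]$ moves to $t[T]$; in epoch $N+k$ the robot at $s_r[k]$ moves to $t_r[k]$; all others stand still. *Paths.* A path is a finite (possibly empty) sequence of circular arcs of radius $d$ and angle $\pi/3$, each turning clockwise about a lattice point from one lattice point to the next. It is unobstructed in an epoch if each of its points (end points included) is at distance at least $2r$ from the center of every non-moving robot. A merging point of a ribbon $R$ with first vertex $x$ is a lattice point $m\notin S$ adjacent to $x$ such that $x$ and $m$ have a common neighbour in the parent of $R$. The extended edge-following path of an epoch is the set of points of the plane whose distance to the nearest point of $S\cup\{\text{centers of non-moving robots}\}$ is $d$. **Proposition.** In every subtractive epoch $T=N+k$, $1\le k\le N$, a robot is present at $s_r[k]$, and the path of the active robot from $s_r[k]$ to $t_r[k]$ exists, is unique, and is unobstructed. Precisely, let $R=R(s_r[k])$.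 1. If the robot is recycled, then $t_r[k]\in H_2$; $R$ has exactly one first vertex $x$ and exactly one merging point $m$; and there is exactly one recycle path, composed of (i) the interior path from $s_r[k]$ to $x$ through vertices of $R$ and (ii) the bridging path, a single arc from $x$ to $m$, both turning clockwise about the nearest robot of the parent ribbon of $R$ at distance $d$, and (iii) the exterior path from $m$ to $t_r[k]$, a clockwise segment, repeating no lattice point, of the extended edge-following path. The whole path is unobstructed, and every arc of the exterior path turns about a non-moving robot (not only about an unoccupied point of $S$), at distance $d$ from the nearest non-moving robot. 2. If the robot is rearranged, then $t_r[k]\in R\cap(S\setminus D)$, and there is exactly one path from $s_r[k]$ to $t_r[k]$ that visits only vertices of $R$ and turns clockwise about the nearest robot of the parent ribbon of $R$ at distance $d$ (empty if $s_r[k]=t_r[k]$). This path is unobstructed. -/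

import Mathlib

noncomputable section

namespace AddSubtract

/-! ### The hexagonal lattice -/

/-- Points of the hexagonal (triangular) lattice in the basis `1, ω = exp (iπ/3)`;
the origin `O` is `(0, 0)`. -/
abbrev Lat : Type := ℤ × ℤ

/-- Position in the plane of a lattice point, for the lattice spacing `d`. -/
def pos (d : ℝ) (x : Lat) : ℂ :=
  (d : ℂ) * ((x.1 : ℂ) + (x.2 : ℂ) * ⟨1 / 2, Real.sqrt 3 / 2⟩)

/-- The squared Euclidean distance of two lattice points in units of `d ^ 2`. -/
def sqDist (x y : Lat) : ℤ :=
  (x.1 - y.1) ^ 2 + (x.1 - y.1) * (x.2 - y.2) + (x.2 - y.2) ^ 2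

/-- The lattice point `q` rotated clockwise by `π / 3` about the lattice point `c`. -/
def rotCW (c q : Lat) : Lat :=
  (c.1 + (q.1 - c.1) + (q.2 - c.2), c.2 - (q.1 - c.1))

theorem dist_pos_sq (d : ℝ) (x y : Lat) :
    dist (pos d x) (pos d y) ^ 2 = d ^ 2 * (sqDist x y : ℝ) := by
  have h3 : Real.sqrt 3 ^ 2 = 3 := Real.sq_sqrt (by norm_num)
  rw [Complex.dist_eq, ← Complex.normSq_eq_norm_sq, Complex.normSq_apply]
  simp only [pos, sqDist, Complex.sub_re, Complex.sub_im, Complex.mul_re, Complex.mul_im,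
    Complex.add_re, Complex.add_im, Complex.ofReal_re, Complex.ofReal_im, Complex.intCast_re,
    Complex.intCast_im]
  push_cast
  linear_combination (d ^ 2 * ((x.2 : ℝ) - y.2) ^ 2 / 4) * h3

theorem pos_rotCW (d : ℝ) (c q : Lat) :
    pos d (rotCW c q) =
      pos d c + (pos d q - pos d c) * Complex.exp (-((Real.pi / 3 : ℝ) : ℂ) * Complex.I) := by
  have h3 : Real.sqrt 3 ^ 2 = 3 := Real.sq_sqrt (by norm_num)
  have hexp : Complex.exp (-((Real.pi / 3 : ℝ) : ℂ) * Complex.I)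
      = ⟨1 / 2, -(Real.sqrt 3 / 2)⟩ := by
    rw [← Complex.ofReal_neg, Complex.exp_mul_I, ← Complex.ofReal_cos, ← Complex.ofReal_sin,
      Real.cos_neg, Real.sin_neg, Real.cos_pi_div_three, Real.sin_pi_div_three]
    apply Complex.ext <;> simp
  rw [hexp]
  apply Complex.ext
  · simp [pos, rotCW]
    linear_combination (-(d * ((q.2 : ℝ) - c.2)) / 4) * h3
  · simp [pos, rotCW]
    ring

/-- The lattice graph `Γ`: two lattice points are adjacent iff their distance is `d`. -/
def latGraph : SimpleGraph Lat where
  Adj x y := sqDist x y = 1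
  symm := ⟨fun x y h => by
    have e : sqDist y x = sqDist x y := by unfold sqDist; ring
    exact e.trans h⟩
  loopless := ⟨fun x h => by simp [sqDist] at h⟩

def p1 : Lat := (-1, 1)
def p2 : Lat := (0, 1)
def p4 : Lat := (1, -1)
def p5 : Lat := (0, -1)

/-- The lattice points occupied by the five stationary seed robots: `O, p₁, p₂, p₄, p₅`. -/
def seeds : Set Lat := {0, p1, p2, p4, p5}

/-- The lattice points of the formation half-plane: those at height at least `√3 d`. -/
def H1 : Set Lat := {x | 2 ≤ x.2}

/-- The lattice points of the idle half-plane: those at height at most `-√3 d`. -/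
def H2 : Set Lat := {x | x.2 ≤ -2}

/-! ### Hop counts and ribbons of a set `P` of lattice points -/

/-- `Γ` restricted to `P ∪ {O, p₁, …, p₆}`. -/
def hopGraph (P : Set Lat) : SimpleGraph Lat where
  Adj x y := latGraph.Adj x y ∧ (x ∈ P ∨ sqDist x 0 ≤ 1) ∧ (y ∈ P ∨ sqDist y 0 ≤ 1)
  symm := ⟨fun _ _ h => ⟨h.1.symm, h.2.2, h.2.1⟩⟩
  loopless := ⟨fun x h => latGraph.loopless.irrefl x h.1⟩

open Classical in
/-- The hop count `h(x)`: the length of a shortest path from `x` to the origin through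
`P ∪ {p₁, …, p₆}`, and `-1` if there is none. -/
def hop (P : Set Lat) (x : Lat) : ℤ :=
  if (hopGraph P).Reachable x 0 then ((hopGraph P).dist x 0 : ℤ) else -1

/-- Adjacency of points of `P` with equal hop count. -/
def ribbonGraph (P : Set Lat) : SimpleGraph Lat where
  Adj x y := latGraph.Adj x y ∧ x ∈ P ∧ y ∈ P ∧ hop P x = hop P y
  symm := ⟨fun _ _ h => ⟨h.1.symm, h.2.2.1, h.2.1, h.2.2.2.symm⟩⟩
  loopless := ⟨fun x h => latGraph.loopless.irrefl x h.1⟩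

/-- The vertex set of the ribbon `R(x)`, the component of `x` among the points of `P` with the
same hop count. -/
def ribbonOf (P : Set Lat) (x : Lat) : Set Lat := {y | (ribbonGraph P).Reachable x y}

/-- The ribbonization of `P`: all its ribbons, as vertex sets. -/
def ribbons (P : Set Lat) : Set (Set Lat) := ribbonOf P '' P

/-- The ribbon with vertex set `R` has gradient `g`. -/
def HasGradient (P : Set Lat) (R : Set Lat) (g : ℤ) : Prop := ∀ x ∈ R, hop P x = g

/-- The arcs of the directed ribbons: the arc from `x` to `x'` turns clockwise about a neighbour
`y` of `x` whose hop count is one less. -/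
def RibbonArc (P : Set Lat) (x x' : Lat) : Prop :=
  x ∈ P ∧ x' ∈ P ∧ hop P x' = hop P x ∧
    ∃ y, latGraph.Adj x y ∧ hop P y = hop P x - 1 ∧ x' = rotCW y x

/-- `x` is in front of `y`: there is a directed path from `y` to `x` in their ribbon.
This is also the ribbon order `x < y`. -/
def InFront (P : Set Lat) (x y : Lat) : Prop := Relation.TransGen (RibbonArc P) y x

/-- `x` is the first vertex of the ribbon `R`. -/
def IsFirstVertex (P : Set Lat) (R : Set Lat) (x : Lat) : Prop :=
  x ∈ R ∧ ∀ y ∈ R, ¬ InFront P y x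

/-- `ID(x)`: the number of vertices of its ribbon in front of `x`. -/
def ribbonIndex (P : Set Lat) (x : Lat) : ℕ := {y | InFront P y x}.ncard

/-- The two conditions under which `Q` is the parent of `R`: its gradient is one less, and every
vertex of `R` is adjacent to a vertex of `Q`. -/
def ParentRel (P : Set Lat) (Q R : Set Lat) : Prop :=
  (∀ x ∈ R, ∀ y ∈ Q, hop P y = hop P x - 1) ∧ ∀ x ∈ R, ∃ y ∈ Q, latGraph.Adj x y

/-- `Q` is the parent ribbon of `R`, both being ribbons of `P`. -/
def IsParent (P : Set Lat) (Q R : Set Lat) : Prop :=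
  Q ∈ ribbons P ∧ R ∈ ribbons P ∧ ParentRel P Q R

/-- The tree order: `Q < R` iff `Q` is an ancestor of `R`. -/
def TreeLt (P : Set Lat) (Q R : Set Lat) : Prop := Relation.TransGen (IsParent P) Q R

/-- The vertices of the parent ribbon of a ribbon `R` of `S ⊆ H₁`, where `(p₂, p₁)` counts as a
ribbon (it is the parent of the ribbon with gradient two). -/
def parentVertices (S : Set Lat) (R : Set Lat) : Set Lat :=
  {y | ∃ Q ∈ insert {p1, p2} (ribbons S), ParentRel S Q R ∧ y ∈ Q}

/-- `m` is a merging point of the ribbon `R`. -/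
def IsMergingPoint (S : Set Lat) (R : Set Lat) (m : Lat) : Prop :=
  m ∉ S ∧ ∃ x, IsFirstVertex S R x ∧ latGraph.Adj m x ∧
    ∃ y ∈ parentVertices S R, latGraph.Adj y x ∧ latGraph.Adj y m

/-! ### Assumptions on the shape, the idle robots and the order of the ribbons -/

/-- The ribbonization of `S`, with the set `D` of hole points, is proper. -/
structure ProperRibbonization (S D : Finset Lat) : Prop where
  subset_H1 : (S : Set Lat) ⊆ H1
  holes_subset : D ⊆ S
  /-- `S` represents a shape homeomorphic to an open disk: it has no lattice holes. -/
  compl_connected : (latGraph.induce (S : Set Lat)ᶜ).Connected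
  hop_pos : ∀ x ∈ S, 0 < hop S x
  two_le_length : ∀ R ∈ ribbons (S : Set Lat), 2 ≤ R.ncard
  root_ribbon : ∃ R ∈ ribbons (S : Set Lat), HasGradient S R 2 ∧ R.ncard = 3 ∧
    ∀ R' ∈ ribbons (S : Set Lat), HasGradient S R' 2 → R' = R
  boundary_notMem : ∀ x ∈ S, (∃ y, y ∉ S ∧ latGraph.Adj x y) → x ∉ D
  smooth_two : ∀ x ∈ S, ∀ y ∈ S, sqDist x y = 4 →
    ∀ z, latGraph.Adj x z → latGraph.Adj y z → z ∈ S
  smooth_sqrt_three : ∀ x ∈ S, ∀ y ∈ S, sqDist x y = 3 →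
    ∃ z, latGraph.Adj x z ∧ latGraph.Adj y z ∧ z ∈ S

/-- `I` is an initial set of idle robots: every idle ribbon is empty or filled, and the idle
ribbons closer to the root than a filled one are filled. -/
structure IdleConfiguration (I : Finset Lat) : Prop where
  subset_H2 : (I : Set Lat) ⊆ H2
  filled_or_empty : ∀ R ∈ ribbons H2, R ⊆ I ∨ Disjoint R I
  filled_of_lt : ∀ R ∈ ribbons H2, ∀ R' ∈ ribbons H2, TreeLt H2 R R' → R' ⊆ I → R ⊆ I

/-- `lt` is a complete tree order: a strict total order of the ribbons of `S` that extends the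
tree order. -/
structure CompleteTreeOrder (S : Finset Lat) (lt : Set Lat → Set Lat → Prop) : Prop where
  irrefl : ∀ R ∈ ribbons (S : Set Lat), ¬ lt R R
  trans : ∀ R₁ ∈ ribbons (S : Set Lat), ∀ R₂ ∈ ribbons (S : Set Lat),
    ∀ R₃ ∈ ribbons (S : Set Lat), lt R₁ R₂ → lt R₂ R₃ → lt R₁ R₃
  total : ∀ R₁ ∈ ribbons (S : Set Lat), ∀ R₂ ∈ ribbons (S : Set Lat),
    R₁ ≠ R₂ → lt R₁ R₂ ∨ lt R₂ R₁
  extends_tree : ∀ R₁ ∈ ribbons (S : Set Lat), ∀ R₂ ∈ ribbons (S : Set Lat),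
    TreeLt S R₁ R₂ → lt R₁ R₂

/-- The data of a run: the robot radius `r`, the lattice points `S` of the shape, the set `D` of
hole points, the initial idle robots `I`, and the order chosen on the ribbons of `S`. -/
structure Setup where
  r : ℝ
  S : Finset Lat
  D : Finset Lat
  I : Finset Lat
  lt : Set Lat → Set Lat → Prop

/-- The standing assumptions. -/
structure Setup.Admissible (P : Setup) : Prop where
  r_pos : 0 < P.r
  proper : ProperRibbonization P.S P.D
  idle : IdleConfiguration P.I
  enough : P.S.card ≤ P.I.card
  order : CompleteTreeOrder P.S P.lt

/-! ### The movement sequences -/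

/-- The element of `A` that precedes all others in the order `before`. -/
def pickFirst (before : Lat → Lat → Prop) (A : Set Lat) : Lat :=
  Classical.epsilon fun x => x ∈ A ∧ ∀ y ∈ A, y ≠ x → before x y

/-- What is left of `A` after `k` successive picks. -/
def remaining (before : Lat → Lat → Prop) (A : Set Lat) : ℕ → Set Lat
  | 0 => A
  | k + 1 => remaining before A k \ {pickFirst before (remaining before A k)}

/-- The `k`-th pick from `A`, for `k ≥ 1`. -/
def pick (before : Lat → Lat → Prop) (A : Set Lat) (k : ℕ) : Lat :=
  pickFirst before (remaining before A (k - 1))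

namespace Setup

variable (P : Setup)

/-- The number of lattice points of the shape. -/
def N : ℕ := P.S.card

/-- The lattice spacing `d = 2r / (√3 - 1)`. -/
def d : ℝ := 2 * P.r / (Real.sqrt 3 - 1)

/-- The activation sequence: largest point on the largest idle ribbon. -/
def s (k : ℕ) : Lat :=
  pick (fun x y => TreeLt H2 (ribbonOf H2 y) (ribbonOf H2 x) ∨
    (ribbonOf H2 x = ribbonOf H2 y ∧ InFront H2 y x)) P.I k

/-- The assembly sequence: smallest point on the smallest ribbon of `S`. -/
def t (k : ℕ) : Lat :=
  pick (fun x y => P.lt (ribbonOf P.S x) (ribbonOf P.S y) ∨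
    (ribbonOf P.S x = ribbonOf P.S y ∧ InFront P.S x y)) P.S k

/-- `x` precedes `y` when the smallest point on the largest ribbon of `S` comes first. -/
def RetreatBefore (x y : Lat) : Prop :=
  P.lt (ribbonOf P.S y) (ribbonOf P.S x) ∨
    (ribbonOf P.S x = ribbonOf P.S y ∧ InFront P.S x y)

/-- The reactivation sequence. -/
def sr (k : ℕ) : Lat := pick P.RetreatBefore P.S k

/-- The robot at `x ∈ S` is a recycled robot: `ID(x) < c(R(x))`, where `c(R)` is the number of
hole points on `R`. -/
def IsRecycled (x : Lat) : Prop :=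
  ribbonIndex P.S x < (ribbonOf P.S x ∩ P.D).ncard

open Classical in
/-- The `k`-th entry of the reassembly sequence, given the set `used` of the earlier entries. -/
def trNext (used : Set Lat) (k : ℕ) : Lat :=
  if P.IsRecycled (P.sr k) then
    pickFirst (fun x y => TreeLt H2 (ribbonOf H2 x) (ribbonOf H2 y) ∨
      (ribbonOf H2 x = ribbonOf H2 y ∧ InFront H2 x y)) (P.s '' Set.Icc 1 P.N \ used)
  else
    pickFirst P.RetreatBefore ((P.S \ P.D : Set Lat) \ used)

/-- The set of the first `k` entries of the reassembly sequence. -/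
def trUsed : ℕ → Set Lat
  | 0 => ∅
  | k + 1 => insert (P.trNext (trUsed k) (k + 1)) (trUsed k)

/-- The reassembly sequence. -/
def tr (k : ℕ) : Lat := P.trNext (P.trUsed (k - 1)) k

/-- The lattice point at which the active robot of epoch `T` starts. -/
def source (T : ℕ) : Lat := if T ≤ P.N then P.s T else P.sr (T - P.N)

/-- The lattice point at which the active robot of epoch `T` ends. -/
def target (T : ℕ) : Lat := if T ≤ P.N then P.t T else P.tr (T - P.N)

/-- The lattice points occupied by non-moving robots after epoch `T`. -/
def occAfter : ℕ → Set Lat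
  | 0 => seeds ∪ P.I
  | T + 1 => insert (P.target (T + 1)) (occAfter T \ {P.source (T + 1)})

/-- The lattice points occupied by non-moving robots while the active robot of epoch `T ≥ 1`
moves. -/
def occDuring (T : ℕ) : Set Lat := P.occAfter (T - 1) \ {P.source T}

/-- The lattice points occupied or virtually occupied during epoch `T`: every unoccupied point
of `S` carries a virtual robot. -/
def extOccDuring (T : ℕ) : Set Lat := P.occDuring T ∪ P.S

end Setup

/-! ### Paths -/

/-- The points of the plane whose distance to the nearest point of `A` is `d`. -/
def edgePath (d : ℝ) (A : Set Lat) : Set ℂ :=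
  {z | (∃ a ∈ A, dist z (pos d a) = d) ∧ ∀ a ∈ A, d ≤ dist z (pos d a)}

/-- The arc of central angle `π / 3` that starts at `q` and turns clockwise about `c`. -/
def arcPoints (d : ℝ) (c q : Lat) : Set ℂ :=
  {z | ∃ θ ∈ Set.Icc (0 : ℝ) (Real.pi / 3),
    z = pos d c + (pos d q - pos d c) * Complex.exp (-(θ : ℂ) * Complex.I)}

/-- A path is given by its starting point and the list of the centers about which the robot
successively turns clockwise by `π / 3`. This is its end point. -/
def pathEnd : Lat → List Lat → Lat
  | q, [] => q
  | q, c :: cs => pathEnd (rotCW c q) cs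

/-- The lattice points at the ends of the arcs of a path, in order. -/
def pathVertices : Lat → List Lat → List Lat
  | q, [] => [q]
  | q, c :: cs => q :: pathVertices (rotCW c q) cs

/-- The arcs of a path, as pairs (center, starting point). -/
def pathArcs : Lat → List Lat → List (Lat × Lat)
  | _, [] => []
  | q, c :: cs => (c, q) :: pathArcs (rotCW c q) cs

/-- All points of the plane on a path. -/
def pathTrace (d : ℝ) (q : Lat) (cs : List Lat) : Set ℂ :=
  {z | z = pos d q ∨ ∃ a ∈ pathArcs q cs, z ∈ arcPoints d a.1 a.2}

/-- Every arc of the path turns about a point of `A`, at distance `d` from it, and all along the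
path the distance to the nearest point of `A` is `d`. -/
def Follows (d : ℝ) (A : Set Lat) (q : Lat) (cs : List Lat) : Prop :=
  ∀ a ∈ pathArcs q cs,
    a.1 ∈ A ∧ latGraph.Adj a.1 a.2 ∧ arcPoints d a.1 a.2 ⊆ edgePath d A

namespace Setup

variable (P : Setup)

/-- The path is unobstructed for the active robot of epoch `T`: the centers of all non-moving
robots are at distance at least `2r` from it. -/
def Unobstructed (T : ℕ) (q : Lat) (cs : List Lat) : Prop :=
  ∀ z ∈ pathTrace P.d q cs, ∀ a ∈ P.occDuring T, 2 * P.r ≤ dist z (pos P.d a)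

/-- The robots of the parent ribbon of `R` that are present during epoch `T`. -/
def parentRobots (T : ℕ) (R : Set Lat) : Set Lat := P.occDuring T ∩ parentVertices P.S R

/-- A path along the ribbon `R` from `q` to `q'`: it visits vertices of `R` only and turns
clockwise about the nearest robot of the parent ribbon at distance `d`. -/
def IsRibbonPath (T : ℕ) (R : Set Lat) (q q' : Lat) (cs : List Lat) : Prop :=
  pathEnd q cs = q' ∧ (∀ v ∈ pathVertices q cs, v ∈ R) ∧
    Follows P.d (P.parentRobots T R) q cs

/-- The exterior path from `m` to `q'`: a segment, directed clockwise and without repetition, of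
the extended edge-following path of epoch `T`. -/
def IsExteriorPath (T : ℕ) (m q' : Lat) (cs : List Lat) : Prop :=
  pathEnd m cs = q' ∧ (pathVertices m cs).Nodup ∧ Follows P.d (P.extOccDuring T) m cs

/-- The recycle path of epoch `T` from `q` to `q'`, where the ribbon `R` of `q` has the first
vertex `x` and the merging point `m`: the interior path `int` from `q` to `x`, the bridging path
from `x` to `m`, a single turn about the parent robot `b`, and the exterior path `ext` from `m`
to `q'`. -/
def IsRecyclePath (T : ℕ) (R : Set Lat) (x m q q' : Lat)
    (int : List Lat) (b : Lat) (ext : List Lat) : Prop :=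
  P.IsRibbonPath T R q x int ∧
  (pathEnd x [b] = m ∧ Follows P.d (P.parentRobots T R) x [b]) ∧
  P.IsExteriorPath T m q' ext

end Setup

end AddSubtract

end

noncomputable section

namespace AddSubtract

/-! ### Directions and neighbours -/

/-! The proof combines a structure theorem for simply connected lattice sets, a walk around the
shape, a clearance estimate for a single arc, and a count of recycled robots.

Structure. Adjoin to `S` the origin and its six neighbours. The result `hull S` is finite and
connected, and closed walks in it wind around no outside point
(`ProperRibbonization.windingTrivial`). Such a set can be dismantled: as long as two points are
left, some vertex other than the origin has a neighbour equal or adjacent to all its other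
neighbours (`exists_dominated`). Deleting that vertex does not change the remaining distances to the
origin, so induction on the cardinality (`level_structure`) gives two local facts: two parents
(neighbours one level lower) of a vertex are adjacent, and adjacent vertices of equal level have a
common parent. Hence a vertex has at most two parents, the frontmost one determines its successor
`nxt`, and ribbons are chains of successors. No ribbon closes up, because `frontKey` decreases along
arcs: it encodes the chain of frontmost parents, with a base-six digit at each level that counts
turns about the parent. So each ribbon of `S` has one first vertex, and its only merging point is
the free successor of that vertex.

Walk. A robot that keeps turning clockwise from the merging point of `R` rounds the ribbons of the
shape, with a measure built from `frontKey` as termination argument (`exists_turns_to_front`). It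
reaches the point to the right of `p2` without turning about `R` or its descendants
(`exists_turns_to_root`). From there an explicit walk passes the seeds and follows a ring of the
idle half-plane to the target (`exists_turns_from_root`). Erasing loops gives the exterior path.

Uniqueness and clearance. The obstacles are smooth: the occupied neighbours of a free point are
consecutive and never opposite (`smoothSet_obstacles`). Hence at most one turn about an obstacle
leads from a free position to a free position, which gives uniqueness. An arc keeps distance `d`
from every lattice point except its two ends and the mirror image of its center. The mirror image is
`√3 d` away from the center, hence at least `(√3 - 1) d = 2 r` away from the arc, and smoothness
shows that it is no obstacle. Thus a path is unobstructed as soon as its lattice points are free.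

Counting. Every ribbon has as many recycled robots as hole points. While a robot of `R` moves, the
ribbons smaller than `R` are therefore untouched, those larger than `R` have robots on all their
points outside `D`, and the part of `R` to be crossed is empty. A center met on the way around the
shape borders a free point outside `S`, so it is not a hole; since it is not on `R` either, a real
robot stands there. -/

/-- The six unit vectors of the lattice, in counterclockwise order. -/
def dir (i : ZMod 6) : Lat :=
  (![(1, 0), (0, 1), (-1, 1), (-1, 0), (0, -1), (1, -1)] : Fin 6 → Lat) i

/-- The neighbour of `v` in the direction `i`. -/
def nb (v : Lat) (i : ZMod 6) : Lat := v + dir i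

theorem zmod_six_cases (i : ZMod 6) : i = 0 ∨ i = 1 ∨ i = 2 ∨ i = 3 ∨ i = 4 ∨ i = 5 := by
  revert i; decide

theorem nb_zero (v : Lat) : nb v 0 = (v.1 + 1, v.2) := by
  simp [nb, show dir 0 = (1, 0) from rfl, Prod.ext_iff]
theorem nb_one (v : Lat) : nb v 1 = (v.1, v.2 + 1) := by
  simp [nb, show dir 1 = (0, 1) from rfl, Prod.ext_iff]
theorem nb_two (v : Lat) : nb v 2 = (v.1 - 1, v.2 + 1) := by
  simp [nb, show dir 2 = (-1, 1) from rfl, Prod.ext_iff, sub_eq_add_neg]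
theorem nb_three (v : Lat) : nb v 3 = (v.1 - 1, v.2) := by
  simp [nb, show dir 3 = (-1, 0) from rfl, Prod.ext_iff, sub_eq_add_neg]
theorem nb_four (v : Lat) : nb v 4 = (v.1, v.2 - 1) := by
  simp [nb, show dir 4 = (0, -1) from rfl, Prod.ext_iff, sub_eq_add_neg]
theorem nb_five (v : Lat) : nb v 5 = (v.1 + 1, v.2 - 1) := by
  simp [nb, show dir 5 = (1, -1) from rfl, Prod.ext_iff, sub_eq_add_neg]

theorem nb_inj {v : Lat} {i j : ZMod 6} : nb v i = nb v j ↔ i = j := by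
  rw [nb, nb, add_right_inj]
  revert i j; decide

theorem nb_nb_add_three (v : Lat) (i : ZMod 6) : nb (nb v i) (i + 3) = v := by
  have : ∀ i, dir i + dir (i + 3) = 0 := by decide
  rw [nb, nb, add_assoc, this, add_zero]

theorem nb_nb_add_two (v : Lat) (i : ZMod 6) : nb (nb v i) (i + 2) = nb v (i + 1) := by
  have : ∀ i, dir i + dir (i + 2) = dir (i + 1) := by decide
  rw [nb, nb, add_assoc, this, nb]

theorem nb_nb_add_four (v : Lat) (i : ZMod 6) : nb (nb v i) (i + 4) = nb v (i + 5) := by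
  have : ∀ i, dir i + dir (i + 4) = dir (i + 5) := by decide
  rw [nb, nb, add_assoc, this, nb]

theorem nb_nb_comm (v : Lat) (i j : ZMod 6) : nb (nb v i) j = nb (nb v j) i := by
  simp [nb, add_right_comm]

theorem sqDist_comm (x y : Lat) : sqDist x y = sqDist y x := by unfold sqDist; ring

theorem sqDist_nb_nb (v : Lat) (i j : ZMod 6) :
    sqDist (nb v i) (nb v j) = sqDist (dir i) (dir j) := by
  simp [sqDist, nb]

theorem sqDist_eq_one_iff {a b : ℤ} : a ^ 2 + a * b + b ^ 2 = 1 ↔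
    (a = 1 ∧ b = 0) ∨ (a = 0 ∧ b = 1) ∨ (a = -1 ∧ b = 1) ∨ (a = -1 ∧ b = 0) ∨
      (a = 0 ∧ b = -1) ∨ (a = 1 ∧ b = -1) := by
  constructor
  · intro h
    have h1 : a ≤ 1 := by nlinarith [sq_nonneg (a + 2 * b)]
    have h2 : -1 ≤ a := by nlinarith [sq_nonneg (a + 2 * b)]
    have h3 : b ≤ 1 := by nlinarith [sq_nonneg (b + 2 * a)]
    have h4 : -1 ≤ b := by nlinarith [sq_nonneg (b + 2 * a)]
    interval_cases a <;> interval_cases b <;> simp_all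
  · rintro (h | h | h | h | h | h) <;> rw [h.1, h.2] <;> norm_num

theorem adj_coord {x y : Lat} : latGraph.Adj x y ↔
    (y.1 = x.1 + 1 ∧ y.2 = x.2) ∨ (y.1 = x.1 ∧ y.2 = x.2 + 1) ∨
    (y.1 = x.1 - 1 ∧ y.2 = x.2 + 1) ∨ (y.1 = x.1 - 1 ∧ y.2 = x.2) ∨
    (y.1 = x.1 ∧ y.2 = x.2 - 1) ∨ (y.1 = x.1 + 1 ∧ y.2 = x.2 - 1) := by
  change sqDist x y = 1 ↔ _
  rw [sqDist_comm, sqDist, sqDist_eq_one_iff]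
  omega

theorem adj_iff_nb {x y : Lat} : latGraph.Adj x y ↔ ∃ i, y = nb x i := by
  rw [adj_coord]
  constructor
  · rintro (h | h | h | h | h | h)
    · exact ⟨0, by rw [nb_zero]; exact Prod.ext h.1 h.2⟩
    · exact ⟨1, by rw [nb_one]; exact Prod.ext h.1 h.2⟩
    · exact ⟨2, by rw [nb_two]; exact Prod.ext h.1 h.2⟩
    · exact ⟨3, by rw [nb_three]; exact Prod.ext h.1 h.2⟩
    · exact ⟨4, by rw [nb_four]; exact Prod.ext h.1 h.2⟩
    · exact ⟨5, by rw [nb_five]; exact Prod.ext h.1 h.2⟩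
  · rintro ⟨i, rfl⟩
    rcases zmod_six_cases i with h | h | h | h | h | h <;> subst h
    · rw [nb_zero]; simp
    · rw [nb_one]; simp
    · rw [nb_two]; simp
    · rw [nb_three]; simp
    · rw [nb_four]; simp
    · rw [nb_five]; simp

theorem adj_nb (v : Lat) (i : ZMod 6) : latGraph.Adj v (nb v i) := adj_iff_nb.2 ⟨i, rfl⟩

theorem adj_nb_nb {v : Lat} {i j : ZMod 6} :
    latGraph.Adj (nb v i) (nb v j) ↔ j = i + 1 ∨ j = i + 5 := by
  change sqDist _ _ = 1 ↔ _
  rw [sqDist_nb_nb]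
  revert i j; decide

/-- A clockwise turn of `q` about a neighbour shifts the direction by one, so arcs become arithmetic
in `ZMod 6`. -/
theorem rotCW_nb (q : Lat) (i : ZMod 6) : rotCW (nb q i) q = nb q (i + 1) := by
  rcases zmod_six_cases i with h | h | h | h | h | h <;> subst h
  · rw [nb_zero, zero_add, nb_one]; simp [rotCW]
  · rw [nb_one, show (1 : ZMod 6) + 1 = 2 from rfl, nb_two]; simp [rotCW, sub_eq_add_neg]
  · rw [nb_two, show (2 : ZMod 6) + 1 = 3 from rfl, nb_three]; simp [rotCW, sub_eq_add_neg]
  · rw [nb_three, show (3 : ZMod 6) + 1 = 4 from rfl, nb_four]; simp [rotCW]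
  · rw [nb_four, show (4 : ZMod 6) + 1 = 5 from rfl, nb_five]; simp [rotCW]
  · rw [nb_five, show (5 : ZMod 6) + 1 = 0 from rfl, nb_zero]; simp [rotCW]

theorem rotCW_center_nb (c : Lat) (j : ZMod 6) : rotCW c (nb c j) = nb c (j + 5) := by
  have h := rotCW_nb (nb c j) (j + 3)
  rwa [nb_nb_add_three, add_assoc, show (3 : ZMod 6) + 1 = 4 from rfl, nb_nb_add_four] at h

/-! ### Winding numbers -/

/-- The signed crossing of the edge from `u` to `v` with a ray going east from `p`, just above
the row of `p`. -/
def crossing (p u v : Lat) : ℤ :=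
  if u.2 = p.2 ∧ v.2 = p.2 + 1 ∧ p.1 < u.1 then 1
  else if v.2 = p.2 ∧ u.2 = p.2 + 1 ∧ p.1 < v.1 then -1 else 0

/-- All closed walks in `X` have winding number zero about `p`. -/
def HasPotential (X : Set Lat) (p : Lat) : Prop :=
  ∃ θ : Lat → ℤ, ∀ u ∈ X, ∀ v ∈ X, latGraph.Adj u v → θ v - θ u = crossing p u v

/-- The change of potential from a point `p` to its neighbour `p'`. -/
def potentialShift (p p' z : Lat) : ℤ :=
  if p'.2 = p.2 then 0
  else if p'.2 = p.2 + 1 then (if z.2 = p'.2 ∧ p'.1 < z.1 then -1 else 0)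
  else (if z.2 = p.2 ∧ p.1 < z.1 then 1 else 0)

theorem crossing_antisymm (p u v : Lat) : crossing p v u = -crossing p u v := by
  unfold crossing
  split_ifs <;> omega

theorem crossing_of_flat {p u v : Lat} (h : v.2 = u.2) : crossing p u v = 0 := by
  unfold crossing
  split_ifs <;> omega

theorem crossing_of_up {p u v : Lat} (h : v.2 = u.2 + 1) :
    crossing p u v = if u.2 = p.2 ∧ p.1 < u.1 then 1 else 0 := by
  unfold crossing
  split_ifs <;> omega

/-- The rays from two adjacent points bound a thin strip, and `potentialShift` is its signed
indicator. An edge that avoids both points crosses only one of the rays exactly when it enters or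
leaves the strip. -/
theorem crossing_sub_crossing_up {p p' u v : Lat} (h : latGraph.Adj p p')
    (huv : latGraph.Adj u v) (hup : u.2 ≤ v.2)
    (hu : u ≠ p) (hu' : u ≠ p') (hv : v ≠ p) (hv' : v ≠ p') :
    crossing p' u v - crossing p u v = potentialShift p p' v - potentialShift p p' u := by
  rw [adj_coord] at huv h
  rw [ne_eq, Prod.ext_iff] at hu hu' hv hv'
  have : v.2 = u.2 ∨ v.2 = u.2 + 1 := by omega
  rcases this with h2 | h2
  · rw [crossing_of_flat h2, crossing_of_flat h2]
    unfold potentialShift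
    split_ifs <;> omega
  · rw [crossing_of_up h2, crossing_of_up h2]
    unfold potentialShift
    split_ifs <;> omega

theorem crossing_sub_crossing {p p' u v : Lat} (h : latGraph.Adj p p') (huv : latGraph.Adj u v)
    (hu : u ≠ p) (hu' : u ≠ p') (hv : v ≠ p) (hv' : v ≠ p') :
    crossing p' u v - crossing p u v = potentialShift p p' v - potentialShift p p' u := by
  rcases le_total u.2 v.2 with h2 | h2
  · exact crossing_sub_crossing_up h huv h2 hu hu' hv hv'
  · have := crossing_sub_crossing_up h huv.symm h2 hv hv' hu hu'
    rw [crossing_antisymm p', crossing_antisymm p] at this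
    linarith

/-- Moving the base point along an edge outside `X` changes the crossing cocycle by a coboundary, so
exactness is preserved. -/
theorem HasPotential.transfer {X : Set Lat} {p p' : Lat} (h : HasPotential X p)
    (ha : latGraph.Adj p p') (hp : p ∉ X) (hp' : p' ∉ X) : HasPotential X p' := by
  obtain ⟨θ, hθ⟩ := h
  refine ⟨fun z => θ z + potentialShift p p' z, fun u hu v hv huv => ?_⟩
  have h1 := crossing_sub_crossing ha huv (ne_of_mem_of_not_mem hu hp)
    (ne_of_mem_of_not_mem hu hp') (ne_of_mem_of_not_mem hv hp) (ne_of_mem_of_not_mem hv hp')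
  have h2 := hθ u hu v hv huv
  linarith

theorem HasPotential.mono {X Y : Set Lat} {p : Lat} (h : HasPotential X p) (hY : Y ⊆ X) :
    HasPotential Y p :=
  h.imp fun _ hθ u hu v hv => hθ u (hY hu) v (hY hv)

theorem hasPotential_of_east {X : Set Lat} {p : Lat} (h : ∀ x ∈ X, x.2 = p.2 → ¬ p.1 < x.1) :
    HasPotential X p := by
  refine ⟨fun _ => 0, fun u hu v hv _ => ?_⟩
  have h1 := h u hu
  have h2 := h v hv
  unfold crossing
  beta_reduce
  split_ifs <;> omega

/-- Every point of `X` in the row of `p` lies under the ray, so an edge crosses the ray exactly when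
it passes between that row and the next; being above the row is the potential. -/
theorem hasPotential_of_west {X : Set Lat} {p : Lat} (h : ∀ x ∈ X, x.2 = p.2 → p.1 < x.1) :
    HasPotential X p := by
  refine ⟨fun z => if p.2 < z.2 then 1 else 0, fun u hu v hv huv => ?_⟩
  have h1 := h u hu
  have h2 := h v hv
  rw [adj_coord] at huv
  unfold crossing
  beta_reduce
  split_ifs <;> omega

/-- Closed walks in `X` wind around points of `X` only. -/
def WindingTrivial (X : Set Lat) : Prop := ∀ p, p ∉ X → HasPotential X p

/-- Adjacency within a set of lattice points. -/
def AdjIn (X : Set Lat) (x y : Lat) : Prop := x ∈ X ∧ y ∈ X ∧ latGraph.Adj x y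

theorem AdjIn.symm {X : Set Lat} {x y : Lat} (h : AdjIn X x y) : AdjIn X y x :=
  ⟨h.2.1, h.1, h.2.2.symm⟩

/-- Any two points of `X` are joined by a walk in `X`. -/
def ConnectedSet (X : Set Lat) : Prop := ∀ x ∈ X, ∀ y ∈ X, Relation.ReflTransGen (AdjIn X) x y

/-- All neighbours of `v` in `X` are equal or adjacent to one of them. -/
def Dominated (X : Set Lat) (v : Lat) : Prop :=
  ∃ c ∈ X, latGraph.Adj v c ∧ ∀ y ∈ X, latGraph.Adj v y → y = c ∨ latGraph.Adj c y

/-- If `v` has two neighbours in `X` at distance `√3`, their middle and its opposite not being in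
`X`, then every walk in `X` between the two passes through `v`. -/
theorem not_reachable_of_gap {X : Set Lat} (hX : WindingTrivial X) {v : Lat} (hv : v ∈ X)
    {i : ZMod 6} (hi : i = 0 ∨ i = 3) (ha : nb v i ∈ X) (hb : nb v (i + 2) ∈ X)
    (hm : nb v (i + 1) ∉ X) (ho : nb v (i + 4) ∉ X) :
    ¬ Relation.ReflTransGen (AdjIn (X \ {v})) (nb v i) (nb v (i + 2)) := by
  intro hr
  obtain ⟨θ₁, h₁⟩ := hX _ hm
  obtain ⟨θ₂, h₂⟩ := hX _ ho
  set m := nb v (i + 1) with hm'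
  set o := nb v (i + 4) with ho'
  -- Away from `v`, `m` and `o`, moving the base point from `m` over `v` to `o` costs only shift
  -- terms, so this combination is constant along the walk. The two edges through `v` contradict
  -- that: the closed walk they complete separates `m` from `o`.
  have key : ∀ x, Relation.ReflTransGen (AdjIn (X \ {v})) (nb v i) x →
      θ₁ x + potentialShift m v x + potentialShift v o x - θ₂ x =
      θ₁ (nb v i) + potentialShift m v (nb v i) + potentialShift v o (nb v i) - θ₂ (nb v i) := by
    intro x hx
    induction hx with
    | refl => rfl
    | @tail b c _ hbc ih =>
      rw [← ih]
      have e1 := h₁ b hbc.1.1 c hbc.2.1.1 hbc.2.2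
      have e2 := h₂ b hbc.1.1 c hbc.2.1.1 hbc.2.2
      have e3 := crossing_sub_crossing (adj_nb v (i + 1)).symm hbc.2.2
        (ne_of_mem_of_not_mem hbc.1.1 hm) hbc.1.2 (ne_of_mem_of_not_mem hbc.2.1.1 hm) hbc.2.1.2
      have e4 := crossing_sub_crossing (adj_nb v (i + 4)) hbc.2.2
        hbc.1.2 (ne_of_mem_of_not_mem hbc.1.1 ho) hbc.2.1.2 (ne_of_mem_of_not_mem hbc.2.1.1 ho)
      rw [← hm'] at e3
      rw [← ho'] at e4
      linarith
  have k := key _ hr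
  have f1 := h₁ _ ha _ hv (adj_nb v i).symm
  have f2 := h₁ _ hv _ hb (adj_nb v (i + 2))
  have f3 := h₂ _ ha _ hv (adj_nb v i).symm
  have f4 := h₂ _ hv _ hb (adj_nb v (i + 2))
  clear_value m o
  obtain ⟨a, b⟩ := v
  clear key h₁ h₂ hr ha hb hm ho hv
  rcases hi with rfl | rfl
  · rw [show (0 : ZMod 6) + 1 = 1 from rfl, nb_one] at hm'
    rw [show (0 : ZMod 6) + 4 = 4 from rfl, nb_four] at ho'
    rw [show (0 : ZMod 6) + 2 = 2 from rfl] at k f2 f4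
    subst hm' ho'
    simp [nb_zero, nb_two, crossing, potentialShift] at k f1 f2 f3 f4
    omega
  · rw [show (3 : ZMod 6) + 1 = 4 from rfl, nb_four] at hm'
    rw [show (3 : ZMod 6) + 4 = 1 from rfl, nb_one] at ho'
    rw [show (3 : ZMod 6) + 2 = 5 from rfl] at k f2 f4
    subst hm' ho'
    simp [nb_three, nb_five, crossing, potentialShift] at k f1 f2 f3 f4
    omega

/-- On the hexagon around `c` the points `b, v, a, y` are consecutive, so `y` is opposite to `b`. -/
theorem ne_of_common_neighbors {c v a b y : Lat} (hv : latGraph.Adj c v) (ha : latGraph.Adj c a)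
    (hb : latGraph.Adj c b) (hy : latGraph.Adj c y) (hva : latGraph.Adj v a)
    (hvb : latGraph.Adj v b) (hab : a ≠ b) (hya : latGraph.Adj a y) (hyv : y ≠ v) :
    ¬ (y = b ∨ latGraph.Adj y b) := by
  obtain ⟨i, rfl⟩ := adj_iff_nb.1 hv
  obtain ⟨j, rfl⟩ := adj_iff_nb.1 ha
  obtain ⟨k, rfl⟩ := adj_iff_nb.1 hb
  obtain ⟨l, rfl⟩ := adj_iff_nb.1 hy
  rw [adj_nb_nb, nb_inj]
  rw [adj_nb_nb] at hva hvb hya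
  rw [ne_eq, nb_inj] at hab hyv
  clear hv ha hb hy
  revert i j k l; decide

/-- On the hexagon around `c` the points `b, v, a, y, z` are consecutive, so `z` and `b` are two
steps apart. -/
theorem ne_of_common_neighbors' {c v a b y z : Lat} (hv : latGraph.Adj c v)
    (ha : latGraph.Adj c a) (hb : latGraph.Adj c b) (hy : latGraph.Adj c y)
    (hz : latGraph.Adj c z) (hva : latGraph.Adj v a) (hvb : latGraph.Adj v b) (hab : a ≠ b)
    (hya : latGraph.Adj a y) (hyv : y ≠ v) (hzy : latGraph.Adj y z) (hza : z ≠ a) :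
    ¬ (z = b ∨ latGraph.Adj z b) := by
  obtain ⟨i, rfl⟩ := adj_iff_nb.1 hv
  obtain ⟨j, rfl⟩ := adj_iff_nb.1 ha
  obtain ⟨k, rfl⟩ := adj_iff_nb.1 hb
  obtain ⟨l, rfl⟩ := adj_iff_nb.1 hy
  obtain ⟨m, rfl⟩ := adj_iff_nb.1 hz
  rw [adj_nb_nb, nb_inj]
  rw [adj_nb_nb] at hva hvb hya hzy
  rw [ne_eq, nb_inj] at hab hyv hza
  clear hv ha hb hy hz
  rcases hva with rfl | rfl <;> rcases hvb with rfl | rfl <;> rcases hya with rfl | rfl <;>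
    rcases hzy with rfl | rfl <;> revert i <;> decide

/-- On the hexagon around `c` the points `y, a, v, b, z` are consecutive, so `y` and `z` are two
steps apart. -/
theorem ne_of_common_neighbors'' {c v a b y z : Lat} (hv : latGraph.Adj c v)
    (ha : latGraph.Adj c a) (hb : latGraph.Adj c b) (hy : latGraph.Adj c y)
    (hz : latGraph.Adj c z) (hva : latGraph.Adj v a) (hvb : latGraph.Adj v b) (hab : a ≠ b)
    (hya : latGraph.Adj a y) (hyv : y ≠ v) (hzb : latGraph.Adj b z) (hzv : z ≠ v) :
    ¬ (y = z ∨ latGraph.Adj y z) := by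
  obtain ⟨i, rfl⟩ := adj_iff_nb.1 hv
  obtain ⟨j, rfl⟩ := adj_iff_nb.1 ha
  obtain ⟨k, rfl⟩ := adj_iff_nb.1 hb
  obtain ⟨l, rfl⟩ := adj_iff_nb.1 hy
  obtain ⟨m, rfl⟩ := adj_iff_nb.1 hz
  rw [adj_nb_nb, nb_inj]
  rw [adj_nb_nb] at hva hvb hya hzb
  rw [ne_eq, nb_inj] at hab hyv hzv
  clear hv ha hb hy hz
  rcases hva with rfl | rfl <;> rcases hvb with rfl | rfl <;> rcases hya with rfl | rfl <;>
    rcases hzb with rfl | rfl <;> revert i <;> decide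

theorem reflTransGen_adjIn_symm {X : Set Lat} {x y : Lat}
    (h : Relation.ReflTransGen (AdjIn X) x y) : Relation.ReflTransGen (AdjIn X) y x := by
  induction h with
  | refl => exact .refl
  | tail _ h ih => exact .head h.symm ih

/-! ### Dominated vertices -/

/-- The neighbours are confined to three consecutive directions. The middle one dominates if it is
present; otherwise a single remaining neighbour dominates, and only two outer ones give the gap. -/
theorem dominated_or_gap {X : Set Lat} {v : Lat} {i : ZMod 6} (h3 : nb v (i + 3) ∉ X)
    (h4 : nb v (i + 4) ∉ X) (h5 : nb v (i + 5) ∉ X) (hn : ∃ y ∈ X, latGraph.Adj v y) :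
    Dominated X v ∨ (nb v i ∈ X ∧ nb v (i + 1) ∉ X ∧ nb v (i + 2) ∈ X) := by
  have hcase : ∀ y ∈ X, latGraph.Adj v y → y = nb v i ∨ y = nb v (i + 1) ∨ y = nb v (i + 2) := by
    intro y hy hvy
    obtain ⟨j, rfl⟩ := adj_iff_nb.1 hvy
    have : j = i ∨ j = i + 1 ∨ j = i + 2 ∨ j = i + 3 ∨ j = i + 4 ∨ j = i + 5 := by
      clear hvy hy h3 h4 h5
      revert i j; decide
    rcases this with rfl | rfl | rfl | rfl | rfl | rfl <;> tauto
  by_cases h1 : nb v (i + 1) ∈ X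
  · refine .inl ⟨_, h1, adj_nb _ _, fun y hy hvy => ?_⟩
    rcases hcase y hy hvy with rfl | rfl | rfl
    · right; rw [adj_nb_nb]; right; rw [add_assoc, show (1 : ZMod 6) + 5 = 0 from rfl, add_zero]
    · exact .inl rfl
    · right; rw [adj_nb_nb]; left; rw [add_assoc]; rfl
  by_cases h0 : nb v i ∈ X
  · by_cases h2 : nb v (i + 2) ∈ X
    · exact .inr ⟨h0, h1, h2⟩
    · refine .inl ⟨_, h0, adj_nb _ _, fun y hy hvy => ?_⟩
      rcases hcase y hy hvy with rfl | rfl | rfl <;> tauto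
  · obtain ⟨y, hy, hvy⟩ := hn
    have h2 : nb v (i + 2) ∈ X := by
      rcases hcase y hy hvy with rfl | rfl | rfl <;> tauto
    refine .inl ⟨_, h2, adj_nb _ _, fun y hy hvy => ?_⟩
    rcases hcase y hy hvy with rfl | rfl | rfl <;> tauto

theorem exists_row_bound (X : Finset Lat) : ∃ M : ℤ, ∀ x ∈ X, x.2 ≤ M := by
  obtain ⟨M, hM⟩ := (X.image Prod.snd).bddAbove
  exact ⟨M, fun x hx => hM (by simpa using ⟨x.1, hx⟩)⟩

/-- A point of `X` off the side can be moved up row by row without meeting the side: a neighbour in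
`C` would pull the point itself into `C`. Above the top row of `X` the potential is the one given
for `X`. -/
theorem hasPotential_of_side {X C : Finset Lat} {v : Lat} (hX : WindingTrivial (X : Set Lat))
    (hv : v ∈ X) (hC : C ⊆ X.erase v) (hcl : ∀ x ∈ C, ∀ y, AdjIn (↑X \ {v}) x y → y ∈ C) {p : Lat}
    (hp : p ∉ insert v C) : HasPotential (insert v C : Finset Lat) p := by
  have hsub : ((insert v C : Finset Lat) : Set Lat) ⊆ X := by
    intro x hx
    rcases Finset.mem_insert.1 (Finset.mem_coe.1 hx) with rfl | hx
    · exact hv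
    · exact Finset.mem_of_mem_erase (hC hx)
  obtain ⟨M, hM⟩ := exists_row_bound X
  have key : ∀ n : ℕ, ∀ p : Lat, M + 1 ≤ p.2 + n → p ∉ insert v C →
      HasPotential (insert v C : Finset Lat) p := by
    intro n
    induction n with
    | zero =>
      intro p hM' _
      exact (hX p fun hp => by have := hM p hp; simp at hM'; omega).mono hsub
    | succ n ih =>
      intro p hn hp
      by_cases hpX : p ∈ X
      swap
      · exact (hX p hpX).mono hsub
      -- There are two ways up, and at most one of them leads to `v`.
      obtain ⟨q, hpq, hqv, hq⟩ : ∃ q, latGraph.Adj p q ∧ q ≠ v ∧ q.2 = p.2 + 1 := by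
        by_cases h1 : nb p 1 = v
        · refine ⟨nb p 2, adj_nb _ _, ?_, by rw [nb_two]⟩
          rw [← h1, ne_eq, nb_inj]; decide
        · exact ⟨nb p 1, adj_nb _ _, h1, by rw [nb_one]⟩
      have hqY : q ∉ insert v C := by
        intro hqY
        have hqC := (Finset.mem_insert.1 hqY).resolve_left hqv
        have hpv : p ≠ v := fun e => hp (e ▸ Finset.mem_insert_self _ _)
        exact hp (Finset.mem_insert_of_mem (hcl q hqC p
          ⟨⟨Finset.mem_of_mem_erase (hC hqC), hqv⟩, ⟨hpX, hpv⟩, hpq.symm⟩))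
      exact (ih q (by push_cast at hn; omega) hqY).transfer hpq.symm hqY hp
  exact key (M + 1 - p.2).toNat p (by omega) hp

/-- A walk in `X` from `C` to `v` can leave `C` only through `v`. -/
theorem connectedSet_of_side {X C : Finset Lat} {v : Lat} (hconn : ConnectedSet (X : Set Lat))
    (hv : v ∈ X) (hC : C ⊆ X.erase v) (hcl : ∀ x ∈ C, ∀ y, AdjIn (↑X \ {v}) x y → y ∈ C) :
    ConnectedSet ((insert v C : Finset Lat) : Set Lat) := by
  have key : ∀ x, Relation.ReflTransGen (AdjIn (X : Set Lat)) x v → x ∈ insert v C →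
      Relation.ReflTransGen (AdjIn ((insert v C : Finset Lat) : Set Lat)) x v := by
    intro x hx
    induction hx using Relation.ReflTransGen.head_induction_on with
    | refl => exact fun _ => .refl
    | @head a b hab _ ih =>
      intro ha
      by_cases hav : a = v
      · rw [hav]
      have haC := (Finset.mem_insert.1 ha).resolve_left hav
      by_cases hbv : b = v
      · subst hbv
        exact .single ⟨ha, Finset.mem_insert_self _ _, hab.2.2⟩
      have hbC : b ∈ insert v C :=
        Finset.mem_insert_of_mem (hcl a haC b ⟨⟨hab.1, hav⟩, ⟨hab.2.1, hbv⟩, hab.2.2⟩)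
      exact .head ⟨ha, hbC, hab.2.2⟩ (ih hbC)
  have hsub : ∀ x ∈ insert v C, x ∈ X := by
    intro x hx
    rcases Finset.mem_insert.1 hx with rfl | hx
    · exact hv
    · exact Finset.mem_of_mem_erase (hC hx)
  intro x hx y hy
  have h1 := key x (hconn x (hsub x hx) v hv) hx
  have h2 := key y (hconn y (hsub y hy) v hv) hy
  exact h1.trans (reflTransGen_adjIn_symm h2)

/-- The neighbours of the last or first vertex in reading order lie in three consecutive directions.
If such a vertex is not dominated, `not_reachable_of_gap` makes it a cut vertex, and induction
applies to a side of the cut, with the cut vertex as the excluded one. -/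
theorem exists_dominated (X : Finset Lat) (hconn : ConnectedSet (X : Set Lat))
    (hX : WindingTrivial (X : Set Lat)) (hcard : 2 ≤ X.card) (z : Lat) :
    ∃ u ∈ X, u ≠ z ∧ Dominated (X : Set Lat) u := by
  induction hn : X.card using Nat.strong_induction_on generalizing X z with
  | _ n IH =>
  subst hn
  -- Points of the side other than `v` have all their neighbours in the side or equal to `v`, so
  -- domination there is domination in `X`.
  have side : ∀ (C : Finset Lat) (v w : Lat), v ∈ X → C ⊆ X.erase v →
      (∀ x ∈ C, ∀ y, AdjIn (↑X \ {v}) x y → y ∈ C) → C.Nonempty → w ∈ X → w ≠ v → w ∉ C →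
      ∃ u ∈ C, Dominated (X : Set Lat) u := by
    intro C v w hv hC hcl hne hw hwv hwC
    have hvC : v ∉ C := fun h => Finset.notMem_erase v X (hC h)
    have hsub : insert v C ⊆ X :=
      Finset.insert_subset hv (hC.trans (Finset.erase_subset _ _))
    have hlt : (insert v C).card < X.card := Finset.card_lt_card
      ⟨hsub, fun h => (Finset.mem_insert.1 (h hw)).elim hwv hwC⟩
    obtain ⟨u, hu, huv, c, hc, huc, hdom⟩ := IH _ hlt _ (connectedSet_of_side hconn hv hC hcl)
      (fun p hp => hasPotential_of_side hX hv hC hcl (by simpa using hp))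
      (by rw [Finset.card_insert_of_notMem hvC]; have := hne.card_pos; omega) v rfl
    have huC := (Finset.mem_insert.1 hu).resolve_left huv
    refine ⟨u, huC, c, hsub hc, huc, fun y hy huy => hdom y ?_ huy⟩
    by_cases hyv : y = v
    · simp [hyv]
    · exact Finset.mem_insert_of_mem (hcl u huC y ⟨⟨hsub hu, huv⟩, ⟨hy, hyv⟩, huy⟩)
  have extreme : ∀ v ∈ X, v ≠ z → ∀ i : ZMod 6, i = 0 ∨ i = 3 → nb v (i + 3) ∉ X →
      nb v (i + 4) ∉ X → nb v (i + 5) ∉ X → ∃ u ∈ X, u ≠ z ∧ Dominated (X : Set Lat) u := by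
    intro v hv hvz i hi h3 h4 h5
    have hn : ∃ y ∈ (X : Set Lat), latGraph.Adj v y := by
      obtain ⟨w, hw, hwv⟩ := Finset.exists_mem_ne (by omega : 1 < X.card) v
      rcases (hconn v hv w hw).cases_head with h | ⟨y, hy, _⟩
      · exact absurd h.symm hwv
      · exact ⟨y, hy.2.1, hy.2.2⟩
    rcases dominated_or_gap (X := (X : Set Lat)) h3 h4 h5 hn with h | ⟨ha, hm, hb⟩
    · exact ⟨v, hv, hvz, h⟩
    have hgap := not_reachable_of_gap hX hv hi ha hb hm h4
    classical
    set A := (X.erase v).filter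
      fun x => Relation.ReflTransGen (AdjIn (↑X \ {v})) (nb v i) x with hA
    have hne : ∀ j, nb v j ≠ v := fun j => (adj_nb v j).ne'
    have haA : nb v i ∈ A := by
      rw [hA, Finset.mem_filter, Finset.mem_erase]
      exact ⟨⟨hne i, ha⟩, .refl⟩
    have hbA : nb v (i + 2) ∉ A := by
      rw [hA, Finset.mem_filter]
      exact fun h => hgap h.2
    have hclA : ∀ x ∈ A, ∀ y, AdjIn (↑X \ {v}) x y → y ∈ A := by
      intro x hx y hxy
      rw [hA, Finset.mem_filter] at hx ⊢
      exact ⟨Finset.mem_erase.2 ⟨hxy.2.1.2, hxy.2.1.1⟩, hx.2.tail hxy⟩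
    -- Of the two sides of the cut, take one that does not contain the excluded vertex `z`.
    by_cases hzA : z ∈ A
    · obtain ⟨u, hu, hdom⟩ := side (X.erase v \ A) v (nb v i) hv Finset.sdiff_subset
        (fun x hx y hxy => by
          rw [Finset.mem_sdiff] at hx ⊢
          exact ⟨Finset.mem_erase.2 ⟨hxy.2.1.2, hxy.2.1.1⟩,
            fun hy => hx.2 (hclA y hy x hxy.symm)⟩)
        ⟨nb v (i + 2), Finset.mem_sdiff.2 ⟨Finset.mem_erase.2 ⟨hne _, hb⟩, hbA⟩⟩ ha (hne i)
        (fun h => (Finset.mem_sdiff.1 h).2 haA)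
      rw [Finset.mem_sdiff] at hu
      exact ⟨u, Finset.mem_of_mem_erase hu.1, fun e => hu.2 (e ▸ hzA), hdom⟩
    · obtain ⟨u, hu, hdom⟩ := side A v (nb v (i + 2)) hv (Finset.filter_subset _ _) hclA
        ⟨_, haA⟩ hb (hne _) hbA
      exact ⟨u, Finset.mem_of_mem_erase (Finset.mem_of_mem_filter u hu),
        fun e => hzA (e ▸ hu), hdom⟩
  have hXne : X.Nonempty := Finset.card_pos.1 (by omega)
  obtain ⟨t, ht, htmax⟩ := Finset.exists_max_image X (fun x => toLex (x.2, x.1)) hXne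
  obtain ⟨b, hb, hbmin⟩ := Finset.exists_min_image X (fun x => toLex (x.2, x.1)) hXne
  simp only [Prod.Lex.toLex_le_toLex] at htmax hbmin
  -- Two extreme vertices are at hand because one of them may be `z`.
  by_cases htz : t = z
  · have hbz : b ≠ z := by
      rintro rfl
      obtain ⟨w, hw, hwb⟩ := Finset.exists_mem_ne (by omega : 1 < X.card) b
      have h1 := htmax w hw
      have h2 := hbmin w hw
      rw [htz] at h1
      exact hwb (Prod.ext (by omega) (by omega))
    refine extreme b hb hbz 0 (.inl rfl) ?_ ?_ ?_
    · rw [zero_add, nb_three]; intro h; have := hbmin _ h; dsimp only at this; omega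
    · rw [zero_add, nb_four]; intro h; have := hbmin _ h; dsimp only at this; omega
    · rw [zero_add, nb_five]; intro h; have := hbmin _ h; dsimp only at this; omega
  · refine extreme t ht htz 3 (.inr rfl) ?_ ?_ ?_
    · rw [show (3 : ZMod 6) + 3 = 0 from rfl, nb_zero]
      intro h
      have := htmax _ h
      dsimp only at this
      omega
    · rw [show (3 : ZMod 6) + 4 = 1 from rfl, nb_one]
      intro h
      have := htmax _ h
      dsimp only at this
      omega
    · rw [show (3 : ZMod 6) + 5 = 2 from rfl, nb_two]
      intro h
      have := htmax _ h
      dsimp only at this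
      omega

/-! ### Level functions -/

/-- `f` is the graph distance from the origin within `X`. -/
structure IsLevel (X : Set Lat) (f : Lat → ℕ) : Prop where
  zero_mem : 0 ∈ X
  zero : f 0 = 0
  lower : ∀ x ∈ X, x ≠ 0 → ∃ y ∈ X, latGraph.Adj x y ∧ f x = f y + 1
  le_add_one : ∀ x ∈ X, ∀ y ∈ X, latGraph.Adj x y → f x ≤ f y + 1

/-- Any two neighbours of `v` of smaller level are equal or adjacent. -/
def ParentsAdjacent (X : Set Lat) (f : Lat → ℕ) : Prop :=
  ∀ v ∈ X, ∀ y ∈ X, ∀ z ∈ X, latGraph.Adj v y → latGraph.Adj v z → f v = f y + 1 →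
    f v = f z + 1 → y = z ∨ latGraph.Adj y z

/-- Adjacent vertices of the same level have a common neighbour of smaller level. -/
def CommonParent (X : Set Lat) (f : Lat → ℕ) : Prop :=
  ∀ u ∈ X, ∀ v ∈ X, latGraph.Adj u v → f u = f v →
    ∃ y ∈ X, latGraph.Adj u y ∧ latGraph.Adj v y ∧ f u = f y + 1

theorem IsLevel.connectedSet {X : Set Lat} {f : Lat → ℕ} (h : IsLevel X f) : ConnectedSet X := by
  have key : ∀ n, ∀ x ∈ X, f x = n → Relation.ReflTransGen (AdjIn X) x 0 := by
    intro n
    induction n with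
    | zero =>
      intro x hx h0
      by_cases hx0 : x = 0
      · rw [hx0]
      · obtain ⟨y, _, _, h⟩ := h.lower x hx hx0
        omega
    | succ n ih =>
      intro x hx h0
      by_cases hx0 : x = 0
      · rw [hx0]
      · obtain ⟨y, hy, hxy, h⟩ := h.lower x hx hx0
        exact .head ⟨hx, hy, hxy⟩ (ih y hy (by omega))
  intro x hx y hy
  exact (key _ x hx rfl).trans
    (reflTransGen_adjIn_symm (key _ y hy rfl))

/-- Folding `v` onto its dominating neighbour `c` shortens nothing: a vertex whose lower neighbour
was `v` is adjacent to `c`, and `c` then has the level of `v`. -/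
theorem IsLevel.diff_dominated {X : Set Lat} {f : Lat → ℕ} (h : IsLevel X f) {v : Lat}
    (hv : v ∈ X) (hv0 : v ≠ 0) (hd : Dominated X v) : IsLevel (X \ {v}) f := by
  obtain ⟨c, hc, hvc, hdom⟩ := hd
  refine ⟨⟨h.zero_mem, hv0.symm⟩, h.zero, fun x hx hx0 => ?_,
    fun x hx y hy => h.le_add_one x hx.1 y hy.1⟩
  obtain ⟨y, hy, hxy, e⟩ := h.lower x hx.1 hx0
  by_cases hyv : y = v
  swap
  · exact ⟨y, ⟨hy, hyv⟩, hxy, e⟩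
  subst hyv
  obtain ⟨w, hw, hyw, e'⟩ := h.lower y hv hv0
  have hcy : f c ≤ f y + 1 := h.le_add_one c hc y hv hvc.symm
  have hwc := hdom w hw hyw
  rcases hdom x hx.1 hxy.symm with rfl | hcx
  · rcases hwc with rfl | hwc
    · omega
    · have := h.le_add_one x hx.1 w hw hwc
      omega
  · have h1 := h.le_add_one x hx.1 c hc hcx.symm
    refine ⟨c, ⟨hc, fun e => latGraph.loopless.irrefl y (by rwa [← e] at hvc ⊢)⟩, hcx.symm, ?_⟩
    rcases hwc with rfl | hwc
    · omega
    · have := h.le_add_one c hc w hw hwc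
      omega

/-- Only configurations that involve `v` are new. Parents of `v` and children of `v` are also
neighbours of `c` (or `c` itself), so if the claim failed, the hypotheses without `v` would yield
two parents of `c` that are too far apart on the hexagon around `c`. -/
theorem parentsAdjacent_of_dominated {X : Set Lat} {f : Lat → ℕ} (h : IsLevel X f) {v : Lat}
    (hv : v ∈ X) (hv0 : v ≠ 0) (hd : Dominated X v) (hQ : ParentsAdjacent (X \ {v}) f)
    (hT : CommonParent (X \ {v}) f) : ParentsAdjacent X f := by
  obtain ⟨c, hc, hvc, hdom⟩ := hd
  obtain ⟨p, hp, hvp, ep⟩ := h.lower v hv hv0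
  have hcv : c ≠ v := hvc.ne'
  have hpv : p ≠ v := hvp.ne'
  have aux : ∀ x ∈ X, x ≠ v → latGraph.Adj x v → f x = f v + 1 → ∀ z ∈ X, z ≠ v →
      latGraph.Adj x z → f x = f z + 1 → latGraph.Adj v z := by
    intro x hx hxv hax ex z hz hzv haz ez
    have hxc : x ≠ c := by
      rintro rfl
      rcases hdom p hp hvp with rfl | hpc
      · omega
      · have := h.le_add_one x hx p hp hpc
        omega
    have hcx := (hdom x hx hax.symm).resolve_left hxc
    have hpc : p ≠ c := by
      rintro rfl
      have := h.le_add_one x hx p hp hcx.symm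
      omega
    have hcp := (hdom p hp hvp).resolve_left hpc
    have l1 := h.le_add_one c hc p hp hcp
    have l2 := h.le_add_one x hx c hc hcx.symm
    rcases hQ x ⟨hx, hxv⟩ z ⟨hz, hzv⟩ c ⟨hc, hcv⟩ haz hcx.symm ez (by omega) with rfl | hzc
    · exact hvc
    obtain ⟨y, hy, hcy, hzy, ey⟩ := hT c ⟨hc, hcv⟩ z ⟨hz, hzv⟩ hzc.symm (by omega)
    have := hQ c ⟨hc, hcv⟩ y hy p ⟨hp, hpv⟩ hcy hcp ey (by omega)
    refine absurd this (ne_of_common_neighbors' hvc.symm hcx hcp hzc.symm hcy hax.symm hvp ?_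
      haz hzv hzy ?_)
    · rintro rfl; omega
    · rintro rfl; omega
  intro x hx y hy z hz hxy hxz ey ez
  by_cases hxv : x = v
  · subst hxv
    rcases hdom y hy hxy with rfl | hcy
    · rcases hdom z hz hxz with rfl | hcz
      · exact .inl rfl
      · exact .inr hcz
    rcases hdom z hz hxz with rfl | hcz
    · exact .inr hcy.symm
    by_cases hyz : y = z
    · exact .inl hyz
    have hyx : y ≠ x := hxy.ne'
    have hzx : z ≠ x := hxz.ne'
    have l1 := h.le_add_one c hc y hy hcy
    have l2 := h.le_add_one x hx c hc hvc
    by_cases hc1 : f c = f y + 1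
    · exact hQ c ⟨hc, hcv⟩ y ⟨hy, hyx⟩ z ⟨hz, hzx⟩ hcy hcz hc1 (by omega)
    obtain ⟨w₁, hw₁, hcw₁, hyw₁, e₁⟩ := hT c ⟨hc, hcv⟩ y ⟨hy, hyx⟩ hcy (by omega)
    obtain ⟨w₂, hw₂, hcw₂, hzw₂, e₂⟩ := hT c ⟨hc, hcv⟩ z ⟨hz, hzx⟩ hcz (by omega)
    exact absurd (hQ c ⟨hc, hcv⟩ w₁ hw₁ w₂ hw₂ hcw₁ hcw₂ e₁ e₂)
      (ne_of_common_neighbors'' hvc.symm hcy hcz hcw₁ hcw₂ hxy hxz hyz hyw₁ hw₁.2 hzw₂ hw₂.2)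
  · by_cases hyv : y = v
    · subst hyv
      by_cases hzv : z = y
      · exact .inl hzv.symm
      · exact .inr (aux x hx hxv hxy ey z hz hzv hxz ez)
    · by_cases hzv : z = v
      · subst hzv
        exact .inr (aux x hx hxv hxz ez y hy hyv hxy ey).symm
      · exact hQ x ⟨hx, hxv⟩ y ⟨hy, hyv⟩ z ⟨hz, hzv⟩ hxy hxz ey ez

/-- For `v` and a neighbour `w` of its level, `c` or a parent `p` of `v` is usually common.
Otherwise `c` is on the same level, and a common parent of `c` and `w` would be opposite to `p`
around `c`, although both are parents of `c`. -/
theorem commonParent_of_dominated {X : Set Lat} {f : Lat → ℕ} (h : IsLevel X f) {v : Lat}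
    (hv : v ∈ X) (hv0 : v ≠ 0) (hd : Dominated X v) (hQ : ParentsAdjacent (X \ {v}) f)
    (hT : CommonParent (X \ {v}) f) : CommonParent X f := by
  obtain ⟨c, hc, hvc, hdom⟩ := hd
  obtain ⟨p, hp, hvp, ep⟩ := h.lower v hv hv0
  have hcv : c ≠ v := hvc.ne'
  have hpv : p ≠ v := hvp.ne'
  have aux : ∀ w ∈ X, latGraph.Adj v w → f v = f w →
      ∃ y ∈ X, latGraph.Adj v y ∧ latGraph.Adj w y ∧ f v = f y + 1 := by
    intro w hw hvw e
    have hwv : w ≠ v := hvw.ne'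
    rcases hdom w hw hvw with rfl | hcw
    · rcases hdom p hp hvp with rfl | hcp
      · omega
      · exact ⟨p, hp, hvp, hcp, ep⟩
    by_cases hc1 : f v = f c + 1
    · exact ⟨c, hc, hvc, hcw.symm, hc1⟩
    rcases hdom p hp hvp with rfl | hcp
    · omega
    have l1 := h.le_add_one c hc p hp hcp
    have l2 := h.le_add_one v hv c hc hvc
    obtain ⟨y, hy, hcy, hwy, ey⟩ := hT c ⟨hc, hcv⟩ w ⟨hw, hwv⟩ hcw (by omega)
    have := hQ c ⟨hc, hcv⟩ y hy p ⟨hp, hpv⟩ hcy hcp ey (by omega)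
    refine absurd this (ne_of_common_neighbors hvc.symm hcw hcp hcy hvw hvp ?_ hwy hy.2)
    rintro rfl; omega
  intro u hu w hw huw e
  by_cases huv : u = v
  · subst huv
    exact aux w hw huw e
  by_cases hwv : w = v
  · subst hwv
    obtain ⟨y, hy, h1, h2, h3⟩ := aux u hu huw.symm e.symm
    exact ⟨y, hy, h2, h1, by omega⟩
  obtain ⟨y, hy, h1⟩ := hT u ⟨hu, huv⟩ w ⟨hw, hwv⟩ huw e
  exact ⟨y, hy.1, h1⟩

theorem Dominated.exists_notMem {X : Set Lat} {v : Lat} (hd : Dominated X v) :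
    ∃ y, latGraph.Adj v y ∧ y ∉ X := by
  obtain ⟨c, hc, hvc, hdom⟩ := hd
  obtain ⟨i, rfl⟩ := adj_iff_nb.1 hvc
  refine ⟨nb v (i + 3), adj_nb _ _, fun h => ?_⟩
  have := hdom _ h (adj_nb _ _)
  rw [adj_nb_nb, nb_inj] at this
  clear hvc hc hdom h
  revert i; decide

/-- Induction on the cardinality, deleting a dominated vertex other than the origin. -/
theorem level_structure (X : Finset Lat) (f : Lat → ℕ) (h : IsLevel (X : Set Lat) f)
    (hX : WindingTrivial (X : Set Lat)) : ParentsAdjacent (X : Set Lat) f ∧ CommonParent X f := by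
  induction hn : X.card generalizing X with
  | zero =>
    have := h.zero_mem
    rw [Finset.card_eq_zero] at hn
    simp [hn] at this
  | succ n IH =>
    by_cases hcard : 2 ≤ X.card
    · obtain ⟨u, hu, hu0, hd⟩ := exists_dominated X h.connectedSet hX hcard 0
      have hsub : ((X.erase u : Finset Lat) : Set Lat) = ↑X \ {u} := Finset.coe_erase u X
      have h' := h.diff_dominated hu hu0 hd
      -- A dominated vertex has a neighbour outside `X`, from which the potential is transferred to
      -- it.
      have hX' : WindingTrivial (↑X \ {u} : Set Lat) := by
        intro p hp
        by_cases hpu : p = u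
        · subst hpu
          obtain ⟨y, hy, hyX⟩ := hd.exists_notMem
          exact ((hX y hyX).mono Set.sdiff_subset).transfer hy.symm (fun h => hyX h.1) hp
        · exact (hX p fun h => hp ⟨h, hpu⟩).mono Set.sdiff_subset
      have := IH (X.erase u) (by rwa [hsub]) (by rwa [hsub])
        (by rw [Finset.card_erase_of_mem hu]; omega)
      rw [hsub] at this
      exact ⟨parentsAdjacent_of_dominated h hu hu0 hd this.1 this.2,
        commonParent_of_dominated h hu hu0 hd this.1 this.2⟩
    · have h1 : X = {0} := by
        obtain ⟨a, ha⟩ := Finset.card_eq_one.1 (by omega : X.card = 1)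
        have := h.zero_mem
        rw [ha] at this ⊢
        simp at this
        rw [this]
      have h2 : ∀ v ∈ (X : Set Lat), ∀ y ∈ (X : Set Lat), ¬ latGraph.Adj v y := by
        rw [h1]
        intro v hv y hy hvy
        simp at hv hy
        subst hv hy
        exact latGraph.loopless.irrefl _ hvy
      exact ⟨fun v hv y hy z hz hvy => absurd hvy (h2 v hv y hy),
        fun v hv y hy hvy => absurd hvy (h2 v hv y hy)⟩

/-! ### Parents and successors in a leveled set -/

/-- A set of lattice points with its level function, with the local structure of a simply
connected set, in which only points above the seeds have level two. -/
structure Leveled (X : Set Lat) (f : Lat → ℕ) : Prop where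
  level : IsLevel X f
  parents : ParentsAdjacent X f
  common : CommonParent X f
  level_one : ∀ v ∈ X, f v = 1 → v.2 ≤ 1
  level_two : ∀ v ∈ X, f v = 2 → v.2 = 2 ∧ -2 ≤ v.1 ∧ v.1 ≤ 0

/-- The neighbour of `v` in the direction `i` is a parent of `v`. -/
def IsParentDir (X : Set Lat) (f : Lat → ℕ) (v : Lat) (i : ZMod 6) : Prop :=
  nb v i ∈ X ∧ f v = f (nb v i) + 1

/-- The direction from `v` to its frontmost parent. -/
def parentDir (X : Set Lat) (f : Lat → ℕ) (v : Lat) : ZMod 6 :=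
  Classical.epsilon fun i => IsParentDir X f v i ∧ ¬ IsParentDir X f v (i + 1)

/-- The frontmost parent of `v`. -/
def par (X : Set Lat) (f : Lat → ℕ) (v : Lat) : Lat := nb v (parentDir X f v)

/-- The position that follows `v` clockwise about its frontmost parent. -/
def nxt (X : Set Lat) (f : Lat → ℕ) (v : Lat) : Lat := nb v (parentDir X f v + 1)

/-- The number of clockwise turns about `v` that move its neighbour in the direction `k` to the
frontmost parent of `v`. -/
def turnCount (X : Set Lat) (f : Lat → ℕ) (v : Lat) (k : ZMod 6) : ℕ := (k - parentDir X f v).val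

/-- Auxiliary recursion for `frontKey`. -/
def frontKeyAux (X : Set Lat) (f : Lat → ℕ) : ℕ → Lat → ℕ
  | 0, v => (-v.1).toNat
  | n + 1, v => if n + 1 ≤ 2 then (-v.1).toNat else
      6 * frontKeyAux X f n (par X f v) + turnCount X f (par X f v) (parentDir X f v + 3)

/-- A number that decreases along the directed ribbons. -/
def frontKey (X : Set Lat) (f : Lat → ℕ) (v : Lat) : ℕ := frontKeyAux X f (f v) v

theorem turnCount_le (X : Set Lat) (f : Lat → ℕ) (v : Lat) (k : ZMod 6) :
    turnCount X f v k ≤ 5 :=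
  Nat.le_of_lt_succ (ZMod.val_lt _)

theorem zmod_six_val_add_five {x : ZMod 6} (h : x ≠ 0) : (x + 5).val + 1 = x.val := by
  revert x; decide

theorem turnCount_succ {X : Set Lat} {f : Lat → ℕ} {v : Lat} {k : ZMod 6}
    (h : k ≠ parentDir X f v) : turnCount X f v (k + 5) + 1 = turnCount X f v k := by
  unfold turnCount
  rw [← zmod_six_val_add_five (sub_ne_zero.2 h), add_sub_right_comm]

theorem nb_par (X : Set Lat) (f : Lat → ℕ) (v : Lat) :
    nb (par X f v) (parentDir X f v + 3) = v := nb_nb_add_three _ _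

theorem nb_par_nxt (X : Set Lat) (f : Lat → ℕ) (v : Lat) :
    nb (par X f v) (parentDir X f v + 2) = nxt X f v := nb_nb_add_two _ _

theorem rotCW_par (X : Set Lat) (f : Lat → ℕ) (v : Lat) :
    rotCW (par X f v) v = nxt X f v := rotCW_nb _ _

theorem adj_nxt (X : Set Lat) (f : Lat → ℕ) (v : Lat) : latGraph.Adj v (nxt X f v) := adj_nb _ _

theorem adj_par (X : Set Lat) (f : Lat → ℕ) (v : Lat) : latGraph.Adj v (par X f v) := adj_nb _ _

theorem frontKey_of_le_two {X : Set Lat} {f : Lat → ℕ} {v : Lat} (h : f v ≤ 2) :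
    frontKey X f v = (-v.1).toNat := by
  unfold frontKey
  rcases hn : f v with _ | n
  · rfl
  · rw [frontKeyAux, if_pos (by omega)]

namespace Leveled

variable {X : Set Lat} {f : Lat → ℕ}

/-- Parents in directions `i` and `i + 2` would not be adjacent, so from any parent at most one step
forward leads to the frontmost. -/
theorem parentDir_spec (L : Leveled X f) {v : Lat} (hv : v ∈ X) (hv0 : v ≠ 0) :
    IsParentDir X f v (parentDir X f v) ∧ ¬ IsParentDir X f v (parentDir X f v + 1) := by
  apply Classical.epsilon_spec (p := fun i => IsParentDir X f v i ∧ ¬ IsParentDir X f v (i + 1))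
  obtain ⟨y, hy, hvy, e⟩ := L.level.lower v hv hv0
  obtain ⟨i, rfl⟩ := adj_iff_nb.1 hvy
  by_cases h : IsParentDir X f v (i + 1)
  · refine ⟨i + 1, h, fun h2 => ?_⟩
    have := L.parents v hv _ hy _ h2.1 hvy (adj_nb _ _) e h2.2
    rw [adj_nb_nb, nb_inj] at this
    revert this
    clear * -
    revert i; decide
  · exact ⟨i, ⟨hy, e⟩, h⟩

theorem parent_dir_cases (L : Leveled X f) {v : Lat} (hv : v ∈ X) {i j : ZMod 6}
    (hi : IsParentDir X f v i) (hj : IsParentDir X f v j) : j = i ∨ j = i + 1 ∨ j = i + 5 := by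
  have := L.parents v hv _ hi.1 _ hj.1 (adj_nb _ _) (adj_nb _ _) hi.2 hj.2
  rw [adj_nb_nb, nb_inj] at this
  tauto

theorem parentDir_eq (L : Leveled X f) {v : Lat} (hv : v ∈ X) {i : ZMod 6}
    (hi : IsParentDir X f v i) (hi' : ¬ IsParentDir X f v (i + 1)) : parentDir X f v = i := by
  have hv0 : v ≠ 0 := by
    rintro rfl
    have := hi.2
    rw [L.level.zero] at this
    omega
  obtain ⟨h1, h2⟩ := L.parentDir_spec hv hv0
  rcases L.parent_dir_cases hv hi h1 with h | h | h
  · exact h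
  · rw [h] at h1; exact absurd h1 hi'
  · rw [h, add_assoc, show (5 : ZMod 6) + 1 = 0 from rfl, add_zero] at h2
    exact absurd hi h2

theorem dir_eq_parentDir_or (L : Leveled X f) {v : Lat} (hv : v ∈ X) {j : ZMod 6}
    (hj : IsParentDir X f v j) :
    j = parentDir X f v ∨ j = parentDir X f v + 5 := by
  have hv0 : v ≠ 0 := by
    rintro rfl
    have := hj.2
    rw [L.level.zero] at this
    omega
  obtain ⟨h1, h2⟩ := L.parentDir_spec hv hv0
  rcases L.parent_dir_cases hv h1 hj with h | h | h
  · exact .inl h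
  · rw [h] at hj; exact absurd hj h2
  · exact .inr h

theorem par_mem (L : Leveled X f) {v : Lat} (hv : v ∈ X) (hv0 : v ≠ 0) : par X f v ∈ X :=
  (L.parentDir_spec hv hv0).1.1

theorem level_par (L : Leveled X f) {v : Lat} (hv : v ∈ X) (hv0 : v ≠ 0) :
    f v = f (par X f v) + 1 :=
  (L.parentDir_spec hv hv0).1.2

theorem ne_zero (L : Leveled X f) {v : Lat} (h : f v ≠ 0) : v ≠ 0 := by
  rintro rfl
  exact h L.level.zero

theorem level_nxt (L : Leveled X f) {v : Lat} (hv : v ∈ X) (hv0 : v ≠ 0) (h : nxt X f v ∈ X) :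
    f (nxt X f v) = f v := by
  have h1 := L.parentDir_spec hv hv0
  have h2 : ¬ f v = f (nxt X f v) + 1 := fun e => h1.2 ⟨h, e⟩
  have h3 := L.level.le_add_one _ hv _ h (adj_nxt X f v)
  have h4 : latGraph.Adj (nxt X f v) (par X f v) := by
    rw [nxt, par, adj_nb_nb]
    right
    rw [add_assoc, show (1 : ZMod 6) + 5 = 0 from rfl, add_zero]
  have h5 := L.level.le_add_one _ h _ (L.par_mem hv hv0) h4
  have h6 := L.level_par hv hv0
  omega

/-- Take a common parent. From one of the two points, the direction after it holds the other point,
which is no parent; so it is the frontmost parent of that point. -/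
theorem nxt_or_nxt (L : Leveled X f) {v w : Lat} (hv : v ∈ X) (hw : w ∈ X) (ha : latGraph.Adj v w)
    (he : f v = f w) : w = nxt X f v ∨ nxt X f w = v := by
  obtain ⟨c, hc, hvc, hwc, e⟩ := L.common v hv w hw ha he
  obtain ⟨j, rfl⟩ := adj_iff_nb.1 ha
  obtain ⟨k, rfl⟩ := adj_iff_nb.1 hvc
  rw [adj_nb_nb] at hwc
  have hk : IsParentDir X f v k := ⟨hc, e⟩
  rcases hwc with rfl | rfl
  · right
    rw [nxt]
    have h1 : nb (nb v j) (j + 2) = nb v (j + 1) := nb_nb_add_two _ _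
    have h2 : nb (nb v j) (j + 3) = v := nb_nb_add_three _ _
    rw [L.parentDir_eq hw (i := j + 2), add_assoc]
    · exact h2
    · exact ⟨by rwa [h1], by rw [h1, ← he, e]⟩
    · rw [add_assoc, show (2 : ZMod 6) + 1 = 3 from rfl]
      intro h
      have := h.2
      rw [h2] at this
      omega
  · left
    rw [nxt, nb_inj]
    rcases L.dir_eq_parentDir_or hv hk with h | h
    · rw [← h, add_assoc]; simp [show (5 : ZMod 6) + 1 = 0 from rfl]
    · exfalso
      have h3 : j = parentDir X f v := add_right_cancel h
      have := (L.parentDir_spec hv (L.ne_zero (by omega))).1.2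
      rw [← h3] at this
      omega

theorem backmost_of_nxt (L : Leveled X f) {v : Lat} (hv : v ∈ X) (hv0 : v ≠ 0) (h : nxt X f v ∈ X) :
    IsParentDir X f (nxt X f v) (parentDir X f v + 5) ∧
      ¬ IsParentDir X f (nxt X f v) (parentDir X f v + 4) ∧
      nb (nxt X f v) (parentDir X f v + 5) = par X f v ∧
      nb (nxt X f v) (parentDir X f v + 4) = v := by
  have h1 : nb (nxt X f v) (parentDir X f v + 5) = par X f v := by
    have := nb_nb_add_four v (parentDir X f v + 1)
    rw [add_assoc, add_assoc, show (1 : ZMod 6) + 4 = 5 from rfl,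
      show (1 : ZMod 6) + 5 = 0 from rfl, add_zero] at this
    exact this
  have h2 : nb (nxt X f v) (parentDir X f v + 4) = v := by
    have := nb_nb_add_three v (parentDir X f v + 1)
    rwa [add_assoc, show (1 : ZMod 6) + 3 = 4 from rfl] at this
  have e := L.level_nxt hv hv0 h
  refine ⟨⟨by rw [h1]; exact L.par_mem hv hv0, by rw [h1, e]; exact L.level_par hv hv0⟩,
    fun h3 => ?_, h1, h2⟩
  have := h3.2
  rw [h2] at this
  omega

/-- Seen from its successor, a point lies just behind the backmost parent, which determines it. -/
theorem nxt_injective (L : Leveled X f) {v w : Lat} (hv : v ∈ X) (hw : w ∈ X)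
    (hv0 : v ≠ 0) (hw0 : w ≠ 0) (h : nxt X f v ∈ X) (e : nxt X f v = nxt X f w) : v = w := by
  obtain ⟨a1, a2, _, a4⟩ := L.backmost_of_nxt hv hv0 h
  obtain ⟨b1, b2, _, b4⟩ := L.backmost_of_nxt hw hw0 (e ▸ h)
  rw [← e] at b1 b2 b4
  have hcase := L.parent_dir_cases h a1 b1
  have : parentDir X f v = parentDir X f w := by
    rcases hcase with h1 | h1 | h1
    · exact (add_right_cancel h1).symm
    · exfalso
      apply b2
      have : parentDir X f w + 4 = parentDir X f v + 5 := by
        generalize parentDir X f w = x at *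
        generalize parentDir X f v = y at *
        clear * - h1
        revert x y; decide
      rwa [this]
    · exfalso
      apply a2
      have : parentDir X f v + 4 = parentDir X f w + 5 := by
        generalize parentDir X f w = x at *
        generalize parentDir X f v = y at *
        clear * - h1
        revert x y; decide
      rwa [this]
  rw [← a4, ← b4, this]

/-- The parent of `v` is also a parent of the successor. Either it is frontmost there, or the
frontmost one is the point ahead of it, which is on its level. -/
theorem par_nxt (L : Leveled X f) {v : Lat} (hv : v ∈ X) (hv0 : 2 ≤ f v) (h : nxt X f v ∈ X) :
    (par X f (nxt X f v) = par X f v ∧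
      parentDir X f (nxt X f v) = parentDir X f v + 5) ∨
    (par X f (nxt X f v) = nxt X f (par X f v) ∧ nxt X f (par X f v) ∈ X) := by
  have hv0' : v ≠ 0 := L.ne_zero (by omega)
  obtain ⟨a1, a2, a3, a4⟩ := L.backmost_of_nxt hv hv0' h
  have ew := L.level_nxt hv hv0' h
  have hw0 : nxt X f v ≠ 0 := L.ne_zero (by omega)
  rcases L.dir_eq_parentDir_or h a1 with h1 | h1
  · left
    exact ⟨by rw [par, ← h1, a3], h1.symm⟩
  · right
    have h2 : parentDir X f v = parentDir X f (nxt X f v) := add_right_cancel h1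
    have hc := L.par_mem hv hv0'
    have ec := L.level_par hv hv0'
    have hcw := L.par_mem h hw0
    have ecw := L.level_par h hw0
    have hc0 : par X f v ≠ 0 := L.ne_zero (by omega)
    have hadj : latGraph.Adj (par X f v) (par X f (nxt X f v)) := by
      rw [← a3, par, ← h2, adj_nb_nb]
      left
      rw [add_assoc, show (5 : ZMod 6) + 1 = 0 from rfl, add_zero]
    rcases L.nxt_or_nxt hc hcw hadj (by omega) with h3 | h3
    · exact ⟨h3, h3 ▸ hcw⟩
    · exfalso
      have hcw0 : par X f (nxt X f v) ≠ 0 := L.ne_zero (by omega)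
      obtain ⟨b1, -, -, b4⟩ := L.backmost_of_nxt hcw hcw0 (by rw [h3]; exact hc)
      rw [h3] at b1 b4
      -- the parent of `par v` behind its predecessor would be `nxt v`
      have e1 : nb (par X f v) (parentDir X f v + 1) = par X f (nxt X f v) := by
        rw [par, par, ← h2, nxt, nb_nb_comm v (parentDir X f v + 1), ← par]
      have b5 := nb_inj.1 (b4.trans e1.symm)
      have e2 : parentDir X f (par X f (nxt X f v)) + 5 = parentDir X f v + 2 := by
        rw [show (5 : ZMod 6) = 4 + 1 from rfl, ← add_assoc, b5, add_assoc]; rfl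
      rw [e2] at b1
      have := b1.2
      rw [nb_par_nxt] at this
      omega

theorem frontKey_eq (L : Leveled X f) {v : Lat} (hv : v ∈ X) (h : 3 ≤ f v) :
    frontKey X f v = 6 * frontKey X f (par X f v) +
      turnCount X f (par X f v) (parentDir X f v + 3) := by
  have := L.level_par hv (L.ne_zero (by omega))
  rw [frontKey, frontKey]
  obtain ⟨n, hn⟩ : ∃ n, f v = n + 1 := ⟨f v - 1, by omega⟩
  have hn' : f (par X f v) = n := by omega
  rw [hn, hn', frontKeyAux, if_neg (by omega)]

/-- By `par_nxt` either the parent stays and the last digit drops by one, or the parent advances and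
its key drops, which outweighs any change of the last digit. -/
theorem frontKey_nxt_lt (L : Leveled X f) {v : Lat} (hv : v ∈ X) (hf : 2 ≤ f v)
    (h : nxt X f v ∈ X) :
    frontKey X f (nxt X f v) < frontKey X f v := by
  induction hn : f v using Nat.strong_induction_on generalizing v with
  | _ n ih =>
  have hv0 : v ≠ 0 := L.ne_zero (by omega)
  have ew := L.level_nxt hv hv0 h
  have ec := L.level_par hv hv0
  have hc := L.par_mem hv hv0
  by_cases h2 : f v = 2
  -- At level two both points lie in row two and the center lies lower, so the turn leads one step
  -- east.
  · rw [frontKey_of_le_two (by omega), frontKey_of_le_two (by omega)]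
    have b1 := L.level_two v hv h2
    have b2 := L.level_two _ h (by omega)
    have b3 := L.level_one _ hc (by omega)
    have a1 := rotCW_par X f v
    have a2 := congrArg Prod.fst a1
    have a3 := congrArg Prod.snd a1
    have a4 := adj_coord.1 (adj_par X f v)
    simp only [rotCW] at a2 a3
    omega
  · rw [L.frontKey_eq hv (by omega), L.frontKey_eq h (by omega)]
    rcases L.par_nxt hv hf h with ⟨h3, h4⟩ | ⟨h3, h4⟩
    · rw [h3, h4]
      have hne : parentDir X f v + 3 ≠ parentDir X f (par X f v) := by
        intro e
        have h5 := L.level_par hc (L.ne_zero (by omega))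
        rw [par.eq_def X f (par X f v), ← e, nb_par] at h5
        omega
      have := turnCount_succ hne
      rw [add_right_comm] at this
      omega
    · rw [h3]
      have := ih (n - 1) (by omega) hc (by omega) h4 (by omega)
      have := turnCount_le X f (nxt X f (par X f v)) (parentDir X f (nxt X f v) + 3)
      omega

end Leveled

/-! ### Hop counts and levels -/

/-- `P` with the origin and its neighbours. -/
def hull (P : Set Lat) : Set Lat := P ∪ {x | sqDist x 0 ≤ 1}

theorem hopGraph_adj {P : Set Lat} {x y : Lat} : (hopGraph P).Adj x y ↔ AdjIn (hull P) x y := by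
  simp only [hopGraph, AdjIn, hull, Set.mem_union, Set.mem_ofPred_eq]
  tauto

theorem zero_mem_hull (P : Set Lat) : (0 : Lat) ∈ hull P := .inr (by simp [sqDist])

theorem sqDist_le_one_iff {x : Lat} : sqDist x 0 ≤ 1 ↔ x = 0 ∨ latGraph.Adj x 0 := by
  change _ ↔ _ ∨ sqDist x 0 = 1
  obtain ⟨a, b⟩ := x
  have h : (0 : ℤ) ≤ sqDist (a, b) 0 := by
    simp only [sqDist, Prod.fst_zero, Prod.snd_zero, sub_zero]
    nlinarith [sq_nonneg (a + b), sq_nonneg a, sq_nonneg b]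
  constructor
  · intro h1
    by_cases h2 : sqDist (a, b) 0 = 1
    · exact .inr h2
    · left
      have h3 : a ^ 2 + a * b + b ^ 2 = 0 := by
        have : sqDist (a, b) 0 = 0 := by omega
        simpa [sqDist] using this
      have ha : a = 0 := by nlinarith [sq_nonneg (a + 2 * b), sq_nonneg a]
      subst ha
      have hb : b = 0 := by nlinarith
      rw [hb]; rfl
  · rintro (h | h)
    · rw [h]; simp [sqDist]
    · omega

theorem ball_coord {x : Lat} : sqDist x 0 ≤ 1 ↔ (x.1 = 0 ∧ x.2 = 0) ∨ (x.1 = -1 ∧ x.2 = 0) ∨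
    (x.1 = 1 ∧ x.2 = 0) ∨ (x.1 = 0 ∧ x.2 = 1) ∨ (x.1 = 0 ∧ x.2 = -1) ∨ (x.1 = 1 ∧ x.2 = -1) ∨
    (x.1 = -1 ∧ x.2 = 1) := by
  rw [sqDist_le_one_iff, adj_coord, Prod.ext_iff]
  simp only [Prod.fst_zero, Prod.snd_zero]
  omega

theorem adj_zero_of_mem_ball {x : Lat} (h : sqDist x 0 ≤ 1) (hx : x ≠ 0) : latGraph.Adj x 0 :=
  (sqDist_le_one_iff.1 h).resolve_left hx

theorem IsLevel.exists_walk {P : Set Lat} {g : Lat → ℕ} (hg : IsLevel (hull P) g) {x : Lat}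
    (hx : x ∈ hull P) : ∃ w : (hopGraph P).Walk x 0, w.length = g x := by
  induction hn : g x generalizing x with
  | zero =>
    by_cases hx0 : x = 0
    · subst hx0
      exact ⟨.nil, by simp⟩
    · obtain ⟨y, _, _, e⟩ := hg.lower x hx hx0
      omega
  | succ n ih =>
    have hx0 : x ≠ 0 := by
      rintro rfl
      rw [hg.zero] at hn
      omega
    obtain ⟨y, hy, hxy, e⟩ := hg.lower x hx hx0
    obtain ⟨w, hw⟩ := ih hy (by omega)
    exact ⟨.cons (hopGraph_adj.2 ⟨hx, hy, hxy⟩) w, by simp [hw]⟩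

theorem IsLevel.le_length {P : Set Lat} {g : Lat → ℕ} (hg : IsLevel (hull P) g) {x : Lat}
    (w : (hopGraph P).Walk x 0) : g x ≤ w.length := by
  generalize hz : (0 : Lat) = z at w
  induction w with
  | nil => subst hz; simp [hg.zero]
  | cons h w ih =>
    have := hopGraph_adj.1 h
    have h2 := hg.le_add_one _ this.1 _ this.2.1 this.2.2
    have h3 := ih hz
    simp only [SimpleGraph.Walk.length_cons]
    omega

/-- Descending along lower neighbours gives a walk of length `g x`, and no walk is shorter since `g`
drops by at most one per step. It is applied to `lev` on the shape and to `hexDist` on the idle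
half-plane. -/
theorem hop_of_level {P : Set Lat} {g : Lat → ℕ} (hg : IsLevel (hull P) g) {x : Lat}
    (hx : x ∈ hull P) : hop P x = g x := by
  obtain ⟨w, hw⟩ := hg.exists_walk hx
  rw [hop, if_pos w.reachable]
  have h1 := SimpleGraph.dist_le w
  obtain ⟨w', hw'⟩ := w.reachable.exists_walk_length_eq_dist
  have h2 := hg.le_length w'
  have : (hopGraph P).dist x 0 = g x := by omega
  rw [this]

theorem hop_of_notMem {P : Set Lat} {x : Lat} (hx : x ∉ hull P) : hop P x = -1 := by
  rw [hop, if_neg]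
  rintro ⟨w⟩
  cases w with
  | nil => exact hx (zero_mem_hull P)
  | cons h _ => exact hx (hopGraph_adj.1 h).1

/-- The level of a lattice point: its distance from the origin within `hull P`. -/
def lev (P : Set Lat) (x : Lat) : ℕ := (hopGraph P).dist x 0

theorem isLevel_lev {P : Set Lat} (h : ∀ x ∈ P, 0 < hop P x) : IsLevel (hull P) (lev P) := by
  have hr : ∀ x ∈ hull P, (hopGraph P).Reachable x 0 := by
    rintro x (hx | hx)
    · by_contra hc
      have := h x hx
      rw [hop, if_neg hc] at this
      omega
    · by_cases hx0 : x = 0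
      · rw [hx0]
      · exact SimpleGraph.Adj.reachable
          (hopGraph_adj.2 ⟨.inr hx, zero_mem_hull P, adj_zero_of_mem_ball hx hx0⟩)
  refine ⟨zero_mem_hull P, by simp [lev], fun x hx hx0 => ?_, fun x hx y hy hxy => ?_⟩
  · obtain ⟨w, hw⟩ := (hr x hx).exists_walk_length_eq_dist
    cases w with
    | nil => exact absurd rfl hx0
    | @cons _ y _ hxy w =>
      have ha := hopGraph_adj.1 hxy
      refine ⟨y, ha.2.1, ha.2.2, ?_⟩
      have h1 := SimpleGraph.dist_le w
      obtain ⟨w', hw'⟩ := (hr y ha.2.1).exists_walk_length_eq_dist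
      have h2 := SimpleGraph.dist_le (SimpleGraph.Walk.cons hxy w')
      rw [SimpleGraph.Walk.length_cons] at h2 hw
      unfold lev
      omega
  · obtain ⟨w, hw⟩ := (hr y hy).exists_walk_length_eq_dist
    have h2 := SimpleGraph.dist_le (SimpleGraph.Walk.cons (hopGraph_adj.2 ⟨hx, hy, hxy⟩) w)
    rw [SimpleGraph.Walk.length_cons, hw] at h2
    exact h2

/-! ### The leveled structure of a proper ribbonization -/

section Shape

variable {S D : Finset Lat}

theorem ProperRibbonization.isLevel (h : ProperRibbonization S D) :
    IsLevel (hull S) (lev S) := isLevel_lev h.hop_pos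

theorem ProperRibbonization.hop_eq (h : ProperRibbonization S D) {x : Lat} (hx : x ∈ hull S) :
    hop S x = lev S x := hop_of_level h.isLevel hx

theorem ProperRibbonization.two_le_row (h : ProperRibbonization S D) {x : Lat} (hx : x ∈ S) :
    2 ≤ x.2 := h.subset_H1 hx

theorem ProperRibbonization.level_ball (h : ProperRibbonization S D) {x : Lat}
    (hx : sqDist x 0 ≤ 1) : lev S x ≤ 1 := by
  by_cases hx0 : x = 0
  · rw [hx0, h.isLevel.zero]; omega
  · have := h.isLevel.le_add_one x (.inr hx) 0 (zero_mem_hull _) (adj_zero_of_mem_ball hx hx0)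
    rw [h.isLevel.zero] at this
    omega

theorem ProperRibbonization.mem_ball_of_level (h : ProperRibbonization S D) {x : Lat}
    (hx : x ∈ hull S) (hl : lev S x ≤ 1) : sqDist x 0 ≤ 1 := by
  by_cases hx0 : x = 0
  · rw [hx0]; simp [sqDist]
  · obtain ⟨y, hy, hxy, e⟩ := h.isLevel.lower x hx hx0
    by_cases hy0 : y = 0
    · rw [hy0] at hxy
      exact sqDist_le_one_iff.2 (.inr hxy)
    · obtain ⟨z, _, _, e'⟩ := h.isLevel.lower y hy hy0
      omega

theorem ProperRibbonization.level_two (h : ProperRibbonization S D) {x : Lat}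
    (hx : x ∈ hull S) (hl : lev S x = 2) : x ∈ S ∧ x.2 = 2 ∧ -2 ≤ x.1 ∧ x.1 ≤ 0 := by
  have hxS : x ∈ S := hx.resolve_right fun hb => by have := h.level_ball hb; omega
  obtain ⟨y, hy, hxy, e⟩ := h.isLevel.lower x hx (by rintro rfl; rw [h.isLevel.zero] at hl; omega)
  have hb := ball_coord.1 (h.mem_ball_of_level hy (by omega))
  rw [adj_coord] at hxy
  have := h.two_le_row hxS
  refine ⟨hxS, ?_⟩
  omega

theorem ProperRibbonization.two_le_level (h : ProperRibbonization S D) {x : Lat} (hx : x ∈ S) :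
    2 ≤ lev S x := by
  by_contra hc
  have h1 := ball_coord.1 (h.mem_ball_of_level (.inl hx) (by omega))
  have h2 := h.two_le_row hx
  omega

/-- Only three lattice points of `H1` can have level two, and the root ribbon has three vertices. -/
theorem ProperRibbonization.root_mem (h : ProperRibbonization S D) :
    ∀ x : Lat, x.2 = 2 → -2 ≤ x.1 → x.1 ≤ 0 → x ∈ S ∧ lev S x = 2 := by
  obtain ⟨R, hR, hg, hc, -⟩ := h.root_ribbon
  have hRS : ∀ x ∈ R, x ∈ S := by
    obtain ⟨x, hx, rfl⟩ := hR
    intro y hy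
    have hy' : (ribbonGraph (S : Set Lat)).Reachable x y := hy
    obtain ⟨w⟩ := hy'.symm
    cases w with
    | nil => exact hx
    | cons h _ => exact h.2.1
  have hsub : R ⊆ ((({(-2, 2), (-1, 2), (0, 2)} : Finset Lat)) : Set Lat) := by
    intro x hx
    have h1 := hg x hx
    rw [h.hop_eq (.inl (hRS x hx))] at h1
    have h2 := (h.level_two (.inl (hRS x hx)) (by omega)).2
    have h3 : x.1 = -2 ∨ x.1 = -1 ∨ x.1 = 0 := by omega
    simp only [Finset.coe_insert, Finset.coe_singleton, Set.mem_insert_iff,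
      Set.mem_singleton_iff, Prod.ext_iff]
    omega
  have heq := Set.eq_of_subset_of_ncard_le hsub (by
    rw [hc, Set.ncard_coe_finset]; decide) (Finset.finite_toSet _)
  intro x h1 h2 h3
  have hx : x ∈ R := by
    rw [heq]
    simp only [Finset.coe_insert, Finset.coe_singleton, Set.mem_insert_iff,
      Set.mem_singleton_iff, Prod.ext_iff]
    omega
  have h4 := hg x hx
  rw [h.hop_eq (.inl (hRS x hx))] at h4
  exact ⟨hRS x hx, by omega⟩

theorem reflTransGen_of_induce_connected {A : Set Lat} (h : (latGraph.induce A).Connected)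
    {x y : Lat} (hx : x ∈ A) (hy : y ∈ A) : Relation.ReflTransGen (AdjIn A) x y := by
  obtain ⟨w⟩ := h.preconnected ⟨x, hx⟩ ⟨y, hy⟩
  have key : ∀ a b : A, (latGraph.induce A).Walk a b →
      Relation.ReflTransGen (AdjIn A) (a : Lat) (b : Lat) := by
    intro a b w
    induction w with
    | nil => exact .refl
    | @cons u v _ h _ ih => exact .head ⟨u.2, v.2, h⟩ ih
  exact key _ _ w

theorem ProperRibbonization.hull_row (h : ProperRibbonization S D) {x : Lat} (hx : x ∈ hull S) :
    2 ≤ x.2 ∨ sqDist x 0 ≤ 1 := by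
  rcases hx with hx | hx
  · exact .inl (h.two_le_row hx)
  · exact .inr hx

/-- Points up to row one have explicit potentials. The others are reached by a walk in the
complement of `S`, along which the potential is transferred. -/
theorem ProperRibbonization.windingTrivial (h : ProperRibbonization S D) :
    WindingTrivial (hull S) := by
  have low : ∀ p : Lat, p ∉ hull S → p.2 ≤ 1 → HasPotential (hull S) p := by
    intro p hp hp2
    have hb : ¬ sqDist p 0 ≤ 1 := fun hb => hp (.inr hb)
    rw [ball_coord] at hb
    by_cases h1 : 1 ≤ p.1
    · refine hasPotential_of_east fun x hx hx2 => ?_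
      have := h.hull_row hx
      rw [ball_coord] at this
      omega
    · by_cases h2 : p.2 ≤ -2
      · refine hasPotential_of_east fun x hx hx2 => ?_
        have := h.hull_row hx
        rw [ball_coord] at this
        omega
      · refine hasPotential_of_west fun x hx hx2 => ?_
        have := h.hull_row hx
        rw [ball_coord] at this
        omega
  -- The start `(0, -5)` is an arbitrary point far below the seeds.
  have key : ∀ p : Lat, Relation.ReflTransGen (AdjIn (S : Set Lat)ᶜ) ((0, -5) : Lat) p →
      p ∉ hull S → HasPotential (hull S) p := by
    intro p hp
    induction hp with
    | refl => exact fun hp => low _ hp (by norm_num)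
    | @tail b c _ hbc ih =>
      intro hc
      by_cases hc2 : c.2 ≤ 1
      · exact low c hc hc2
      have hcS : c ∉ S := hbc.2.1
      have hb : b ∉ hull S := by
        rintro (hb | hb)
        · exact hbc.1 hb
        -- Stepping from the seed hexagon up to row two would land on the root ribbon, which is in
        -- `S`.
        · have h1 := adj_coord.1 hbc.2.2
          rw [Set.mem_ofPred_eq, ball_coord] at hb
          exact hcS (h.root_mem c (by omega) (by omega) (by omega)).1
      exact (ih hb).transfer hbc.2.2 hb hc
  intro p hp
  refine key p (reflTransGen_of_induce_connected h.compl_connected ?_ ?_) hp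
  · intro hS
    have := h.two_le_row hS
    norm_num at this
  · exact fun hS => hp (.inl hS)

theorem hull_finite (S : Finset Lat) : (hull S).Finite := by
  refine S.finite_toSet.union ((Finset.finite_toSet
    ({(0, 0), (-1, 0), (1, 0), (0, 1), (0, -1), (1, -1), (-1, 1)} : Finset Lat)).subset ?_)
  intro x hx
  rw [Set.mem_ofPred_eq, ball_coord] at hx
  simp only [Finset.coe_insert, Finset.coe_singleton, Set.mem_insert_iff,
    Set.mem_singleton_iff, Prod.ext_iff]
  omega

theorem ProperRibbonization.leveled (h : ProperRibbonization S D) :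
    Leveled (hull S) (lev S) := by
  have hfin := hull_finite S
  have h1 := level_structure hfin.toFinset (lev S) (by simpa using h.isLevel)
    (by simpa using h.windingTrivial)
  rw [hfin.coe_toFinset] at h1
  refine ⟨h.isLevel, h1.1, h1.2, fun v hv hl => ?_, fun v hv hl => (h.level_two hv hl).2⟩
  have := ball_coord.1 (h.mem_ball_of_level hv hl.le)
  omega

end Shape

/-! ### The directed ribbons of a proper ribbonization -/

/-- The frontmost parent of a point of `S`. -/
abbrev parPt (S : Finset Lat) (v : Lat) : Lat := par (hull S) (lev S) v

/-- The position next to a point of `S` clockwise about its frontmost parent. -/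
abbrev nextPt (S : Finset Lat) (v : Lat) : Lat := nxt (hull S) (lev S) v

/-- A number that decreases along the ribbons of `S`. -/
abbrev keyPt (S : Finset Lat) (v : Lat) : ℕ := frontKey (hull S) (lev S) v

theorem ribbonOf_subset {P : Set Lat} {x : Lat} (hx : x ∈ P) : ribbonOf P x ⊆ P := by
  intro y hy
  obtain ⟨w⟩ := SimpleGraph.Reachable.symm hy
  cases w with
  | nil => exact hx
  | cons h _ => exact h.2.1

theorem mem_ribbonOf_self (P : Set Lat) (x : Lat) : x ∈ ribbonOf P x :=
  SimpleGraph.Reachable.refl x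

theorem ribbonOf_eq {P : Set Lat} {x y : Lat} (h : y ∈ ribbonOf P x) :
    ribbonOf P y = ribbonOf P x := by
  ext z
  exact ⟨fun hz => SimpleGraph.Reachable.trans h hz,
    fun hz => SimpleGraph.Reachable.trans (SimpleGraph.Reachable.symm h) hz⟩

theorem ribbonOf_eq_iff {P : Set Lat} {x y : Lat} :
    ribbonOf P y = ribbonOf P x ↔ y ∈ ribbonOf P x :=
  ⟨fun h => h ▸ mem_ribbonOf_self P y, ribbonOf_eq⟩

theorem ribbonOf_mem_ribbons {P : Set Lat} {x : Lat} (hx : x ∈ P) : ribbonOf P x ∈ ribbons P :=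
  ⟨x, hx, rfl⟩

theorem eq_ribbonOf {P : Set Lat} {R : Set Lat} (hR : R ∈ ribbons P) {x : Lat} (hx : x ∈ R) :
    R = ribbonOf P x := by
  obtain ⟨y, _, rfl⟩ := hR
  exact (ribbonOf_eq hx).symm

theorem hop_eq_of_mem_ribbonOf {P : Set Lat} {x y : Lat} (h : y ∈ ribbonOf P x) :
    hop P y = hop P x := by
  obtain ⟨w⟩ := h
  induction w with
  | nil => rfl
  | cons h _ ih => exact ih.trans h.2.2.2.symm

theorem RibbonArc.mem_ribbonOf {P : Set Lat} {x y : Lat} (h : RibbonArc P x y) :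
    y ∈ ribbonOf P x := by
  obtain ⟨hx, hy, e, z, hz, -, rfl⟩ := h
  obtain ⟨i, rfl⟩ := adj_iff_nb.1 hz
  rw [rotCW_nb] at *
  exact SimpleGraph.Adj.reachable ⟨adj_nb _ _, hx, hy, e.symm⟩

theorem InFront.mem_ribbonOf {P : Set Lat} {x y : Lat} (h : InFront P x y) :
    x ∈ ribbonOf P y := by
  induction h with
  | single h => exact h.mem_ribbonOf
  | tail _ h ih => exact SimpleGraph.Reachable.trans ih h.mem_ribbonOf

theorem InFront.mem {P : Set Lat} {x y : Lat} (h : InFront P x y) : x ∈ P := by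
  cases h with
  | single h => exact h.2.1
  | tail _ h => exact h.2.1

/-! ### The ribbons of the shape as chains of successors. -/

namespace ProperRibbonization

variable {S D : Finset Lat}

theorem ne_zero_of_mem (h : ProperRibbonization S D) {v : Lat} (hv : v ∈ S) : v ≠ 0 := by
  rintro rfl
  have := h.two_le_row hv
  norm_num at this

theorem mem_of_two_le (h : ProperRibbonization S D) {v : Lat} (hv : v ∈ hull S)
    (hl : 2 ≤ lev S v) : v ∈ S :=
  hv.resolve_right fun hb => by have := h.level_ball hb; omega

theorem nextPt_mem (h : ProperRibbonization S D) {v : Lat} (hv : v ∈ S)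
    (hn : nextPt S v ∈ hull S) : nextPt S v ∈ S := by
  refine h.mem_of_two_le hn ?_
  rw [h.leveled.level_nxt (.inl hv) (h.ne_zero_of_mem hv) hn]
  exact h.two_le_level hv

theorem level_nextPt (h : ProperRibbonization S D) {v : Lat} (hv : v ∈ S)
    (hn : nextPt S v ∈ S) : lev S (nextPt S v) = lev S v :=
  h.leveled.level_nxt (.inl hv) (h.ne_zero_of_mem hv) (.inl hn)

theorem parPt_mem_hull (h : ProperRibbonization S D) {v : Lat} (hv : v ∈ S) :
    parPt S v ∈ hull S := h.leveled.par_mem (.inl hv) (h.ne_zero_of_mem hv)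

theorem level_parPt (h : ProperRibbonization S D) {v : Lat} (hv : v ∈ S) :
    lev S v = lev S (parPt S v) + 1 := h.leveled.level_par (.inl hv) (h.ne_zero_of_mem hv)

theorem parPt_mem (h : ProperRibbonization S D) {v : Lat} (hv : v ∈ S) (hl : 3 ≤ lev S v) :
    parPt S v ∈ S := by
  have := h.level_parPt hv
  exact h.mem_of_two_le (h.parPt_mem_hull hv) (by omega)

/-- A neighbour of smaller hop count is a parent. -/
theorem isParentDir_of_hop (h : ProperRibbonization S D) {v : Lat} (hv : v ∈ S) {j : ZMod 6}
    (e : hop S (nb v j) = hop S v - 1) : IsParentDir (hull S) (lev S) v j := by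
  have h1 := h.hop_eq (.inl hv)
  have h2 := h.two_le_level hv
  have h3 : nb v j ∈ hull S := by
    by_contra hc
    rw [hop_of_notMem hc] at e
    omega
  have h4 := h.hop_eq h3
  exact ⟨h3, by omega⟩

/-- An arc may turn about any parent, but a turn about the rear one of two parents ends at the front
one, on a lower level. -/
theorem ribbonArc_iff (h : ProperRibbonization S D) {x y : Lat} :
    RibbonArc S x y ↔ x ∈ S ∧ y ∈ S ∧ y = nextPt S x := by
  constructor
  · rintro ⟨hx, hy, e, z, hz, e', rfl⟩
    refine ⟨hx, hy, ?_⟩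
    obtain ⟨j, rfl⟩ := adj_iff_nb.1 hz
    rw [rotCW_nb] at *
    rcases h.leveled.dir_eq_parentDir_or (.inl hx) (h.isParentDir_of_hop hx e') with h1 | h1
    · rw [h1]; rfl
    · exfalso
      rw [h1, add_assoc, show (5 : ZMod 6) + 1 = 0 from rfl, add_zero] at e
      have h2 := h.level_parPt hx
      rw [h.hop_eq (.inl hx)] at e
      have h3 : hop S (parPt S x) = lev S (parPt S x) := h.hop_eq (h.parPt_mem_hull hx)
      change hop S (parPt S x) = _ at e
      omega
  · rintro ⟨hx, hy, rfl⟩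
    refine ⟨hx, hy, ?_, parPt S x, adj_par _ _ _, ?_, (rotCW_par _ _ _).symm⟩
    · rw [h.hop_eq (.inl hx), h.hop_eq (.inl hy), h.level_nextPt hx hy]
    · rw [h.hop_eq (.inl hx), h.hop_eq (h.parPt_mem_hull hx)]
      have := h.level_parPt hx
      omega

theorem key_lt_of_inFront (h : ProperRibbonization S D) {x y : Lat} (hxy : InFront S x y) :
    keyPt S x < keyPt S y := by
  have step : ∀ {a b}, RibbonArc S a b → keyPt S b < keyPt S a := by
    intro a b hab
    obtain ⟨ha, hb, rfl⟩ := h.ribbonArc_iff.1 hab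
    exact h.leveled.frontKey_nxt_lt (.inl ha) (h.two_le_level ha) (.inl hb)
  induction hxy with
  | single h => exact step h
  | tail _ h ih => exact (step h).trans ih

theorem ribbonGraph_adj (h : ProperRibbonization S D) {x y : Lat}
    (hxy : (ribbonGraph (S : Set Lat)).Adj x y) : RibbonArc S x y ∨ RibbonArc S y x := by
  obtain ⟨ha, hx, hy, e⟩ := hxy
  rw [h.hop_eq (.inl hx), h.hop_eq (.inl hy)] at e
  rw [h.ribbonArc_iff, h.ribbonArc_iff]
  rcases h.leveled.nxt_or_nxt (.inl hx) (.inl hy) ha (by omega) with h1 | h1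
  · exact .inl ⟨hx, hy, h1⟩
  · exact .inr ⟨hy, hx, h1.symm⟩

theorem arc_unique_right (h : ProperRibbonization S D) {x y z : Lat} (h1 : RibbonArc S x y)
    (h2 : RibbonArc S x z) : y = z := by
  rw [h.ribbonArc_iff] at h1 h2
  rw [h1.2.2, h2.2.2]

theorem arc_unique_left (h : ProperRibbonization S D) {x y z : Lat} (h1 : RibbonArc S x z)
    (h2 : RibbonArc S y z) : x = y := by
  rw [h.ribbonArc_iff] at h1 h2
  have h3 : nextPt S x ∈ hull S := by rw [← h1.2.2]; exact .inl h1.2.1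
  exact h.leveled.nxt_injective (.inl h1.1) (.inl h2.1) (h.ne_zero_of_mem h1.1)
    (h.ne_zero_of_mem h2.1) h3 (h1.2.2.symm.trans h2.2.2)

/-- Adjacent vertices of a ribbon are joined by an arc, and arcs are unique in both directions, so a
ribbon is a chain. With `key_lt_of_inFront` it has no cycle. -/
theorem trichotomy (h : ProperRibbonization S D) {x y : Lat} (hy : y ∈ ribbonOf S x) :
    InFront S y x ∨ y = x ∨ InFront S x y := by
  have hy' : (ribbonGraph (S : Set Lat)).Reachable x y := hy
  rw [SimpleGraph.reachable_iff_reflTransGen] at hy'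
  induction hy' with
  | refl => exact .inr (.inl rfl)
  | @tail y z _ hyz ih =>
    have hy := ih (by
      rw [ribbonOf, Set.mem_ofPred_eq, SimpleGraph.reachable_iff_reflTransGen]
      assumption)
    rcases h.ribbonGraph_adj hyz with ha | ha
    · rcases hy with h1 | rfl | h1
      · exact .inl (h1.tail ha)
      · exact .inl (.single ha)
      · rcases Relation.TransGen.head'_iff.1 h1 with ⟨w, hw, hwx⟩
        rw [h.arc_unique_right hw ha] at hwx
        rcases Relation.reflTransGen_iff_eq_or_transGen.1 hwx with h2 | h2
        · exact .inr (.inl h2.symm)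
        · exact .inr (.inr h2)
    · rcases hy with h1 | rfl | h1
      · rcases Relation.TransGen.tail'_iff.1 h1 with ⟨w, hwx, hw⟩
        rw [h.arc_unique_left hw ha] at hwx
        rcases Relation.reflTransGen_iff_eq_or_transGen.1 hwx with h2 | h2
        · exact .inr (.inl h2)
        · exact .inl h2
      · exact .inr (.inr (.single ha))
      · exact .inr (.inr (.head ha h1))

theorem not_inFront_self (h : ProperRibbonization S D) (x : Lat) : ¬ InFront S x x :=
  fun hx => (h.key_lt_of_inFront hx).ne rfl

theorem level_eq_of_mem_ribbonOf (h : ProperRibbonization S D) {x y : Lat} (hx : x ∈ S)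
    (hy : y ∈ ribbonOf S x) : lev S y = lev S x := by
  have := hop_eq_of_mem_ribbonOf hy
  rw [h.hop_eq (.inl hx), h.hop_eq (.inl (ribbonOf_subset hx hy))] at this
  omega

/-! ### First vertices -/

theorem isFirstVertex_iff (h : ProperRibbonization S D) {x₀ x : Lat} (hx₀ : x₀ ∈ S) :
    IsFirstVertex S (ribbonOf S x₀) x ↔ x ∈ ribbonOf S x₀ ∧ nextPt S x ∉ S := by
  refine and_congr_right fun hx => ?_
  have hxS := ribbonOf_subset hx₀ hx
  constructor
  · intro hf hn
    have ha : RibbonArc S x (nextPt S x) := h.ribbonArc_iff.2 ⟨hxS, hn, rfl⟩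
    exact hf _ (SimpleGraph.Reachable.trans hx ha.mem_ribbonOf) (.single ha)
  · intro hn y _ hyx
    rcases Relation.TransGen.head'_iff.1 hyx with ⟨w, hw, _⟩
    have := h.ribbonArc_iff.1 hw
    exact hn (this.2.2 ▸ this.2.1)

theorem exists_first (h : ProperRibbonization S D) {x₀ : Lat} (hx₀ : x₀ ∈ S) :
    ∃ x ∈ ribbonOf S x₀, nextPt S x ∉ S := by
  have hfin : (ribbonOf (S : Set Lat) x₀).Finite := S.finite_toSet.subset (ribbonOf_subset hx₀)
  obtain ⟨x, hx, hmin⟩ := Set.exists_min_image _ (keyPt S) hfin ⟨x₀, mem_ribbonOf_self _ _⟩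
  refine ⟨x, hx, fun hn => ?_⟩
  have ha : RibbonArc S x (nextPt S x) := h.ribbonArc_iff.2 ⟨ribbonOf_subset hx₀ hx, hn, rfl⟩
  have h1 := hmin _ (SimpleGraph.Reachable.trans hx ha.mem_ribbonOf)
  have h2 := h.key_lt_of_inFront (.single ha)
  omega

theorem inFront_of_first (h : ProperRibbonization S D) {x y : Lat} (hx : x ∈ ribbonOf S y)
    (hn : nextPt S x ∉ S) : x = y ∨ InFront S x y := by
  rcases h.trichotomy hx with h1 | h1 | h1
  · exact .inr h1
  · exact .inl h1
  · rcases Relation.TransGen.head'_iff.1 h1 with ⟨w, hw, _⟩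
    have := h.ribbonArc_iff.1 hw
    exact absurd (this.2.2 ▸ this.2.1) hn

theorem first_unique (h : ProperRibbonization S D) {x y : Lat} (hx : x ∈ ribbonOf S y)
    (hn : nextPt S x ∉ S) (hn' : nextPt S y ∉ S) : x = y := by
  rcases h.inFront_of_first hx hn with h1 | h1
  · exact h1
  · rcases h.inFront_of_first (SimpleGraph.Reachable.symm hx) hn' with h2 | h2
    · exact h2.symm
    · exact absurd (Relation.TransGen.trans h1 h2) (h.not_inFront_self _)

/-- Turns about `p1` and `p2` stay in the filled root row up to its east end. So the root ribbon
always merges at the fixed point to the right of `p2`, where the walk around the shape is to arrive.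
-/
theorem level_two_nextPt (h : ProperRibbonization S D) {v : Lat} (hv : v ∈ S)
    (hl : lev S v = 2) : nextPt S v ∉ S → v = (0, 2) ∧ nextPt S v = (1, 1) ∧
      parPt S v = (0, 1) := by
  intro hn
  have b1 := (h.level_two (.inl hv) hl).2
  have b2 := h.level_parPt hv
  have b3 := ball_coord.1 (h.mem_ball_of_level (h.parPt_mem_hull hv) (by omega))
  have a1 : rotCW (parPt S v) v = nextPt S v := rotCW_par _ _ _
  have a2 := congrArg Prod.fst a1
  have a3 := congrArg Prod.snd a1
  have a4 : latGraph.Adj v (parPt S v) := adj_par _ _ _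
  rw [adj_coord] at a4
  simp only [rotCW] at a2 a3
  have a5 := fun h1 h2 h3 => hn (h.root_mem (nextPt S v) h1 h2 h3).1
  have a6 : ¬ sqDist (nextPt S v) 0 ≤ 1 := by
    intro hb
    have l1 := h.level_ball hb
    have l2 := h.isLevel.le_add_one v (.inl hv) (nextPt S v) (.inr hb) (adj_nxt _ _ _)
    exact (h.leveled.parentDir_spec (.inl hv) (h.ne_zero_of_mem hv)).2
      ⟨.inr hb, show _ = lev S (nextPt S v) + 1 by omega⟩
  rw [ball_coord] at a6
  rw [Prod.ext_iff, Prod.ext_iff, Prod.ext_iff]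
  dsimp only
  generalize nextPt S v = n at *
  generalize parPt S v = p at *
  by_cases hp : p.1 = -1
  · exfalso
    exact a5 (by omega) (by omega) (by omega)
  · have hv0 : v.1 = 0 := by
      by_contra hv0
      exact a5 (by omega) (by omega) (by omega)
    omega

/-! ### Parent ribbons -/

theorem parent_mem_ribbonOf_parPt (h : ProperRibbonization S D) {v : Lat} (hv : v ∈ S)
    (hl : 3 ≤ lev S v) {j : ZMod 6} (hj : IsParentDir (hull S) (lev S) v j) :
    nb v j ∈ ribbonOf S (parPt S v) := by
  rcases h.leveled.dir_eq_parentDir_or (.inl hv) hj with h1 | h1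
  · rw [h1]; exact mem_ribbonOf_self _ _
  · have h2 := h.parPt_mem hv hl
    have h3 := h.level_parPt hv
    have h4 := hj.2
    have h5 : nb v j ∈ S := h.mem_of_two_le hj.1 (by omega)
    refine SimpleGraph.Adj.reachable ⟨?_, h2, h5, ?_⟩
    · rw [h1]; exact adj_nb_nb.2 (.inr rfl)
    · rw [h.hop_eq (.inl h2), h.hop_eq hj.1]; omega

/-- By `par_nxt`, the frontmost parent stays or moves along one arc whenever the child moves along
one. -/
theorem parPt_mem_ribbonOf (h : ProperRibbonization S D) {x y : Lat} (hx : x ∈ S)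
    (hl : 3 ≤ lev S x) (hy : y ∈ ribbonOf S x) : parPt S y ∈ ribbonOf S (parPt S x) := by
  have step : ∀ a b, 3 ≤ lev S a → RibbonArc S a b → parPt S b ∈ ribbonOf S (parPt S a) := by
    intro a b hl hab
    obtain ⟨ha, hb, rfl⟩ := h.ribbonArc_iff.1 hab
    rcases h.leveled.par_nxt (.inl ha) (h.two_le_level ha) (.inl hb) with h1 | h1
    · have e : parPt S (nextPt S a) = parPt S a := h1.1
      rw [e]; exact mem_ribbonOf_self _ _
    · have e : parPt S (nextPt S a) = nextPt S (parPt S a) := h1.1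
      rw [e]
      have hp := h.parPt_mem ha hl
      exact (h.ribbonArc_iff.2 ⟨hp, h.nextPt_mem hp h1.2, rfl⟩).mem_ribbonOf
  have main : ∀ a b, InFront S b a → 3 ≤ lev S a → a ∈ S →
      parPt S b ∈ ribbonOf S (parPt S a) := by
    intro a b hab hl ha
    induction hab with
    | single h1 => exact step _ _ hl h1
    | @tail b c h1 h2 ih =>
      have : lev S b = lev S a := h.level_eq_of_mem_ribbonOf ha (InFront.mem_ribbonOf h1)
      exact SimpleGraph.Reachable.trans ih (step _ _ (by omega) h2)
  have hlev := h.level_eq_of_mem_ribbonOf hx hy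
  rcases h.trichotomy hy with h1 | rfl | h1
  · exact main _ _ h1 hl hx
  · exact mem_ribbonOf_self _ _
  · exact SimpleGraph.Reachable.symm (main _ _ h1 (by omega) (ribbonOf_subset hx hy))

/-- Level two is separate: there the parents are `p1` and `p2`, which are not points of `S`. -/
theorem parent_mem_parentVertices (h : ProperRibbonization S D) {x₀ x : Lat} (hx₀ : x₀ ∈ S)
    (hx : x ∈ ribbonOf S x₀) {j : ZMod 6} (hj : IsParentDir (hull S) (lev S) x j) :
    nb x j ∈ parentVertices S (ribbonOf S x₀) := by
  have hxS := ribbonOf_subset hx₀ hx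
  have hlx := h.level_eq_of_mem_ribbonOf hx₀ hx
  have h2 := h.two_le_level hx₀
  have hop_lev : ∀ z ∈ ribbonOf S x₀, hop S z = lev S x₀ := fun z hz => by
    rw [h.hop_eq (.inl (ribbonOf_subset hx₀ hz)), h.level_eq_of_mem_ribbonOf hx₀ hz]
  rcases h2.eq_or_lt with h2 | h2
  · have hlevel : ∀ z ∈ ({p1, p2} : Set Lat), hop S z = 1 := by
      intro z hz
      have hb : sqDist z 0 ≤ 1 := by
        rcases hz with rfl | rfl <;> decide
      have hz0 : z ≠ 0 := by rcases hz with rfl | rfl <;> decide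
      rw [h.hop_eq (.inr hb)]
      have h3 := h.level_ball hb
      obtain ⟨y, _, _, e⟩ := h.isLevel.lower z (.inr hb) hz0
      omega
    have hmem : ∀ z ∈ ribbonOf S x₀, ∀ j, IsParentDir (hull S) (lev S) z j →
        nb z j ∈ ({p1, p2} : Set Lat) := by
      intro z hz j hj
      have hzS := ribbonOf_subset hx₀ hz
      have hlz := h.level_eq_of_mem_ribbonOf hx₀ hz
      have h3 := hj.2
      have h4 := ball_coord.1 (h.mem_ball_of_level hj.1 (by omega))
      have h5 := adj_coord.1 (adj_nb z j)
      have h6 := h.two_le_row hzS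
      simp only [p1, p2, Set.mem_insert_iff, Set.mem_singleton_iff, Prod.ext_iff]
      omega
    refine ⟨{p1, p2}, .inl rfl, ⟨fun z hz y hy => ?_, fun z hz => ?_⟩, hmem x hx j hj⟩
    · rw [hlevel y hy, hop_lev z hz]; omega
    · have hzS := ribbonOf_subset hx₀ hz
      exact ⟨_, hmem z hz _ (h.leveled.parentDir_spec (.inl hzS) (h.ne_zero_of_mem hzS)).1,
        adj_nb _ _⟩
  · have hp := h.parPt_mem hx₀ h2
    have hlp := h.level_parPt hx₀
    refine ⟨ribbonOf S (parPt S x₀), .inr (ribbonOf_mem_ribbons hp), ⟨fun z hz y hy => ?_,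
      fun z hz => ⟨parPt S z, h.parPt_mem_ribbonOf hx₀ h2 hz, adj_par _ _ _⟩⟩, ?_⟩
    · rw [hop_lev z hz, hop_eq_of_mem_ribbonOf hy, h.hop_eq (.inl hp)]
      omega
    · exact SimpleGraph.Reachable.trans (h.parPt_mem_ribbonOf hx₀ h2 hx)
        (h.parent_mem_ribbonOf_parPt hxS (by omega) hj)

theorem hop_of_mem_parentVertices {x₀ x y : Lat}
    (hx : x ∈ ribbonOf S x₀) (hy : y ∈ parentVertices S (ribbonOf S x₀)) :
    hop S y = hop S x - 1 := by
  obtain ⟨Q, _, hQ, hyQ⟩ := hy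
  exact hQ.1 x hx y hyQ

theorem parentVertices_cases {x₀ y : Lat} (hx₀ : x₀ ∈ S)
    (hy : y ∈ parentVertices S (ribbonOf S x₀)) :
    y = p1 ∨ y = p2 ∨ (y ∈ S ∧ TreeLt S (ribbonOf S y) (ribbonOf S x₀)) := by
  obtain ⟨Q, hQ, hrel, hyQ⟩ := hy
  rcases hQ with rfl | hQ
  · rcases hyQ with h | h
    · exact .inl h
    · exact .inr (.inl h)
  · right; right
    have e := eq_ribbonOf hQ hyQ
    obtain ⟨z, hz, e'⟩ := id hQ
    refine ⟨?_, ?_⟩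
    · rw [← e'] at hyQ
      exact ribbonOf_subset hz hyQ
    · rw [← e]
      exact .single ⟨hQ, ribbonOf_mem_ribbons hx₀, hrel⟩

/-! ### Merging points -/

/-- A merging point lies next to a parent of the first vertex. Ahead of the frontmost parent this is
the successor; the position behind the backmost parent is taken by the predecessor, which exists
because a ribbon has at least two vertices. -/
theorem isMergingPoint_iff (h : ProperRibbonization S D) {x₀ x m : Lat} (hx₀ : x₀ ∈ S)
    (hx : x ∈ ribbonOf S x₀) (hn : nextPt S x ∉ S) :
    IsMergingPoint S (ribbonOf S x₀) m ↔ m = nextPt S x := by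
  have hxS := ribbonOf_subset hx₀ hx
  have hfirst : IsFirstVertex S (ribbonOf S x₀) x := (h.isFirstVertex_iff hx₀).2 ⟨hx, hn⟩
  obtain ⟨hpd, hpd'⟩ := h.leveled.parentDir_spec (.inl hxS) (h.ne_zero_of_mem hxS)
  constructor
  · rintro ⟨hmS, x', hx', hmx, y, hy, hyx, hym⟩
    have hxx : x' = x := by
      rw [h.isFirstVertex_iff hx₀] at hx'
      exact h.first_unique (SimpleGraph.Reachable.trans (SimpleGraph.Reachable.symm hx) hx'.1)
        hx'.2 hn
    subst hxx
    obtain ⟨j, rfl⟩ := adj_iff_nb.1 hyx.symm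
    obtain ⟨k, rfl⟩ := adj_iff_nb.1 hmx.symm
    have hj := h.isParentDir_of_hop hxS (hop_of_mem_parentVertices hx hy)
    -- A parent outside `S` is a seed next to the root ribbon; at its east end `(0, 2)` the only
    -- parent is `p2`.
    have hball : ¬ IsParentDir (hull S) (lev S) x' k := by
      intro hk
      have hkb := hk.1.resolve_left hmS
      have l1 := h.level_ball hkb
      have l2 := hk.2
      have l3 := h.two_le_level hxS
      obtain ⟨rfl, -, -⟩ := h.level_two_nextPt hxS (by omega) hn
      have c1 := ball_coord.1 hkb
      have c2 := adj_coord.1 hmx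
      have l4 := hj.2
      have c3 := ball_coord.1 (h.mem_ball_of_level hj.1 (by omega))
      have c4 := adj_coord.1 hyx
      have c5 := adj_coord.1 hym
      dsimp only at c2 c4
      omega
    -- the predecessor of the first vertex
    obtain ⟨z, hz, hzn⟩ : ∃ z ∈ S, nextPt S z = x' := by
      have hcard := h.two_le_length _ (ribbonOf_mem_ribbons (P := (S : Set Lat)) hx₀)
      obtain ⟨w, hw, hwx⟩ := Set.exists_ne_of_one_lt_ncard (by omega :
        1 < (ribbonOf (S : Set Lat) x₀).ncard) x'
      rcases h.inFront_of_first (SimpleGraph.Reachable.trans (SimpleGraph.Reachable.symm hw) hx)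
        hn with h1 | h1
      · exact absurd h1.symm hwx
      · rcases Relation.TransGen.tail'_iff.1 h1 with ⟨z, _, hz⟩
        have := h.ribbonArc_iff.1 hz
        exact ⟨z, this.1, this.2.2.symm⟩
    obtain ⟨b1, b2, -, b4⟩ := h.leveled.backmost_of_nxt (v := z) (.inl hz) (h.ne_zero_of_mem hz)
      (by change nextPt S z ∈ _; rw [hzn]; exact .inl hxS)
    change IsParentDir _ _ (nextPt S z) _ at b1
    change ¬ IsParentDir _ _ (nextPt S z) _ at b2
    change nb (nextPt S z) _ = _ at b4
    rw [hzn] at b1 b2 b4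
    have b5 := h.leveled.dir_eq_parentDir_or (.inl hxS) b1
    have hkz : k ≠ parentDir (hull S) (lev S) z + 4 := by
      rintro rfl
      rw [b4] at hmS
      exact hmS hz
    rw [adj_nb_nb] at hym
    change _ = nb x' _
    rw [nb_inj]
    have hj' := h.leveled.dir_eq_parentDir_or (.inl hxS) hj
    generalize parentDir (hull S) (lev S) z = a at *
    generalize parentDir (hull S) (lev S) x' = b at *
    rcases hj' with rfl | rfl
    · rcases hym with rfl | rfl
      · rfl
      · exfalso
        rcases b5 with b5 | b5
        · apply hkz
          rw [← b5]
          clear * -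
          revert a; decide
        · rw [b5] at b1
          exact hball b1
    · rcases hym with rfl | rfl
      · exfalso
        apply hball
        rwa [add_assoc, show (5 : ZMod 6) + 1 = 0 from rfl, add_zero]
      · exfalso
        rcases b5 with b5 | b5
        · apply b2
          have : a + 4 = b + 5 := by
            rw [← b5]
            clear * -
            revert a; decide
          rwa [this]
        · apply hkz
          rw [← b5]
          clear * -
          revert a; decide
  · rintro rfl
    refine ⟨hn, x, hfirst, (adj_nxt _ _ _).symm, parPt S x,
      h.parent_mem_parentVertices hx₀ hx hpd, (adj_par _ _ _).symm, ?_⟩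
    exact adj_nb_nb.2 (.inl rfl)

end ProperRibbonization

/-! ### Walking around the shape -/

/-- The robot turns clockwise by `π / 3` from `q` to `q'` about a point of `A` that lies in `C`,
and neither `q` nor `q'` is in `A`. -/
def Turn (A C : Set Lat) (q q' : Lat) : Prop :=
  ∃ c ∈ C, c ∈ A ∧ latGraph.Adj c q ∧ q ∉ A ∧ q' = rotCW c q ∧ q' ∉ A

theorem Turn.mono {A C C' : Set Lat} (h : C ⊆ C') {q q' : Lat} (ht : Turn A C q q') :
    Turn A C' q q' := by
  obtain ⟨c, hc, h1⟩ := ht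
  exact ⟨c, h hc, h1⟩

theorem turns_mono {A C C' : Set Lat} (h : C ⊆ C') {q q' : Lat}
    (ht : Relation.ReflTransGen (Turn A C) q q') :
    Relation.ReflTransGen (Turn A C') q q' := by
  induction ht with
  | refl => exact .refl
  | tail _ h1 ih => exact ih.tail (h1.mono h)

/-- The ancestor of level `g` of a point of `S`. -/
def ancestor (S : Finset Lat) (g : ℕ) (t : Lat) : Lat := (parPt S)^[lev S t - g] t

/-- The centers met by a walk around the descendants of a ribbon of level `g`. -/
def region (S : Finset Lat) (g K m : ℕ) : Set Lat :=
  {t | t ∈ S ∧ g ≤ lev S t ∧ keyPt S (ancestor S g t) ≤ K ∧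
    (g + 1 ≤ lev S t → keyPt S (ancestor S (g + 1) t) < m)}

theorem region_mono {S : Finset Lat} {g K K' m m' : ℕ} (hK : K ≤ K') (hm : m ≤ m') :
    region S g K m ⊆ region S g K' m' :=
  fun _ ⟨h1, h2, h3, h4⟩ => ⟨h1, h2, h3.trans hK, fun h => (h4 h).trans_le hm⟩

namespace ProperRibbonization

variable {S D : Finset Lat}

theorem ancestor_spec (h : ProperRibbonization S D) {t : Lat} (ht : t ∈ S) {g : ℕ} (hg : 2 ≤ g)
    (hgt : g ≤ lev S t) : ancestor S g t ∈ S ∧ lev S (ancestor S g t) = g := by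
  obtain ⟨n, hn⟩ : ∃ n, lev S t = g + n := ⟨lev S t - g, by omega⟩
  have : lev S t - g = n := by omega
  rw [ancestor, this]
  clear this
  induction n generalizing t with
  | zero => exact ⟨ht, by simpa using hn⟩
  | succ n ih =>
    rw [Function.iterate_succ_apply]
    have := h.level_parPt ht
    exact ih (h.parPt_mem ht (by omega)) (by omega) (by omega)

theorem ancestor_self {S : Finset Lat} {t : Lat} {g : ℕ} (h : lev S t = g) :
    ancestor S g t = t := by
  rw [ancestor, h, Nat.sub_self]
  rfl

theorem parPt_ancestor {S : Finset Lat} {t : Lat} {g : ℕ} (hgt : g + 1 ≤ lev S t) :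
    parPt S (ancestor S (g + 1) t) = ancestor S g t := by
  rw [ancestor, ancestor, ← Function.iterate_succ_apply' (parPt S)]
  congr 1
  omega

theorem key_eq (h : ProperRibbonization S D) {v : Lat} (hv : v ∈ S) (hl : 3 ≤ lev S v) :
    keyPt S v = 6 * keyPt S (parPt S v) +
      turnCount (hull S) (lev S) (parPt S v) (parentDir (hull S) (lev S) v + 3) :=
  h.leveled.frontKey_eq (.inl hv) hl

/-- Regarded as a neighbour of the parent of `v`, the successor position has a walk measure one less
than the key of `v`. This lets the walk go on after a ribbon has been rounded. -/
theorem key_nextPt (h : ProperRibbonization S D) {v : Lat} (hv : v ∈ S)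
    (hl : 3 ≤ lev S v) : 6 * keyPt S (parPt S v) +
      turnCount (hull S) (lev S) (parPt S v) (parentDir (hull S) (lev S) v + 2) + 1 =
      keyPt S v := by
  rw [h.key_eq hv hl]
  have hp := h.parPt_mem hv hl
  have hne : parentDir (hull S) (lev S) v + 3 ≠ parentDir (hull S) (lev S) (parPt S v) := by
    intro e
    have h5 := h.level_parPt hp
    have h6 : parPt S (parPt S v) = v := by
      rw [parPt, par.eq_def (hull S) (lev S) (parPt S v), ← e]
      exact nb_par _ _ _
    rw [h6] at h5
    have := h.level_parPt hv
    omega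
  have h7 := turnCount_succ hne
  rw [add_assoc, show (3 : ZMod 6) + 5 = 2 from rfl] at h7
  omega

/-- The predecessor sits just behind the backmost parent; the two cases correspond to one and two
parents. -/
theorem dir_of_nextPt (h : ProperRibbonization S D) {v : Lat} {j : ZMod 6} (hv : v ∈ S)
    (hw : nb v j ∈ S) (e : nextPt S (nb v j) = v) :
    j = parentDir (hull S) (lev S) v + 5 ∨ (j = parentDir (hull S) (lev S) v + 4 ∧
      IsParentDir (hull S) (lev S) v (parentDir (hull S) (lev S) v + 5)) := by
  obtain ⟨b1, -, -, b4⟩ := h.leveled.backmost_of_nxt (v := nb v j) (.inl hw)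
    (h.ne_zero_of_mem hw) (by change nextPt S _ ∈ _; rw [e]; exact .inl hv)
  change IsParentDir _ _ (nextPt S _) _ at b1
  change nb (nextPt S _) _ = _ at b4
  rw [e] at b1 b4
  rw [nb_inj] at b4
  have hj := h.leveled.dir_eq_parentDir_or (.inl hv) b1
  generalize parentDir (hull S) (lev S) (nb v j) = a at *
  generalize parentDir (hull S) (lev S) v = b at *
  subst b4
  rcases hj with hj | hj
  · left
    rw [← hj]
    clear * -
    revert a; decide
  · right
    rw [hj] at b1
    exact ⟨by rw [add_right_cancel hj], b1⟩

/-- From a free neighbour of `v`, a robot that keeps turning clockwise gets to the merging point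
of the ribbon of `v`, turning only about vertices of that ribbon and of its descendants. -/
theorem exists_turns_to_front (h : ProperRibbonization S D) {A : Set Lat}
    (hA : ∀ q : Lat, 1 ≤ q.2 → (q ∈ A ↔ q ∈ hull S)) (n : ℕ) :
    ∀ g, (∀ t ∈ S, lev S t < g + n) → ∀ (m : ℕ) (v : Lat) (k : ZMod 6), v ∈ S → lev S v = g →
      nb v k ∉ A → 6 * keyPt S v + turnCount (hull S) (lev S) v k = m →
      ∃ x ∈ ribbonOf S v, nextPt S x ∉ S ∧
        Relation.ReflTransGen (Turn A (region S g (keyPt S v) m)) (nb v k) (nextPt S x) := by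
  induction n with
  | zero =>
    intro g hg m v k hv hl
    have := hg v hv
    omega
  | succ n ihn =>
  intro g hg m
  induction m using Nat.strong_induction_on with
  | _ m ihm =>
  intro v k hv hl hk hm
  have hrow : ∀ j, 1 ≤ (nb v j).2 := fun j => by
    have h1 := adj_coord.1 (adj_nb v j)
    have h2 := h.two_le_row hv
    omega
  have hvA : v ∈ A := (hA v (by have := h.two_le_row hv; omega)).2 (.inl hv)
  have hg2 : 2 ≤ g := hl ▸ h.two_le_level hv
  obtain ⟨hpd, hpd'⟩ := h.leveled.parentDir_spec (.inl hv) (h.ne_zero_of_mem hv)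
  have hparent : ∀ j, IsParentDir (hull S) (lev S) v j → j ≠ k := by
    rintro j hj rfl
    exact hk ((hA _ (hrow j)).2 hj.1)
  have hki := hparent _ hpd
  have htc := turnCount_succ hki.symm
  have htc5 := turnCount_le (hull S) (lev S) v k
  have hkk : k + 5 + 1 = k := by rw [add_assoc, show (5 : ZMod 6) + 1 = 0 from rfl, add_zero]
  -- One step ahead of the frontmost parent the position is the successor itself; since it is free,
  -- `v` is the first vertex.
  by_cases hk1 : k = parentDir (hull S) (lev S) v + 1
  · refine ⟨v, mem_ribbonOf_self _ _, ?_, ?_⟩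
    · intro hn
      apply hk
      rw [hk1]
      exact (hA _ (hrow _)).2 (.inl hn)
    · rw [hk1]
      exact .refl
  have hrot : rotCW v (nb v k) = nb v (k + 5) := rotCW_center_nb _ _
  have hk0 : k + 5 ≠ parentDir (hull S) (lev S) v := by
    intro e
    apply hk1
    rw [← e, hkk]
  have hk5 : k + 5 ≠ parentDir (hull S) (lev S) v + 5 := fun e =>
    hki.symm (add_right_cancel e)
  by_cases hq : nb v (k + 5) ∈ A
  swap
  · -- turn about `v`
    obtain ⟨x, hx, hn, hw⟩ := ihm (m - 1) (by omega) v (k + 5) hv hl hq (by omega)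
    refine ⟨x, hx, hn, .head ⟨v, ?_, hvA, (adj_nb v k), hk, hrot.symm, hq⟩
      (turns_mono (region_mono le_rfl (by omega)) hw)⟩
    refine ⟨hv, hl.ge, by rw [ancestor_self hl], fun h1 => by omega⟩
  have hqh := (hA _ (hrow _)).1 hq
  have hqp : ¬ IsParentDir (hull S) (lev S) v (k + 5) := by
    intro hc
    rcases h.leveled.dir_eq_parentDir_or (.inl hv) hc with e | e
    · exact hk0 e
    · exact hk5 e
  have hlip := h.isLevel.le_add_one v (.inl hv) _ hqh (adj_nb _ _)
  have hlip' := h.isLevel.le_add_one _ hqh v (.inl hv) (adj_nb _ _).symm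
  have hlq : lev S v ≤ lev S (nb v (k + 5)) := by
    by_contra hc
    exact hqp ⟨hqh, by omega⟩
  have hqS : nb v (k + 5) ∈ S := h.mem_of_two_le hqh (by omega)
  -- a vertex of level `g` adjacent to `v` in a direction that precedes `k` is the next one
  have hsame : ∀ j, nb v j ∈ S → lev S (nb v j) = g → (j = k + 5 ∨ j = k + 4) →
      nb v j = nextPt S v := by
    intro j hj hlj hjk
    rcases h.leveled.nxt_or_nxt (.inl hv) (.inl hj) (adj_nb _ _) (by omega) with e | e
    · exact e
    exfalso
    have hd := h.dir_of_nextPt hv hj e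
    rcases hjk with rfl | rfl
    · rcases hd with e | ⟨e, hp⟩
      · exact hk5 e
      · apply hparent _ hp
        generalize parentDir (hull S) (lev S) v = b at *
        clear * - e
        revert k b; decide
    · rcases hd with e | ⟨e, hp⟩
      · apply hk0
        generalize parentDir (hull S) (lev S) v = b at *
        clear * - e
        revert k b; decide
      · exact hki.symm (add_right_cancel e)
  by_cases hlg : lev S (nb v (k + 5)) = g
  · -- pivot to the next vertex of the ribbon
    -- The robot does not move here: its position is renamed as a neighbour of the successor, whose
    -- smaller key outweighs a turn count of at most five.
    have e := hsame _ hqS hlg (.inl rfl)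
    have e2 : nb v k = nb (nextPt S v) (k + 5 + 2) := by
      rw [← e, nb_nb_add_two, hkk]
    have hnS : nextPt S v ∈ S := e ▸ hqS
    have hkey := h.leveled.frontKey_nxt_lt (.inl hv) (by omega) (.inl hnS)
    change keyPt S (nextPt S v) < keyPt S v at hkey
    have := turnCount_le (hull S) (lev S) (nextPt S v) (k + 5 + 2)
    obtain ⟨x, hx, hn, hw⟩ := ihm _ (by omega) (nextPt S v) (k + 5 + 2) hnS
      (by rw [← e]; exact hlg) (by rwa [← e2]) rfl
    rw [← e2] at hw
    have ha : RibbonArc S v (nextPt S v) := h.ribbonArc_iff.2 ⟨hv, hnS, rfl⟩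
    exact ⟨x, SimpleGraph.Reachable.trans ha.mem_ribbonOf hx, hn,
      turns_mono (region_mono hkey.le (by omega)) hw⟩
  · -- pivot to a child, and walk around its ribbon
    obtain ⟨s, hs⟩ : ∃ s, s = nb v (k + 5) := ⟨_, rfl⟩
    have hls : lev S s = g + 1 := by rw [hs]; omega
    have hsS : s ∈ S := hs ▸ hqS
    have hkq : nb v k = nb s (k + 5 + 2) := by rw [hs, nb_nb_add_two, hkk]
    have hsv : nb s (k + 5 + 3) = v := by rw [hs, nb_nb_add_three]
    have hspd : IsParentDir (hull S) (lev S) s (k + 5 + 3) :=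
      ⟨by rw [hsv]; exact .inl hv, by rw [hsv]; omega⟩
    -- If `v` is the frontmost parent of the child, its key is the measure after one more turn about
    -- `v`; otherwise its frontmost parent is the successor of `v`, with a smaller key.
    have hkeys : keyPt S s < m := by
      rw [h.key_eq hsS (by omega)]
      rcases h.leveled.dir_eq_parentDir_or (.inl hsS) hspd with e | e
      · have e2 : parPt S s = v := by rw [← hsv, e]; rfl
        rw [e2, ← e, add_assoc (k + 5), show (3 : ZMod 6) + 3 = 0 from rfl, add_zero]
        omega
      · have e2 : parPt S s = nb v (k + 4) := by
          have : parentDir (hull S) (lev S) s = k + 5 + 4 := by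
            generalize parentDir (hull S) (lev S) s = b at *
            clear * - e
            revert k b; decide
          change nb s _ = _
          rw [this, hs, nb_nb_add_four, add_assoc]
          rfl
        have e3 := hsame (k + 4) (e2 ▸ h.parPt_mem hsS (by omega))
          (by rw [← e2]; have := h.level_parPt hsS; omega) (.inr rfl)
        have hkey := h.leveled.frontKey_nxt_lt (.inl hv) (by omega)
          (by change nextPt S v ∈ _; rw [← e3, ← e2]; exact h.parPt_mem_hull hsS)
        change keyPt S (nextPt S v) < keyPt S v at hkey
        rw [e2, e3]
        have := turnCount_le (hull S) (lev S) (nextPt S v) (parentDir (hull S) (lev S) s + 3)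
        omega
    obtain ⟨x, hx, hn, hw⟩ := ihn (g + 1) (fun t ht => by have := hg t ht; omega) _ s
      (k + 5 + 2) hsS hls (by rwa [← hkq]) rfl
    have hxS := ribbonOf_subset hsS hx
    have hlx := h.level_eq_of_mem_ribbonOf hsS hx
    have hkx : keyPt S x ≤ keyPt S s := by
      rcases h.inFront_of_first hx hn with rfl | h1
      · exact le_rfl
      · exact (h.key_lt_of_inFront h1).le
    have hkn := h.key_nextPt hxS (by omega)
    have hnx : nextPt S x = nb (parPt S x) (parentDir (hull S) (lev S) x + 2) :=
      (nb_par_nxt _ _ _).symm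
    have hpx := h.parPt_mem hxS (by omega)
    have hlpx := h.level_parPt hxS
    have hnA : nextPt S x ∉ A := by
      intro hc
      refine hn (h.nextPt_mem hxS ((hA _ ?_).1 hc))
      have h1 := adj_coord.1 (adj_nxt (hull S) (lev S) x)
      have h2 := h.two_le_row hxS
      change 1 ≤ (nxt (hull S) (lev S) x).2
      omega
    -- At the merging point of the child ribbon, continue around the parent of its first vertex;
    -- `key_nextPt` bounds the new measure by the key of the child.
    obtain ⟨y, hy, hny, hw'⟩ := ihm _ (by omega) (parPt S x)
      (parentDir (hull S) (lev S) x + 2) hpx (by omega)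
      (by rwa [← hnx]) rfl
    rw [← hnx] at hw'
    have hrib : parPt S x ∈ ribbonOf S v := by
      have h1 := h.parent_mem_ribbonOf_parPt hsS (by omega) hspd
      rw [hsv] at h1
      rw [ribbonOf_eq h1]
      exact h.parPt_mem_ribbonOf hsS (by omega) hx
    refine ⟨y, SimpleGraph.Reachable.trans hrib hy, hny, ?_⟩
    rw [hkq]
    refine (turns_mono ?_ hw).trans (turns_mono (region_mono ?_ ?_) hw')
    -- Six times the key of the ancestor of level `g` is at most the key of the ancestor of level `g
    -- + 1`, which is less than `6 * keyPt S v + 6`.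
    · rintro t ⟨ht, htg, hta, -⟩
      refine ⟨ht, by omega, ?_, fun _ => by omega⟩
      have ha := h.ancestor_spec ht (by omega) htg
      have hk2 := h.key_eq ha.1 (by omega)
      rw [parPt_ancestor htg] at hk2
      omega
    · omega
    · omega

/-- From the merging point of a ribbon of level `g`, a robot that keeps turning clockwise gets to
the right of `p₂`, without turning about the ribbon or its descendants. -/
theorem exists_turns_to_root (h : ProperRibbonization S D) {A : Set Lat}
    (hA : ∀ q : Lat, 1 ≤ q.2 → (q ∈ A ↔ q ∈ hull S)) {x : Lat} (hx : x ∈ S)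
    (hn : nextPt S x ∉ S) :
    Relation.ReflTransGen
      (Turn A {t | t ∈ S ∧ ¬ (lev S x ≤ lev S t ∧ ancestor S (lev S x) t ∈ ribbonOf S x)})
      (nextPt S x) (1, 1) := by
  induction hg : lev S x generalizing x with
  | zero => have := h.two_le_level hx; omega
  | succ g ih =>
  have hg2 := h.two_le_level hx
  by_cases hg3 : lev S x = 2
  · rw [(h.level_two_nextPt hx hg3 hn).2.1]
  have hpx := h.parPt_mem hx (by omega)
  have hlp := h.level_parPt hx
  have hkn := h.key_nextPt hx (by omega)
  have hnx : nextPt S x = nb (parPt S x) (parentDir (hull S) (lev S) x + 2) :=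
    (nb_par_nxt _ _ _).symm
  have hnA : nextPt S x ∉ A := by
    intro hc
    refine hn (h.nextPt_mem hx ((hA _ ?_).1 hc))
    have h1 := adj_coord.1 (adj_nxt (hull S) (lev S) x)
    have h2 := h.two_le_row hx
    change 1 ≤ (nxt (hull S) (lev S) x).2
    omega
  obtain ⟨N, hN⟩ : ∃ N, ∀ t ∈ S, lev S t ≤ N := by
    obtain ⟨N, hN⟩ := (S.image (lev S)).bddAbove
    exact ⟨N, fun t ht => hN (by simpa using ⟨_, _, ht, rfl⟩)⟩
  obtain ⟨y, hy, hny, hw⟩ := h.exists_turns_to_front hA (N + 1) g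
    (fun t ht => by have := hN t ht; omega) _ (parPt S x) _ hpx (by omega) (by rwa [← hnx]) rfl
  rw [← hnx] at hw
  have hyS := ribbonOf_subset hpx hy
  have hly := h.level_eq_of_mem_ribbonOf hpx hy
  refine (turns_mono ?_ hw).trans (turns_mono ?_ (ih hyS hny (by omega)))
  -- The walk starts with measure `keyPt S x - 1`, while no vertex of the ribbon of `x` has a key
  -- below that of its first vertex `x`.
  · rintro t ⟨ht, -, -, ht2⟩
    refine ⟨ht, fun ⟨h1, h2⟩ => ?_⟩
    have h3 := ht2 h1
    have h4 : keyPt S x ≤ keyPt S (ancestor S (g + 1) t) := by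
      rcases h.inFront_of_first (SimpleGraph.Reachable.symm h2) hn with e | e
      · rw [← e]
      · exact (h.key_lt_of_inFront e).le
    omega
  · rintro t ⟨ht, ht2⟩
    refine ⟨ht, fun ⟨h1, h2⟩ => ht2 ⟨by omega, ?_⟩⟩
    have h3 := h.parPt_mem_ribbonOf hx (by omega) h2
    rw [parPt_ancestor h1] at h3
    rwa [ribbonOf_eq hy]

end ProperRibbonization

/-! ### The idle half-plane and the extended boundary -/

/-- The distance from the origin of a point in the lower half-plane. -/
def ring (z : Lat) : ℤ := max (-z.2) (max z.1 (-z.1 - z.2))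

/-- Twice the horizontal coordinate. -/
def twiceX (z : Lat) : ℤ := 2 * z.1 + z.2

/-- The order in which the points of the idle half-plane are filled. -/
def LowBefore (z t : Lat) : Prop := ring z < ring t ∨ (ring z = ring t ∧ twiceX z < twiceX t)

/-- The points of the idle half-plane filled before `t`. -/
def lowSet (t : Lat) : Set Lat := {z | z.2 ≤ -2 ∧ LowBefore z t}

/-- The obstacles on the way of a recycled robot with target `t`. -/
def obstacles (S : Finset Lat) (t : Lat) : Set Lat := ↑S ∪ seeds ∪ lowSet t

theorem mem_seeds {z : Lat} : z ∈ seeds ↔ (z.1 = 0 ∧ z.2 = 0) ∨ (z.1 = -1 ∧ z.2 = 1) ∨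
    (z.1 = 0 ∧ z.2 = 1) ∨ (z.1 = 1 ∧ z.2 = -1) ∨ (z.1 = 0 ∧ z.2 = -1) := by
  simp only [seeds, p1, p2, p4, p5, Set.mem_insert_iff, Set.mem_singleton_iff, Prod.ext_iff,
    Prod.fst_zero, Prod.snd_zero]

theorem ProperRibbonization.mem_obstacles_of_row {S D : Finset Lat}
    (h : ProperRibbonization S D) {t z : Lat}
    (hz : z.2 ≤ 1) : z ∈ obstacles S t ↔ (z.1 = 0 ∧ z.2 = 0) ∨ (z.1 = -1 ∧ z.2 = 1) ∨
    (z.1 = 0 ∧ z.2 = 1) ∨ (z.1 = 1 ∧ z.2 = -1) ∨ (z.1 = 0 ∧ z.2 = -1) ∨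
    (z.2 ≤ -2 ∧ LowBefore z t) := by
  have hS : z ∉ (S : Set Lat) := fun hc => by have := h.two_le_row hc; omega
  rw [obstacles, Set.mem_union, Set.mem_union, mem_seeds, lowSet, Set.mem_ofPred_eq]
  tauto

theorem mem_obstacles_iff_hull {S : Finset Lat} {t z : Lat}
    (hz : 1 ≤ z.2) : z ∈ obstacles S t ↔ z ∈ hull S := by
  rw [obstacles, Set.mem_union, Set.mem_union, mem_seeds, lowSet, Set.mem_ofPred_eq, hull,
    Set.mem_union, Set.mem_ofPred_eq, ball_coord]
  constructor
  · rintro ((h1 | h1) | h1)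
    · exact .inl h1
    · right; omega
    · omega
  · rintro (h1 | h1)
    · exact .inl (.inl h1)
    · left; right; omega

/-! ### Smoothness of the obstacles, row by row. -/

/-- The neighbours in `A` of a point outside `A` are consecutive, and no two are opposite. -/
def SmoothSet (A : Set Lat) : Prop :=
  ∀ q, q ∉ A → ∀ i, (nb q i ∈ A → nb q (i + 3) ∉ A) ∧
    (nb q i ∈ A → nb q (i + 2) ∈ A → nb q (i + 1) ∈ A)

/-- A free point in row two or higher is not next to the seed hexagon, since the root row is filled;
so its obstacle neighbours are in `S`, and the two smoothness conditions on the shape apply. -/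
theorem smooth_above {S D : Finset Lat} (h : ProperRibbonization S D) {t q : Lat}
    (hrow : 2 ≤ q.2) (hq : q ∉ obstacles S t) (i : ZMod 6) :
    (nb q i ∈ obstacles S t → nb q (i + 3) ∉ obstacles S t) ∧
    (nb q i ∈ obstacles S t → nb q (i + 2) ∈ obstacles S t → nb q (i + 1) ∈ obstacles S t) := by
  have hqS : q ∉ S := fun hc => hq (.inl (.inl hc))
  have hn : ∀ j, nb q j ∈ obstacles S t → nb q j ∈ S := by
    intro j hj
    have h1 := adj_coord.1 (adj_nb q j)
    rw [mem_obstacles_iff_hull (by omega)] at hj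
    refine hj.resolve_right fun hb => hqS ?_
    have h2 := ball_coord.1 hb
    exact (h.root_mem q (by omega) (by omega) (by omega)).1
  constructor
  · intro h1 h2
    refine hqS (h.smooth_two _ (hn _ h1) _ (hn _ h2) ?_ q (adj_nb _ _).symm (adj_nb _ _).symm)
    rw [sqDist_nb_nb]
    clear h1 h2
    revert i; decide
  · intro h1 h2
    obtain ⟨z, hz1, hz2, hz⟩ := h.smooth_sqrt_three _ (hn _ h1) _ (hn _ h2) (by
      rw [sqDist_nb_nb]
      clear h1 h2
      revert i; decide)
    obtain ⟨a, rfl⟩ := adj_iff_nb.1 hz1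
    obtain ⟨b, hb⟩ := adj_iff_nb.1 hz2
    have key : ∀ i a b, dir i + dir a = dir (i + 2) + dir b →
        dir i + dir a = 0 ∨ dir i + dir a = dir (i + 1) := by decide
    simp only [nb, add_assoc, add_right_inj] at hb
    rcases key i a b hb with e | e
    · exfalso
      rw [nb, nb, add_assoc, e, add_zero] at hz
      exact hqS hz
    · rw [nb, nb, add_assoc, e] at hz
      exact .inl (.inl hz)

/-- Only the free points just beside `p1` and `p2` have a seed neighbour in this row; there the ends
of the root ribbon fill the corner. -/
theorem smooth_row_one {S D : Finset Lat} (h : ProperRibbonization S D) {t q : Lat}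
    (hrow : q.2 = 1) (hq : q ∉ obstacles S t) (i : ZMod 6) :
    (nb q i ∈ obstacles S t → nb q (i + 3) ∉ obstacles S t) ∧
    (nb q i ∈ obstacles S t → nb q (i + 2) ∈ obstacles S t → nb q (i + 1) ∈ obstacles S t) := by
  rw [h.mem_obstacles_of_row (by omega)] at hq
  have h0 : nb q 0 ∈ obstacles S t → q.1 = -2 := by
    rw [nb_zero, h.mem_obstacles_of_row (by dsimp only; omega)]
    dsimp only
    omega
  have h3 : nb q 3 ∈ obstacles S t → q.1 = 1 := by
    rw [nb_three, h.mem_obstacles_of_row (by dsimp only; omega)]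
    dsimp only
    omega
  have h4 : nb q 4 ∉ obstacles S t := by
    rw [nb_four, h.mem_obstacles_of_row (by dsimp only; omega)]
    dsimp only
    omega
  have h5 : nb q 5 ∉ obstacles S t := by
    rw [nb_five, h.mem_obstacles_of_row (by dsimp only; omega)]
    dsimp only
    omega
  have h1 : q.1 = -2 → nb q 1 ∈ obstacles S t := fun e =>
    .inl (.inl (h.root_mem _ (by rw [nb_one]; dsimp only; omega)
      (by rw [nb_one]; dsimp only; omega) (by rw [nb_one]; dsimp only; omega)).1)
  have h2 : q.1 = 1 → nb q 2 ∈ obstacles S t := fun e =>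
    .inl (.inl (h.root_mem _ (by rw [nb_two]; dsimp only; omega)
      (by rw [nb_two]; dsimp only; omega) (by rw [nb_two]; dsimp only; omega)).1)
  rcases zmod_six_cases i with rfl | rfl | rfl | rfl | rfl | rfl
  · exact ⟨fun a b => by have := h0 a; have := h3 b; omega, fun a _ => h1 (h0 a)⟩
  · exact ⟨fun _ => h4, fun _ b => h2 (h3 b)⟩
  · exact ⟨fun _ => h5, fun _ b => absurd b h4⟩
  · exact ⟨fun a b => by have := h3 a; have := h0 b; omega, fun _ b => absurd b h5⟩
  · exact ⟨fun a => absurd a h4, fun a => absurd a h4⟩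
  · exact ⟨fun a => absurd a h5, fun a => absurd a h5⟩

theorem ring_eq_iff {z : Lat} {n : ℤ} : ring z = n ↔ -z.2 ≤ n ∧ z.1 ≤ n ∧ -z.1 - z.2 ≤ n ∧
    (n = -z.2 ∨ n = z.1 ∨ n = -z.1 - z.2) := by
  unfold ring
  omega

theorem ring_lt_iff {z : Lat} {n : ℤ} : ring z < n ↔ -z.2 < n ∧ z.1 < n ∧ -z.1 - z.2 < n := by
  unfold ring
  omega

/-- Membership in the obstacles below the seeds, in coordinates. -/
def LowCoord (n u a b : ℤ) : Prop :=
  -b ≤ n ∧ a ≤ n ∧ -a - b ≤ n ∧ ((-b < n ∧ a < n ∧ -a - b < n) ∨ 2 * a + b < u)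

theorem lowBefore_iff {z t : Lat} : LowBefore z t ↔ LowCoord (ring t) (twiceX t) z.1 z.2 := by
  unfold LowBefore LowCoord
  rw [ring_lt_iff, ring_eq_iff, twiceX]
  omega

section LowCoord

variable {n u a b : ℤ}

/-- `LowCoord` describes a full hexagonal ball with the western part of the next ring. The names of
these lemmas give the directions of the two neighbours: opposite ones exclude each other, and ones
two apart force the one in between. -/
theorem lowCoord_zero_three (hq : ¬ LowCoord n u a b)
    (h0 : LowCoord n u (a + 1) b) : ¬ LowCoord n u (a - 1) b := by
  obtain ⟨h1, h2, h3, h4⟩ := h0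
  rintro ⟨h5, h6, h7, h8⟩
  exact hq ⟨by omega, by omega, by omega, by omega⟩

theorem lowCoord_one_four (hq : ¬ LowCoord n u a b)
    (h0 : LowCoord n u a (b + 1)) : ¬ LowCoord n u a (b - 1) := by
  obtain ⟨h1, h2, h3, h4⟩ := h0
  rintro ⟨h5, h6, h7, h8⟩
  exact hq ⟨by omega, by omega, by omega, by omega⟩

theorem lowCoord_two_five (hq : ¬ LowCoord n u a b)
    (h0 : LowCoord n u (a - 1) (b + 1)) : ¬ LowCoord n u (a + 1) (b - 1) := by
  obtain ⟨h1, h2, h3, h4⟩ := h0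
  rintro ⟨h5, h6, h7, h8⟩
  exact hq ⟨by omega, by omega, by omega, by omega⟩

theorem lowCoord_zero_two (hb : b + 1 ≤ -2 ∨ a = 1 ∨ a = 2) (hq : ¬ LowCoord n u a b)
    (h0 : LowCoord n u (a + 1) b) (h1 : LowCoord n u (a - 1) (b + 1)) :
    (b + 1 ≤ -2 ∨ a = 0 ∨ a = 1) ∧ LowCoord n u a (b + 1) := by
  obtain ⟨h2, h3, h4, h5⟩ := h0
  obtain ⟨h6, h7, h8, h9⟩ := h1
  by_cases hb' : b + 1 ≤ -2
  · exact ⟨.inl hb', by omega, by omega, by omega, by omega⟩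
  · exact absurd ⟨by omega, by omega, by omega, by omega⟩ hq

theorem lowCoord_one_three (hb : b ≤ -2) (hb' : b + 1 ≤ -2 ∨ a = 0 ∨ a = 1)
    (hq : ¬ LowCoord n u a b) (h0 : LowCoord n u a (b + 1)) (h1 : LowCoord n u (a - 1) b) :
    (b + 1 ≤ -2 ∨ a = 1 ∨ a = 2) ∧ LowCoord n u (a - 1) (b + 1) := by
  obtain ⟨h2, h3, h4, h5⟩ := h0
  obtain ⟨h6, h7, h8, h9⟩ := h1
  by_cases ha : a = 0
  · by_cases hc : b + 1 ≤ -2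
    · exact ⟨.inl hc, by omega, by omega, by omega, by omega⟩
    · exact absurd ⟨by omega, by omega, by omega, by omega⟩ hq
  · exact ⟨by omega, by omega, by omega, by omega, by omega⟩

theorem lowCoord_two_four (h0 : LowCoord n u (a - 1) (b + 1)) (h1 : LowCoord n u a (b - 1)) :
    LowCoord n u (a - 1) b := by
  obtain ⟨h2, h3, h4, h5⟩ := h0
  obtain ⟨h6, h7, h8, h9⟩ := h1
  exact ⟨by omega, by omega, by omega, by omega⟩

theorem lowCoord_three_five (hq : ¬ LowCoord n u a b)
    (h0 : LowCoord n u (a - 1) b) (h1 : LowCoord n u (a + 1) (b - 1)) : LowCoord n u a (b - 1) := by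
  obtain ⟨h2, h3, h4, h5⟩ := h0
  obtain ⟨h6, h7, h8, h9⟩ := h1
  unfold LowCoord at hq
  exact ⟨by omega, by omega, by omega, by omega⟩

theorem lowCoord_four_zero (hq : ¬ LowCoord n u a b)
    (h0 : LowCoord n u a (b - 1)) (h1 : LowCoord n u (a + 1) b) : LowCoord n u (a + 1) (b - 1) := by
  obtain ⟨h2, h3, h4, h5⟩ := h0
  obtain ⟨h6, h7, h8, h9⟩ := h1
  unfold LowCoord at hq
  exact ⟨by omega, by omega, by omega, by omega⟩

theorem lowCoord_five_one (hq : ¬ LowCoord n u a b)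
    (h0 : LowCoord n u (a + 1) (b - 1)) (h1 : LowCoord n u a (b + 1)) : LowCoord n u (a + 1) b := by
  obtain ⟨h2, h3, h4, h5⟩ := h0
  obtain ⟨h6, h7, h8, h9⟩ := h1
  unfold LowCoord at hq
  exact ⟨by omega, by omega, by omega, by omega⟩

end LowCoord

/-- `M` stands for the obstacles in rows at most `-1`; in row `-1` these are the two seeds in
columns `0` and `1`. -/
theorem smooth_below_aux {n u a b : ℤ} (hb : b ≤ -2) (hq : ¬ LowCoord n u a b)
    (M : Lat → Prop) (hM : ∀ x y, y ≤ -1 →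
      (M (x, y) ↔ (y ≤ -2 ∨ x = 0 ∨ x = 1) ∧ LowCoord n u x y)) (i : ZMod 6) :
    (M (nb (a, b) i) → ¬ M (nb (a, b) (i + 3))) ∧
    (M (nb (a, b) i) → M (nb (a, b) (i + 2)) → M (nb (a, b) (i + 1))) := by
  have m0 : M (nb (a, b) 0) ↔ LowCoord n u (a + 1) b := by
    rw [nb_zero, hM _ _ (by dsimp only; omega)]
    exact ⟨fun h => h.2, fun h => ⟨.inl hb, h⟩⟩
  have m1 : M (nb (a, b) 1) ↔ (b + 1 ≤ -2 ∨ a = 0 ∨ a = 1) ∧ LowCoord n u a (b + 1) := by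
    rw [nb_one, hM _ _ (by dsimp only; omega)]
  have m2 : M (nb (a, b) 2) ↔ (b + 1 ≤ -2 ∨ a = 1 ∨ a = 2) ∧ LowCoord n u (a - 1) (b + 1) := by
    rw [nb_two, hM _ _ (by dsimp only; omega)]
    have e1 : a - 1 = 0 ↔ a = 1 := by omega
    have e2 : a - 1 = 1 ↔ a = 2 := by omega
    dsimp only
    rw [e1, e2]
  have m3 : M (nb (a, b) 3) ↔ LowCoord n u (a - 1) b := by
    rw [nb_three, hM _ _ (by dsimp only; omega)]
    exact ⟨fun h => h.2, fun h => ⟨.inl hb, h⟩⟩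
  have m4 : M (nb (a, b) 4) ↔ LowCoord n u a (b - 1) := by
    rw [nb_four, hM _ _ (by dsimp only; omega)]
    exact ⟨fun h => h.2, fun h => ⟨.inl (by dsimp only; omega), h⟩⟩
  have m5 : M (nb (a, b) 5) ↔ LowCoord n u (a + 1) (b - 1) := by
    rw [nb_five, hM _ _ (by dsimp only; omega)]
    exact ⟨fun h => h.2, fun h => ⟨.inl (by dsimp only; omega), h⟩⟩
  rcases zmod_six_cases i with rfl | rfl | rfl | rfl | rfl | rfl
  · change (_ → ¬ M (nb _ 3)) ∧ (_ → M (nb _ 2) → M (nb _ 1))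
    rw [m0, m1, m2, m3]
    exact ⟨lowCoord_zero_three hq, fun h0 h1 => lowCoord_zero_two h1.1 hq h0 h1.2⟩
  · change (_ → ¬ M (nb _ 4)) ∧ (_ → M (nb _ 3) → M (nb _ 2))
    rw [m1, m2, m3, m4]
    exact ⟨fun h0 => lowCoord_one_four hq h0.2,
      fun h0 h1 => lowCoord_one_three hb h0.1 hq h0.2 h1⟩
  · change (_ → ¬ M (nb _ 5)) ∧ (_ → M (nb _ 4) → M (nb _ 3))
    rw [m2, m3, m4, m5]
    exact ⟨fun h0 => lowCoord_two_five hq h0.2, fun h0 h1 => lowCoord_two_four h0.2 h1⟩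
  · change (_ → ¬ M (nb _ 0)) ∧ (_ → M (nb _ 5) → M (nb _ 4))
    rw [m3, m4, m5, m0]
    exact ⟨fun h0 h1 => lowCoord_zero_three hq h1 h0, lowCoord_three_five hq⟩
  · change (_ → ¬ M (nb _ 1)) ∧ (_ → M (nb _ 0) → M (nb _ 5))
    rw [m4, m5, m0, m1]
    exact ⟨fun h0 h1 => lowCoord_one_four hq h1.2 h0, lowCoord_four_zero hq⟩
  · change (_ → ¬ M (nb _ 2)) ∧ (_ → M (nb _ 1) → M (nb _ 0))
    rw [m5, m0, m1, m2]
    exact ⟨fun h0 h1 => lowCoord_two_five hq h1.2 h0, fun h0 h1 => lowCoord_five_one hq h0 h1.2⟩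

theorem smooth_below {S D : Finset Lat} (h : ProperRibbonization S D) {t q : Lat} (ht : t.2 ≤ -2)
    (hrow : q.2 ≤ -2) (hq : q ∉ obstacles S t) (i : ZMod 6) :
    (nb q i ∈ obstacles S t → nb q (i + 3) ∉ obstacles S t) ∧
    (nb q i ∈ obstacles S t → nb q (i + 2) ∈ obstacles S t → nb q (i + 1) ∈ obstacles S t) := by
  have hr2 : 2 ≤ ring t := by unfold ring; omega
  refine smooth_below_aux (n := ring t) (u := twiceX t) hrow (fun hc => hq ?_)
    (fun z => z ∈ obstacles S t) (fun x y hy => ?_) i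
  · exact .inr ⟨hrow, lowBefore_iff.2 hc⟩
  · rw [h.mem_obstacles_of_row (by dsimp only; omega), lowBefore_iff]
    dsimp only
    generalize twiceX t = u
    generalize ring t = n at *
    constructor
    · rintro (e | e | e | e | e | e)
      · omega
      · omega
      · omega
      · exact ⟨by omega, by unfold LowCoord; omega⟩
      · exact ⟨by omega, by unfold LowCoord; omega⟩
      · exact ⟨.inl e.1, e.2⟩
    · rintro ⟨h1, h2⟩
      by_cases h3 : y ≤ -2
      · exact .inr (.inr (.inr (.inr (.inr ⟨h3, h2⟩))))
      · rcases h1.resolve_left h3 with h1 | h1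
        · exact .inr (.inr (.inr (.inr (.inl ⟨h1, by omega⟩))))
        · exact .inr (.inr (.inr (.inl ⟨h1, by omega⟩)))

theorem ProperRibbonization.mem_obstacles_middle {S D : Finset Lat}
    (h : ProperRibbonization S D) {t z : Lat} (h1 : -1 ≤ z.2) (h2 : z.2 ≤ 1) :
    z ∈ obstacles S t ↔ z ∈ seeds := by
  rw [h.mem_obstacles_of_row h2, mem_seeds]
  have : ¬ z.2 ≤ -2 := by omega
  tauto

theorem smooth_row_zero {S D : Finset Lat} (h : ProperRibbonization S D) {t q : Lat}
    (hrow : q.2 = 0) (hq : q ∉ obstacles S t) (i : ZMod 6) :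
    (nb q i ∈ obstacles S t → nb q (i + 3) ∉ obstacles S t) ∧
    (nb q i ∈ obstacles S t → nb q (i + 2) ∈ obstacles S t → nb q (i + 1) ∈ obstacles S t) := by
  obtain ⟨a, b⟩ := q
  obtain rfl : b = 0 := hrow
  rw [h.mem_obstacles_middle (by norm_num) (by norm_num), mem_seeds] at hq
  have m (x y : ℤ) (h1 : -1 ≤ y) (h2 : y ≤ 1) : ((x, y) : Lat) ∈ obstacles S t ↔ _ :=
    (h.mem_obstacles_middle h1 h2).trans mem_seeds
  rcases zmod_six_cases i with rfl | rfl | rfl | rfl | rfl | rfl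
  · change (_ → ¬ nb _ 3 ∈ _) ∧ (_ → nb _ 2 ∈ _ → nb _ 1 ∈ _)
    rw [nb_zero, nb_one, nb_two, nb_three, m _ _ (by norm_num) (by norm_num),
      m _ _ (by norm_num) (by norm_num), m _ _ (by norm_num) (by norm_num),
      m _ _ (by norm_num) (by norm_num)]
    dsimp only at *; omega
  · change (_ → ¬ nb _ 4 ∈ _) ∧ (_ → nb _ 3 ∈ _ → nb _ 2 ∈ _)
    rw [nb_one, nb_two, nb_three, nb_four, m _ _ (by norm_num) (by norm_num),
      m _ _ (by norm_num) (by norm_num), m _ _ (by norm_num) (by norm_num),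
      m _ _ (by norm_num) (by norm_num)]
    dsimp only at *; omega
  · change (_ → ¬ nb _ 5 ∈ _) ∧ (_ → nb _ 4 ∈ _ → nb _ 3 ∈ _)
    rw [nb_two, nb_three, nb_four, nb_five, m _ _ (by norm_num) (by norm_num),
      m _ _ (by norm_num) (by norm_num), m _ _ (by norm_num) (by norm_num),
      m _ _ (by norm_num) (by norm_num)]
    dsimp only at *; omega
  · change (_ → ¬ nb _ 0 ∈ _) ∧ (_ → nb _ 5 ∈ _ → nb _ 4 ∈ _)
    rw [nb_three, nb_four, nb_five, nb_zero, m _ _ (by norm_num) (by norm_num),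
      m _ _ (by norm_num) (by norm_num), m _ _ (by norm_num) (by norm_num),
      m _ _ (by norm_num) (by norm_num)]
    dsimp only at *; omega
  · change (_ → ¬ nb _ 1 ∈ _) ∧ (_ → nb _ 0 ∈ _ → nb _ 5 ∈ _)
    rw [nb_four, nb_five, nb_zero, nb_one, m _ _ (by norm_num) (by norm_num),
      m _ _ (by norm_num) (by norm_num), m _ _ (by norm_num) (by norm_num),
      m _ _ (by norm_num) (by norm_num)]
    dsimp only at *; omega
  · change (_ → ¬ nb _ 2 ∈ _) ∧ (_ → nb _ 1 ∈ _ → nb _ 0 ∈ _)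
    rw [nb_five, nb_zero, nb_one, nb_two, m _ _ (by norm_num) (by norm_num),
      m _ _ (by norm_num) (by norm_num), m _ _ (by norm_num) (by norm_num),
      m _ _ (by norm_num) (by norm_num)]
    dsimp only at *; omega

/-- The delicate points are those just beside `p5` and `p4`: an obstacle obliquely below, on the
outer side, must bring the one under the seed with it, because the idle points fill ring by ring. -/
theorem smooth_row_neg_one {S D : Finset Lat} (h : ProperRibbonization S D) {t q : Lat}
    (ht : t.2 ≤ -2) (hrow : q.2 = -1) (hq : q ∉ obstacles S t) (i : ZMod 6) :
    (nb q i ∈ obstacles S t → nb q (i + 3) ∉ obstacles S t) ∧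
    (nb q i ∈ obstacles S t → nb q (i + 2) ∈ obstacles S t → nb q (i + 1) ∈ obstacles S t) := by
  have hr2 : 2 ≤ ring t := by unfold ring; omega
  obtain ⟨a, b⟩ := q
  obtain rfl : b = -1 := hrow
  have m (x y : ℤ) (h1 : -1 ≤ y) (h2 : y ≤ 1) : ((x, y) : Lat) ∈ obstacles S t ↔ _ :=
    (h.mem_obstacles_middle h1 h2).trans mem_seeds
  rw [m _ _ (by norm_num) (by norm_num)] at hq
  dsimp only at hq
  have hq1 : a ≤ -1 ∨ 2 ≤ a := by omega
  clear hq
  have m0 : nb (a, -1) 0 ∈ obstacles S t ↔ a = -1 := by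
    rw [nb_zero, m _ _ (by norm_num) (by norm_num)]; dsimp only; omega
  have m1 : nb (a, -1) 1 ∉ obstacles S t := by
    rw [nb_one, m _ _ (by norm_num) (by norm_num)]; dsimp only; omega
  have m2 : nb (a, -1) 2 ∉ obstacles S t := by
    rw [nb_two, m _ _ (by norm_num) (by norm_num)]; dsimp only; omega
  have m3 : nb (a, -1) 3 ∈ obstacles S t ↔ a = 2 := by
    rw [nb_three, m _ _ (by norm_num) (by norm_num)]; dsimp only; omega
  have low (x : ℤ) : ((x, -2) : Lat) ∈ obstacles S t ↔ LowCoord (ring t) (twiceX t) x (-2) := by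
    rw [h.mem_obstacles_of_row (by norm_num), lowBefore_iff]
    norm_num
  have m4 : nb (a, -1) 4 ∈ obstacles S t ↔ LowCoord (ring t) (twiceX t) a (-2) := by
    rw [nb_four, ← low]; rfl
  have m5 : nb (a, -1) 5 ∈ obstacles S t ↔ LowCoord (ring t) (twiceX t) (a + 1) (-2) := by
    rw [nb_five, ← low]; rfl
  have h4 : a = -1 → LowCoord (ring t) (twiceX t) a (-2) →
      LowCoord (ring t) (twiceX t) (a + 1) (-2) := by
    unfold LowCoord; omega
  have h5 : a = 2 → LowCoord (ring t) (twiceX t) (a + 1) (-2) →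
      LowCoord (ring t) (twiceX t) a (-2) := by
    unfold LowCoord; omega
  rcases zmod_six_cases i with rfl | rfl | rfl | rfl | rfl | rfl
  · change (_ → ¬ nb _ 3 ∈ _) ∧ (_ → nb _ 2 ∈ _ → nb _ 1 ∈ _)
    exact ⟨fun x y => by have := m0.1 x; have := m3.1 y; omega, fun _ y => absurd y m2⟩
  · exact ⟨fun x => absurd x m1, fun x => absurd x m1⟩
  · exact ⟨fun x => absurd x m2, fun x => absurd x m2⟩
  · change (_ → ¬ nb _ 0 ∈ _) ∧ (_ → nb _ 5 ∈ _ → nb _ 4 ∈ _)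
    exact ⟨fun x y => by have := m3.1 x; have := m0.1 y; omega,
      fun x y => m4.2 (h5 (m3.1 x) (m5.1 y))⟩
  · change (_ → ¬ nb _ 1 ∈ _) ∧ (_ → nb _ 0 ∈ _ → nb _ 5 ∈ _)
    exact ⟨fun _ => m1, fun x y => m5.2 (h4 (m0.1 y) (m4.1 x))⟩
  · change (_ → ¬ nb _ 2 ∈ _) ∧ (_ → nb _ 1 ∈ _ → nb _ 0 ∈ _)
    exact ⟨fun _ => m2, fun _ y => absurd y m1⟩

theorem smoothSet_obstacles {S D : Finset Lat} (h : ProperRibbonization S D) {t : Lat}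
    (ht : t.2 ≤ -2) : SmoothSet (obstacles S t) := by
  intro q hq i
  by_cases h0 : q.2 ≤ -2
  · exact smooth_below h ht h0 hq i
  by_cases h1 : q.2 = -1
  · exact smooth_row_neg_one h ht h1 hq i
  by_cases h1 : q.2 = 0
  · exact smooth_row_zero h h1 hq i
  by_cases h2 : q.2 = 1
  · exact smooth_row_one h h2 hq i
  · exact smooth_above h (by omega) hq i

/-! ### The walk below the seeds -/

theorem turn_of_coord {S : Finset Lat} {t c q q' : Lat}
    (hc : c ∈ seeds ∪ lowSet t) (hcq : latGraph.Adj c q) (hq : q ∉ obstacles S t)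
    (h1 : q'.1 = q.1 + q.2 - c.2) (h2 : q'.2 = c.1 + c.2 - q.1) (hq' : q' ∉ obstacles S t) :
    Turn (obstacles S t) (seeds ∪ lowSet t) q q' := by
  refine ⟨c, hc, ?_, hcq, hq, Prod.ext ?_ ?_, hq'⟩
  · rcases hc with hc | hc
    · exact .inl (.inr hc)
    · exact .inr hc
  · simp only [rotCW]; omega
  · simp only [rotCW]; omega

/-- All points one ring further in are obstacles, and those of the ring of `t` are filled from the
west. So the robot rolls clockwise about the inner ring, down the east side, along the bottom and up
the west side, until it reaches `t`. -/
theorem exists_turns_on_ring {S D : Finset Lat} (h : ProperRibbonization S D) {t : Lat}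
    (ht : t.2 ≤ -2) (m : ℕ) : ∀ q : Lat, q.2 ≤ -2 → ring q = ring t →
      twiceX q = twiceX t + m →
      Relation.ReflTransGen (Turn (obstacles S t) (seeds ∪ lowSet t)) q t := by
  induction m using Nat.strong_induction_on with
  | _ m ih =>
  intro q hq hr hx
  by_cases hm : m = 0
  · have : q = t := by
      simp only [ring, twiceX] at hr hx
      exact Prod.ext (by omega) (by omega)
    rw [this]
  have hqA : q ∉ obstacles S t := by
    rw [h.mem_obstacles_of_row (by omega), LowBefore]
    omega
  have step : ∀ c q' : Lat, latGraph.Adj c q → (c.2 ≤ -2 ∧ ring c < ring t ∨ c ∈ seeds) →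
      q'.1 = q.1 + q.2 - c.2 → q'.2 = c.1 + c.2 - q.1 → q'.2 ≤ -2 → ring q' = ring t →
      twiceX t ≤ twiceX q' → twiceX q' < twiceX q →
      Relation.ReflTransGen (Turn (obstacles S t) (seeds ∪ lowSet t)) q t := by
    intro c q' hcq hc h1 h2 h3 h4 h5 h6
    refine .head (turn_of_coord ?_ hcq hqA h1 h2 ?_)
      (ih (twiceX q' - twiceX t).toNat (by omega) q' h3 h4 (by omega))
    · exact hc.elim (fun hc => .inr ⟨hc.1, .inl hc.2⟩) .inl
    · rw [h.mem_obstacles_of_row (by omega), LowBefore]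
      omega
  simp only [adj_coord, mem_seeds, ring_lt_iff, ring_eq_iff (n := ring t), twiceX] at step hr hx
  have ht' := ring_eq_iff.1 (rfl : ring t = ring t)
  -- The east side above its corner, then the bottom, then the west side.
  by_cases h1 : q.1 = ring t ∧ q.2 ≠ -ring t
  · refine step (q.1 - 1, q.2) (q.1, q.2 - 1) ?_ ?_ ?_ ?_ ?_ ?_ ?_ ?_ <;> dsimp only <;> omega
  by_cases h2 : 1 ≤ q.1
  · refine step (q.1 - 1, q.2 + 1) (q.1 - 1, q.2) ?_ ?_ ?_ ?_ ?_ ?_ ?_ ?_ <;> dsimp only <;> omega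
  · refine step (q.1, q.2 + 1) (q.1 - 1, q.2 + 1) ?_ ?_ ?_ ?_ ?_ ?_ ?_ ?_ <;> dsimp only <;> omega

/-- Roll about `p2` and `p4` past the right of the seeds, then east over the filled part of row
`-2`, and come down at the east end of the ring of `t`. -/
theorem exists_turns_from_root {S D : Finset Lat} (h : ProperRibbonization S D) {t : Lat}
    (ht : t.2 ≤ -2) :
    Relation.ReflTransGen (Turn (obstacles S t) (seeds ∪ lowSet t)) (1, 1) t := by
  have hr2 : 2 ≤ ring t := by unfold ring; omega
  have hfree : ∀ z : Lat, z.2 ≤ 1 → z ∉ seeds → (z.2 ≤ -2 → ¬ LowBefore z t) →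
      z ∉ obstacles S t := by
    intro z hz h1 h2
    rw [h.mem_obstacles_of_row hz]
    rw [mem_seeds] at h1
    tauto
  have f1 : ((1, 1) : Lat) ∉ obstacles S t :=
    hfree _ (by norm_num) (by rw [mem_seeds]; norm_num) (by norm_num)
  have f2 : ((1, 0) : Lat) ∉ obstacles S t :=
    hfree _ (by norm_num) (by rw [mem_seeds]; norm_num) (by norm_num)
  have f3 : ∀ j : ℤ, 2 ≤ j → ((j, -1) : Lat) ∉ obstacles S t := fun j hj =>
    hfree _ (by norm_num) (by rw [mem_seeds]; dsimp only; omega) (by norm_num)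
  have f4 : ((ring t, -2) : Lat) ∉ obstacles S t :=
    hfree _ (by norm_num) (by rw [mem_seeds]; dsimp only; omega)
      (fun _ => by unfold LowBefore; simp only [ring, twiceX] at *; omega)
  have s1 : Turn (obstacles S t) (seeds ∪ lowSet t) (1, 1) (1, 0) :=
    turn_of_coord (c := (0, 1)) (.inl (by rw [mem_seeds]; norm_num))
      (by rw [adj_coord]; norm_num) f1 (by norm_num) (by norm_num) f2
  have s2 : Turn (obstacles S t) (seeds ∪ lowSet t) (1, 0) (2, -1) :=
    turn_of_coord (c := (1, -1)) (.inl (by rw [mem_seeds]; norm_num))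
      (by rw [adj_coord]; norm_num) f2 (by norm_num) (by norm_num) (f3 2 le_rfl)
  have hlow : ∀ j : ℤ, 2 ≤ j → j < ring t → ((j, -2) : Lat) ∈ lowSet t := by
    intro j h1 h2
    refine ⟨le_rfl, .inl ?_⟩
    have : ring (j, -2) = j := by simp only [ring]; omega
    omega
  have srow : ∀ n : ℕ, (2 : ℤ) + n < ring t ∨ n = 0 →
      Relation.ReflTransGen (Turn (obstacles S t) (seeds ∪ lowSet t)) (2, -1) (2 + n, -1) := by
    intro n
    induction n with
    | zero => intro _; exact .refl
    | succ n ih =>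
      intro hn
      refine (ih (by omega)).tail (turn_of_coord (c := (2 + n + 1, -2)) (.inr ?_) ?_
        (f3 _ (by omega)) ?_ ?_ (f3 _ (by omega)))
      · exact hlow _ (by omega) (by omega)
      · rw [adj_coord]; dsimp only; omega
      · dsimp only; omega
      · dsimp only; omega
  have slast : Relation.ReflTransGen (Turn (obstacles S t) (seeds ∪ lowSet t))
      (2, -1) (ring t, -2) := by
    -- For ring two, row `-2` offers no support to the east, and `p4` is the center of the descent.
    rcases hr2.eq_or_lt with e | e
    · exact .single (turn_of_coord (c := (1, -1)) (.inl (by rw [mem_seeds]; norm_num))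
        (by rw [adj_coord]; norm_num) (f3 2 le_rfl) (by dsimp only; omega) (by norm_num) f4)
    · refine (srow (ring t - 3).toNat (by omega)).tail (turn_of_coord (c := (ring t - 1, -2))
        (.inr (hlow _ (by omega) (by omega))) ?_ (f3 _ (by omega)) ?_ ?_ f4)
      · rw [adj_coord]; dsimp only; omega
      · dsimp only; omega
      · dsimp only; omega
  have hring : ring (ring t, -2) = ring t := by
    simp only [ring] at hr2 ⊢; omega
  have hx : twiceX t ≤ twiceX (ring t, -2) := by
    simp only [ring, twiceX] at *; omega
  exact .head s1 (.head s2 (slast.trans (exists_turns_on_ring h ht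
    (twiceX (ring t, -2) - twiceX t).toNat _ le_rfl hring (by omega))))

/-! ### The ribbons of the idle half-plane -/

/-- The distance from the origin in the lattice graph. -/
def hexDist (z : Lat) : ℕ :=
  (max (max z.1 (-z.1)) (max (max z.2 (-z.2)) (max (z.1 + z.2) (-z.1 - z.2)))).toNat

theorem hexDist_le_iff {z : Lat} {n : ℕ} : hexDist z ≤ n ↔ z.1 ≤ n ∧ -z.1 ≤ n ∧ z.2 ≤ n ∧
    -z.2 ≤ n ∧ z.1 + z.2 ≤ n ∧ -z.1 - z.2 ≤ n := by
  simp only [hexDist, Int.toNat_le, max_le_iff]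
  tauto

theorem hexDist_eq_ring {z : Lat} (hz : z ∈ H2) : (hexDist z : ℤ) = ring z := by
  have : z.2 ≤ -2 := hz
  unfold hexDist ring
  omega

theorem two_le_ring {z : Lat} (hz : z ∈ H2) : 2 ≤ ring z := by
  have : z.2 ≤ -2 := hz
  unfold ring
  omega

/-- Step up from the bottom side and horizontally inward from the other sides; only from ring two
does this leave the idle half-plane, and it then ends on a seed. -/
theorem exists_inner {z : Lat} (hz : z ∈ H2) :
    ∃ y, latGraph.Adj z y ∧ y ∈ hull H2 ∧ hexDist z = hexDist y + 1 ∧ (3 ≤ ring z → y ∈ H2) := by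
  have hz' : z.2 ≤ -2 := hz
  have hr := ring_eq_iff.1 (rfl : ring z = ring z)
  have hr2 := two_le_ring hz
  have e := hexDist_eq_ring hz
  have key : ∀ y : Lat, y.2 ≤ -1 → ring y = ring z - 1 → hexDist z = hexDist y + 1 := by
    intro y hy h1
    have : (hexDist y : ℤ) = ring y := by
      unfold hexDist ring at *
      omega
    omega
  have low : ∀ y : Lat, y.2 ≤ -2 → y ∈ H2 := fun _ h => h
  by_cases h1 : -z.2 = ring z
  · by_cases h2 : z.1 = ring z
    · refine ⟨(z.1 - 1, z.2 + 1), ?_, ?_, ?_, fun _ => low _ (by dsimp only; omega)⟩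
      · rw [adj_coord]; dsimp only; omega
      · by_cases h3 : ring z = 2
        · right; rw [Set.mem_ofPred_eq, ball_coord]; dsimp only; omega
        · exact .inl (low _ (by dsimp only; omega))
      · refine key _ (by dsimp only; omega) ?_
        rw [ring_eq_iff]; dsimp only; omega
    · refine ⟨(z.1, z.2 + 1), ?_, ?_, ?_, fun _ => low _ (by dsimp only; omega)⟩
      · rw [adj_coord]; dsimp only; omega
      · by_cases h3 : ring z = 2
        · right; rw [Set.mem_ofPred_eq, ball_coord]; dsimp only; omega
        · exact .inl (low _ (by dsimp only; omega))
      · refine key _ (by dsimp only; omega) ?_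
        rw [ring_eq_iff]; dsimp only; omega
  · by_cases h2 : z.1 = ring z
    · refine ⟨(z.1 - 1, z.2), ?_, .inl hz, ?_, fun _ => hz⟩
      · rw [adj_coord]; dsimp only; omega
      · refine key _ (by dsimp only; omega) ?_
        rw [ring_eq_iff]; dsimp only; omega
    · refine ⟨(z.1 + 1, z.2), ?_, .inl hz, ?_, fun _ => hz⟩
      · rw [adj_coord]; dsimp only; omega
      · refine key _ (by dsimp only; omega) ?_
        rw [ring_eq_iff]; dsimp only; omega

/-- The lower half-plane is wide enough for shortest lattice walks, so hop counts there are the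
plain hexagonal distance. -/
theorem isLevel_hexDist : IsLevel (hull H2) hexDist := by
  refine ⟨zero_mem_hull _, by simp [hexDist], fun x hx hx0 => ?_, fun x _ y _ hxy => ?_⟩
  · rcases hx with hx | hx
    · obtain ⟨y, h1, h2, h3, -⟩ := exists_inner hx
      exact ⟨y, h2, h1, h3⟩
    · have h1 := adj_zero_of_mem_ball hx hx0
      refine ⟨0, zero_mem_hull _, h1, ?_⟩
      rw [adj_coord] at h1
      unfold hexDist
      simp only [Prod.fst_zero, Prod.snd_zero] at *
      omega
  · have h := hexDist_le_iff.1 (le_refl (hexDist y))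
    rw [adj_coord] at hxy
    rw [hexDist_le_iff]
    push_cast
    omega

theorem hop_low {z : Lat} (hz : z ∈ H2) : hop H2 z = ring z := by
  rw [hop_of_level isLevel_hexDist (.inl hz), hexDist_eq_ring hz]

/-- A clockwise turn about a point of the next inner ring leads west. -/
theorem twiceX_lt_of_arc {x y : Lat} (h : RibbonArc H2 x y) :
    ring y = ring x ∧ twiceX y < twiceX x := by
  obtain ⟨hx, hy, e, c, hc, e', rfl⟩ := h
  rw [hop_low hx, hop_low hy] at e
  refine ⟨e, ?_⟩
  have hr2 := two_le_ring hx
  have hcm : c ∈ hull H2 := by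
    by_contra hcm
    rw [hop_of_notMem hcm, hop_low hx] at e'
    omega
  rw [hop_of_level isLevel_hexDist hcm, hop_low hx] at e'
  have hx2 : x.2 ≤ -2 := hx
  have hc' := hexDist_le_iff.1 (le_refl (hexDist c))
  have hrx := ring_eq_iff.1 (rfl : ring x = ring x)
  rw [ring_eq_iff] at e
  rw [adj_coord] at hc
  simp only [rotCW, twiceX] at *
  omega

/-- On each side of the ring the center one ring further in is explicit. The western point `y`
guarantees that the ring has not yet left the half-plane. -/
theorem exists_arc_west {x y : Lat} (hx : x ∈ H2) (hy : y ∈ H2) (hr : ring x = ring y)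
    (hlt : twiceX y < twiceX x) : ∃ x', RibbonArc H2 x x' ∧ twiceX y ≤ twiceX x' := by
  have hx2 : x.2 ≤ -2 := hx
  have hy2 : y.2 ≤ -2 := hy
  have hrx := ring_eq_iff.1 (rfl : ring x = ring x)
  have hry := ring_eq_iff.1 hr.symm
  have hr2 := two_le_ring hx
  have mk : ∀ c x' : Lat, latGraph.Adj x c → c.2 ≤ -1 → (c.2 = -1 → c.1 = 0 ∨ c.1 = 1) →
      ring c = ring x - 1 → x'.1 = x.1 + x.2 - c.2 → x'.2 = c.1 + c.2 - x.1 → x'.2 ≤ -2 →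
      ring x' = ring x → twiceX y ≤ twiceX x' →
      ∃ x', RibbonArc H2 x x' ∧ twiceX y ≤ twiceX x' := by
    intro c x' h1 h2 h2' h3 h4 h5 h6 h7 h8
    have hx' : x' ∈ H2 := h6
    refine ⟨x', ⟨hx, hx', ?_, c, h1, ?_, ?_⟩, h8⟩
    · rw [hop_low hx, hop_low hx', h7]
    · have hcm : c ∈ hull H2 := by
        by_cases h : c.2 ≤ -2
        · exact .inl h
        · right; rw [Set.mem_ofPred_eq, ball_coord]; omega
      rw [hop_of_level isLevel_hexDist hcm, hop_low hx, ← h3]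
      unfold hexDist ring at *
      omega
    · refine Prod.ext ?_ ?_
      · simp only [rotCW]; omega
      · simp only [rotCW]; omega
  simp only [adj_coord, ring_eq_iff (n := ring x - 1), ring_eq_iff (n := ring x), twiceX]
    at mk hlt ⊢
  by_cases h1 : x.1 = ring x ∧ x.2 ≠ -ring x
  · refine mk (x.1 - 1, x.2) (x.1, x.2 - 1) ?_ ?_ ?_ ?_ ?_ ?_ ?_ ?_ ?_ <;> dsimp only <;> omega
  by_cases h2 : 1 ≤ x.1
  · refine mk (x.1 - 1, x.2 + 1) (x.1 - 1, x.2) ?_ ?_ ?_ ?_ ?_ ?_ ?_ ?_ ?_ <;> dsimp only <;> omega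
  · refine mk (x.1, x.2 + 1) (x.1 - 1, x.2 + 1) ?_ ?_ ?_ ?_ ?_ ?_ ?_ ?_ ?_ <;> dsimp only <;> omega

theorem eq_of_ring_of_twiceX {x y : Lat} (hx : x ∈ H2) (hy : y ∈ H2) (hr : ring x = ring y)
    (ht : twiceX x = twiceX y) : x = y := by
  have hx2 : x.2 ≤ -2 := hx
  have hy2 : y.2 ≤ -2 := hy
  unfold ring twiceX at *
  exact Prod.ext (by omega) (by omega)

theorem inFront_low_iff {x y : Lat} (hx : x ∈ H2) (hy : y ∈ H2) :
    InFront H2 x y ↔ ring x = ring y ∧ twiceX x < twiceX y := by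
  constructor
  · intro h
    clear hx hy
    induction h with
    | single h => exact twiceX_lt_of_arc h
    | tail _ h ih =>
      have := twiceX_lt_of_arc h
      exact ⟨this.1.trans ih.1, this.2.trans ih.2⟩
  · rintro ⟨hr, ht⟩
    induction hn : (twiceX y - twiceX x).toNat using Nat.strong_induction_on generalizing y with
    | _ n ih =>
    obtain ⟨w, hw, hxw⟩ := exists_arc_west hy hx hr.symm ht
    have h1 := twiceX_lt_of_arc hw
    rcases hxw.eq_or_lt with e | hlt
    · rw [eq_of_ring_of_twiceX hx hw.2.1 (hr.trans h1.1.symm) e]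
      exact .single hw
    · exact .head hw (ih _ (by omega) hw.2.1 (hr.trans h1.1.symm) hlt rfl)

theorem ribbonOf_low_eq_iff {x y : Lat} (hx : x ∈ H2) (hy : y ∈ H2) :
    ribbonOf H2 x = ribbonOf H2 y ↔ ring x = ring y := by
  rw [ribbonOf_eq_iff]
  constructor
  · intro h
    have := hop_eq_of_mem_ribbonOf h
    rwa [hop_low hx, hop_low hy] at this
  · intro h
    rcases lt_trichotomy (twiceX x) (twiceX y) with h1 | h1 | h1
    · exact ((inFront_low_iff hx hy).2 ⟨h, h1⟩).mem_ribbonOf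
    · rw [eq_of_ring_of_twiceX hx hy h h1]; exact mem_ribbonOf_self _ _
    · exact SimpleGraph.Reachable.symm ((inFront_low_iff hy hx).2 ⟨h.symm, h1⟩).mem_ribbonOf

theorem isParent_low {x y : Lat} (hx : x ∈ H2) (hy : y ∈ H2) (h : ring x = ring y + 1) :
    IsParent H2 (ribbonOf H2 y) (ribbonOf H2 x) := by
  have hop_r : ∀ {x z : Lat}, x ∈ H2 → z ∈ ribbonOf H2 x → ring z = ring x := fun hx hz =>
    (ribbonOf_low_eq_iff (ribbonOf_subset hx hz) hx).1 (ribbonOf_eq hz)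
  refine ⟨ribbonOf_mem_ribbons hy, ribbonOf_mem_ribbons hx, fun a ha b hb => ?_, fun a ha => ?_⟩
  · rw [hop_low (ribbonOf_subset hx ha), hop_low (ribbonOf_subset hy hb), hop_r hx ha,
      hop_r hy hb]
    omega
  · have ha2 := ribbonOf_subset hx ha
    obtain ⟨b, h1, -, h3, h4⟩ := exists_inner ha2
    have hr := hop_r hx ha
    have hy2 := two_le_ring hy
    have hb := h4 (by omega)
    refine ⟨b, ?_, h1⟩
    rw [← ribbonOf_eq_iff, ribbonOf_low_eq_iff hb hy]
    have := hexDist_eq_ring ha2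
    have := hexDist_eq_ring hb
    omega

theorem treeLt_low_iff {x y : Lat} (hx : x ∈ H2) (hy : y ∈ H2) :
    TreeLt H2 (ribbonOf H2 y) (ribbonOf H2 x) ↔ ring y < ring x := by
  constructor
  · intro h
    have step : ∀ {Q R : Set Lat}, IsParent H2 Q R → ∀ a ∈ Q, ∀ b ∈ R, ring a < ring b := by
      rintro Q R ⟨⟨q, hq, rfl⟩, ⟨r, hr, rfl⟩, h1, -⟩ a ha b hb
      have := h1 b hb a ha
      rw [hop_low (ribbonOf_subset hq ha), hop_low (ribbonOf_subset hr hb)] at this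
      omega
    have key : ∀ {Q R : Set Lat}, TreeLt H2 Q R → ∀ a ∈ Q, ∀ b ∈ R, ring a < ring b := by
      intro Q R hQR a ha
      induction hQR with
      | single h => exact fun b hb => step h a ha b hb
      | tail _ h ih =>
        intro b hb
        obtain ⟨q, hq, rfl⟩ := h.1
        exact (ih q (mem_ribbonOf_self _ _)).trans
          (step h q (mem_ribbonOf_self _ _) b hb)
    exact key h y (mem_ribbonOf_self _ _) x (mem_ribbonOf_self _ _)
  · intro h
    have hy2 := two_le_ring hy
    induction hn : (ring x - ring y).toNat generalizing x with
    | zero => omega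
    | succ n ih =>
      by_cases h1 : ring x = ring y + 1
      · exact .single (isParent_low hx hy h1)
      · have hw : ((0, 1 - ring x) : Lat) ∈ H2 := by change 1 - ring x ≤ -2; omega
        have hrw : ring (0, 1 - ring x) = ring x - 1 := by rw [ring_eq_iff]; dsimp only; omega
        exact .tail (ih hw (by omega) (by omega)) (isParent_low hx hw (by omega))

/-- This turns the order of ribbons and positions in the movement sequences of the idle half-plane
into coordinates. -/
theorem lowBefore_iff_order {x y : Lat} (hx : x ∈ H2) (hy : y ∈ H2) :
    (TreeLt H2 (ribbonOf H2 x) (ribbonOf H2 y) ∨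
      (ribbonOf H2 x = ribbonOf H2 y ∧ InFront H2 x y)) ↔ LowBefore x y := by
  rw [treeLt_low_iff hy hx, ribbonOf_low_eq_iff hx hy, inFront_low_iff hx hy, LowBefore]
  tauto

theorem lowBefore_trans {x y z : Lat} (h1 : LowBefore x y) (h2 : LowBefore y z) :
    LowBefore x z := by
  unfold LowBefore at *
  omega

theorem not_lowBefore_self (x : Lat) : ¬ LowBefore x x := by
  unfold LowBefore
  omega

theorem lowBefore_total {x y : Lat} (hx : x ∈ H2) (hy : y ∈ H2) (hne : x ≠ y) :
    LowBefore x y ∨ LowBefore y x := by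
  have : ¬ (ring x = ring y ∧ twiceX x = twiceX y) := fun h =>
    hne (eq_of_ring_of_twiceX hx hy h.1 h.2)
  unfold LowBefore
  omega

/-- The idle robots form an initial segment of the order: ribbons are filled entirely, and so are
the ribbons nearer to the seeds. -/
theorem IdleConfiguration.mem_of_lowBefore {I : Finset Lat} (h : IdleConfiguration I) {y z : Lat}
    (hz : z ∈ I) (hy : y ∈ H2) (hyz : LowBefore y z) : y ∈ I := by
  have hz2 : z ∈ H2 := h.subset_H2 hz
  have hf : ribbonOf H2 z ⊆ I := (h.filled_or_empty _ (ribbonOf_mem_ribbons hz2)).resolve_right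
    fun hd => Set.disjoint_left.1 hd (mem_ribbonOf_self _ _) hz
  rcases hyz with h1 | h1
  · exact h.filled_of_lt _ (ribbonOf_mem_ribbons hy) _ (ribbonOf_mem_ribbons hz2)
      ((treeLt_low_iff hz2 hy).2 h1) hf (mem_ribbonOf_self _ _)
  · exact hf (ribbonOf_eq_iff.1 ((ribbonOf_low_eq_iff hy hz2).2 h1.1))

/-! ### Distances from an arc -/

theorem sqrt_three_bounds : 1 < Real.sqrt 3 ∧ Real.sqrt 3 < 2 ∧ Real.sqrt 3 ^ 2 = 3 := by
  have h3 : Real.sqrt 3 ^ 2 = 3 := Real.sq_sqrt (by norm_num)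
  have h0 := Real.sqrt_nonneg 3
  exact ⟨by nlinarith, by nlinarith, h3⟩

theorem dist_sq_of_coord {d x y : ℝ} {z : ℂ} (hre : z.re = d * (x + y / 2))
    (him : z.im = d * (y * (Real.sqrt 3 / 2))) (a : Lat) :
    dist z (pos d a) ^ 2 =
      d ^ 2 * ((x - a.1) ^ 2 + (x - a.1) * (y - a.2) + (y - a.2) ^ 2) := by
  have h3 := sqrt_three_bounds.2.2
  rw [Complex.dist_eq, ← Complex.normSq_eq_norm_sq, Complex.normSq_apply]
  simp only [pos, Complex.sub_re, Complex.sub_im, Complex.mul_re, Complex.mul_im,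
    Complex.add_re, Complex.add_im, Complex.ofReal_re, Complex.ofReal_im, Complex.intCast_re,
    Complex.intCast_im, hre, him]
  linear_combination (d ^ 2 * (y - a.2) ^ 2 / 4) * h3

/-- Every point of an arc is a combination, with nonnegative coefficients, of its two ends. -/
theorem arc_coord {d : ℝ} {c q : Lat} (hcq : latGraph.Adj c q) {z : ℂ}
    (hz : z ∈ arcPoints d c q) : ∃ s t : ℝ, 0 ≤ s ∧ 0 ≤ t ∧ s ^ 2 + s * t + t ^ 2 = 1 ∧
      ∀ a, dist z (pos d a) ^ 2 = d ^ 2 * (sqDist c a + 1 + s * (sqDist q a - sqDist c a - 1) +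
        t * (sqDist (rotCW c q) a - sqDist c a - 1)) := by
  obtain ⟨θ, ⟨h0, h1⟩, rfl⟩ := hz
  obtain ⟨g1, g2, g3⟩ := sqrt_three_bounds
  have hs0 : 0 ≤ Real.sin θ :=
    Real.sin_nonneg_of_nonneg_of_le_pi h0 (h1.trans (by linarith [Real.pi_pos]))
  have hs1 : 0 ≤ Real.sin (Real.pi / 3 - θ) :=
    Real.sin_nonneg_of_nonneg_of_le_pi (by linarith) (by linarith [Real.pi_pos])
  rw [Real.sin_sub, Real.sin_pi_div_three, Real.cos_pi_div_three] at hs1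
  have hsc := Real.sin_sq_add_cos_sq θ
  have hexp : Complex.exp (-(θ : ℂ) * Complex.I) = ⟨Real.cos θ, -Real.sin θ⟩ := by
    rw [← Complex.ofReal_neg, Complex.exp_mul_I, ← Complex.ofReal_cos, ← Complex.ofReal_sin,
      Real.cos_neg, Real.sin_neg]
    apply Complex.ext
    · simp [-Complex.ofReal_cos, -Complex.ofReal_sin]
    · simp [-Complex.ofReal_cos, -Complex.ofReal_sin]
  have hadj : (c.1 - q.1) ^ 2 + (c.1 - q.1) * (c.2 - q.2) + (c.2 - q.2) ^ 2 = 1 := hcq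
  have hadj' : ((c.1 : ℝ) - q.1) ^ 2 + (c.1 - q.1) * (c.2 - q.2) + (c.2 - q.2) ^ 2 = 1 := by
    exact_mod_cast hadj
  -- `s` and `t` are the coordinates of `exp (-iθ)` in the basis `1`, `exp (-iπ/3)`.
  obtain ⟨s, hs⟩ : ∃ s, s = Real.cos θ - Real.sqrt 3 / 3 * Real.sin θ := ⟨_, rfl⟩
  obtain ⟨t, ht⟩ : ∃ t, t = 2 * (Real.sqrt 3 / 3) * Real.sin θ := ⟨_, rfl⟩
  have hst : s ^ 2 + s * t + t ^ 2 = 1 := by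
    rw [hs, ht]
    linear_combination hsc + (Real.sin θ ^ 2 / 3) * g3
  refine ⟨s, t, ?_, by rw [ht]; positivity, hst, fun a => ?_⟩
  · have : s = 2 * (Real.sqrt 3 / 3) * (Real.sqrt 3 / 2 * Real.cos θ - 1 / 2 * Real.sin θ) := by
      rw [hs]
      linear_combination (-(Real.cos θ) / 3) * g3
    rw [this]
    exact mul_nonneg (by positivity) hs1
  · rw [dist_sq_of_coord
      (x := c.1 + s * (q.1 - c.1) + t * ((q.1 - c.1) + (q.2 - c.2)))
      (y := c.2 + s * (q.2 - c.2) - t * (q.1 - c.1)) ?_ ?_ a]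
    · simp only [sqDist, rotCW]
      push_cast
      linear_combination
        (d ^ 2 * (((c.1 : ℝ) - q.1) ^ 2 + (c.1 - q.1) * (c.2 - q.2) + (c.2 - q.2) ^ 2)) * hst +
          d ^ 2 * (1 - s - t) * hadj'
    · rw [hexp, hs, ht]
      simp only [pos, Complex.sub_re, Complex.sub_im, Complex.mul_re, Complex.mul_im,
        Complex.add_re, Complex.add_im, Complex.ofReal_re, Complex.ofReal_im, Complex.intCast_re,
        Complex.intCast_im]
      ring
    · rw [hexp, hs, ht]
      simp only [pos, Complex.sub_re, Complex.sub_im, Complex.mul_re, Complex.mul_im,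
        Complex.add_re, Complex.add_im, Complex.ofReal_re, Complex.ofReal_im, Complex.intCast_re,
        Complex.intCast_im]
      linear_combination (d * Real.sin θ * (-(c.2 : ℝ) / 6 - c.1 / 3 + q.1 / 3 + q.2 / 6)) * g3

theorem dist_center_of_mem_arc {d : ℝ} (hd : 0 ≤ d) {c q : Lat} (hcq : latGraph.Adj c q) {z : ℂ}
    (hz : z ∈ arcPoints d c q) : dist z (pos d c) = d := by
  obtain ⟨s, t, -, -, -, h⟩ := arc_coord hcq hz
  have h1 := h c
  have e1 : sqDist c c = 0 := by simp [sqDist]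
  have e2 : sqDist q c = 1 := hcq.symm
  have e3 : sqDist (rotCW c q) c = 1 := by
    rw [← e2]; unfold sqDist rotCW; ring
  rw [e1, e2, e3] at h1
  norm_num at h1
  exact (sq_eq_sq₀ dist_nonneg hd).1 h1

theorem start_mem_arcPoints (d : ℝ) (c q : Lat) : pos d q ∈ arcPoints d c q :=
  ⟨0, ⟨le_rfl, by positivity⟩, by simp⟩

theorem end_mem_arcPoints (d : ℝ) (c q : Lat) : pos d (rotCW c q) ∈ arcPoints d c q :=
  ⟨Real.pi / 3, ⟨by positivity, le_rfl⟩, pos_rotCW d c q⟩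

theorem exists_dir_of_sqDist_three {c a : Lat} (h : sqDist c a = 3) :
    ∃ k, a = nb (nb c k) (k + 1) := by
  obtain ⟨x, y⟩ := c
  obtain ⟨x', y'⟩ := a
  obtain ⟨u, rfl⟩ : ∃ u, x' = x + u := ⟨x' - x, by ring⟩
  obtain ⟨v, rfl⟩ : ∃ v, y' = y + v := ⟨y' - y, by ring⟩
  have h' : u ^ 2 + u * v + v ^ 2 = 3 := by
    rw [← h]; simp only [sqDist]; ring
  have h1 : u ≤ 2 := by nlinarith [sq_nonneg (u + 2 * v)]
  have h2 : -2 ≤ u := by nlinarith [sq_nonneg (u + 2 * v)]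
  have h3 : v ≤ 2 := by nlinarith [sq_nonneg (v + 2 * u)]
  have h4 : -2 ≤ v := by nlinarith [sq_nonneg (v + 2 * u)]
  have key : ∀ k, nb (nb (x, y) k) (k + 1) = (x, y) + (dir k + dir (k + 1)) := fun k => by
    rw [nb, nb, add_assoc]
  have e : ((x + u, y + v) : Lat) = (x, y) + (u, v) := rfl
  simp only [key, e, add_right_inj]
  clear key e h
  interval_cases u <;> interval_cases v <;> simp at h' <;> decide

/-- The position symmetric to the center of an arc. -/
def farPt (c q : Lat) : Lat := q + rotCW c q - c

theorem sqDist_cases (c a : Lat) :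
    a = c ∨ latGraph.Adj c a ∨ sqDist c a = 3 ∨ 4 ≤ sqDist c a := by
  have h0 : 0 ≤ sqDist c a := by
    unfold sqDist
    nlinarith [sq_nonneg (c.1 - a.1 + (c.2 - a.2)), sq_nonneg (c.1 - a.1), sq_nonneg (c.2 - a.2)]
  have h2 : sqDist c a ≠ 2 := by
    intro h
    unfold sqDist at h
    generalize c.1 - a.1 = u at h
    generalize c.2 - a.2 = v at h
    have h1 : u ≤ 1 := by nlinarith [sq_nonneg (u + 2 * v)]
    have h2 : -1 ≤ u := by nlinarith [sq_nonneg (u + 2 * v)]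
    have h3 : v ≤ 1 := by nlinarith [sq_nonneg (v + 2 * u)]
    have h4 : -1 ≤ v := by nlinarith [sq_nonneg (v + 2 * u)]
    interval_cases u <;> interval_cases v <;> simp at h
  by_cases h1 : sqDist c a = 0
  · left
    unfold sqDist at h1
    have e1 : (c.1 - a.1) ^ 2 ≤ 0 := by
      nlinarith [sq_nonneg (c.1 - a.1 + 2 * (c.2 - a.2)), sq_nonneg (c.1 - a.1)]
    have e2 : (c.2 - a.2) ^ 2 ≤ 0 := by
      nlinarith [sq_nonneg (2 * (c.1 - a.1) + (c.2 - a.2)), sq_nonneg (c.2 - a.2)]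
    have e1 := pow_eq_zero_iff (two_ne_zero) |>.1 (le_antisymm e1 (sq_nonneg _))
    have e2 := pow_eq_zero_iff (two_ne_zero) |>.1 (le_antisymm e2 (sq_nonneg _))
    exact Prod.ext (by omega) (by omega)
  · right
    change sqDist c a = 1 ∨ _
    omega

/-- Lattice points at distance `2 d` or more from the center are settled by the triangle inequality.
Those at distance `d` or `√3 d` are finitely many directions, and the formula of `arc_coord` with
`s, t ≤ 1` settles them. -/
theorem le_dist_arc_of_ne {d : ℝ} (hd : 0 ≤ d) {c q a : Lat} (hcq : latGraph.Adj c q) {z : ℂ}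
    (hz : z ∈ arcPoints d c q) (h1 : a ≠ q) (h2 : a ≠ rotCW c q) (h3 : a ≠ farPt c q) :
    d ≤ dist z (pos d a) := by
  have hc := dist_center_of_mem_arc hd hcq hz
  obtain ⟨s, t, hs, ht, hst, h⟩ := arc_coord hcq hz
  have h := h a
  have hs1 : s ≤ 1 := by nlinarith
  have ht1 : t ≤ 1 := by nlinarith
  -- The left side is the excess of the squared distance over `d ^ 2`, in units of `d ^ 2`.
  have fin : 0 ≤ (sqDist c a : ℝ) + s * (sqDist q a - sqDist c a - 1) +
      t * (sqDist (rotCW c q) a - sqDist c a - 1) → d ≤ dist z (pos d a) := by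
    intro hh
    refine (sq_le_sq₀ hd dist_nonneg).1 ?_
    rw [h]
    nlinarith [sq_nonneg d, mul_nonneg (sq_nonneg d) hh]
  obtain ⟨j, rfl⟩ := adj_iff_nb.1 hcq
  rcases sqDist_cases c a with rfl | h4 | h4 | h4
  · exact hc.ge
  · obtain ⟨k, rfl⟩ := adj_iff_nb.1 h4
    rw [rotCW_center_nb] at *
    rw [Ne, nb_inj] at h1 h2
    refine fin ?_
    rw [sqDist_nb_nb, sqDist_nb_nb, show sqDist c (nb c k) = 1 from h4]
    have key : ∀ j k : ZMod 6, k ≠ j → k ≠ j + 5 →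
        (sqDist (dir j) (dir k) = 1 ∧ 3 ≤ sqDist (dir (j + 5)) (dir k)) ∨
        (3 ≤ sqDist (dir j) (dir k) ∧ 1 = sqDist (dir (j + 5)) (dir k)) ∨
        (3 ≤ sqDist (dir j) (dir k) ∧ 3 ≤ sqDist (dir (j + 5)) (dir k)) := by decide
    have := key j k h1 h2
    generalize sqDist (dir j) (dir k) = m at *
    generalize sqDist (dir (j + 5)) (dir k) = n at *
    rcases this with ⟨rfl, e⟩ | ⟨e, rfl⟩ | ⟨e, e'⟩
    · have : (3 : ℝ) ≤ n := by exact_mod_cast e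
      push_cast; nlinarith
    · have : (3 : ℝ) ≤ m := by exact_mod_cast e
      push_cast; nlinarith
    · have : (3 : ℝ) ≤ n := by exact_mod_cast e'
      have : (3 : ℝ) ≤ m := by exact_mod_cast e
      push_cast; nlinarith
  · obtain ⟨k, rfl⟩ := exists_dir_of_sqDist_three h4
    rw [farPt, rotCW_center_nb] at h3
    rw [rotCW_center_nb] at *
    refine fin ?_
    have e1 : ∀ i, sqDist (nb c i) (nb (nb c k) (k + 1)) =
        sqDist (dir i) (dir k + dir (k + 1)) := by
      intro i
      simp only [nb, add_assoc]
      simp [sqDist]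
    have h3' : dir k + dir (k + 1) ≠ dir j + dir (j + 5) := by
      intro e
      apply h3
      simp only [nb, add_assoc, e]
      abel
    rw [e1, e1, h4]
    have key : ∀ j k : ZMod 6, dir k + dir (k + 1) ≠ dir j + dir (j + 5) →
        (1 ≤ sqDist (dir j) (dir k + dir (k + 1)) ∧
          4 ≤ sqDist (dir (j + 5)) (dir k + dir (k + 1))) ∨
        (4 ≤ sqDist (dir j) (dir k + dir (k + 1)) ∧
          1 ≤ sqDist (dir (j + 5)) (dir k + dir (k + 1))) := by decide
    have := key j k h3'
    generalize sqDist (dir j) (dir k + dir (k + 1)) = m at *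
    generalize sqDist (dir (j + 5)) (dir k + dir (k + 1)) = n at *
    rcases this with ⟨e, e'⟩ | ⟨e, e'⟩
    · have : (1 : ℝ) ≤ m := by exact_mod_cast e
      have : (4 : ℝ) ≤ n := by exact_mod_cast e'
      push_cast; nlinarith
    · have : (4 : ℝ) ≤ m := by exact_mod_cast e
      have : (1 : ℝ) ≤ n := by exact_mod_cast e'
      push_cast; nlinarith
  · have e := dist_pos_sq d c a
    have h5 : (4 : ℝ) ≤ sqDist c a := by exact_mod_cast h4
    have h6 : 2 * d ≤ dist (pos d c) (pos d a) := by
      refine (sq_le_sq₀ (by positivity) dist_nonneg).1 ?_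
      rw [e]
      nlinarith [sq_nonneg d]
    have := dist_triangle_left (pos d c) (pos d a) z
    linarith

/-- The mirror image of the center is at distance `√3 d` from it. This case is the reason for the
choice of the spacing `d`. -/
theorem le_dist_arc_far {d : ℝ} (hd : 0 ≤ d) {c q : Lat} (hcq : latGraph.Adj c q) {z : ℂ}
    (hz : z ∈ arcPoints d c q) : (Real.sqrt 3 - 1) * d ≤ dist z (pos d (farPt c q)) := by
  have hc := dist_center_of_mem_arc hd hcq hz
  have e := dist_pos_sq d c (farPt c q)
  have e3 : sqDist c (farPt c q) = 3 := by
    have h1 : sqDist c q = 1 := hcq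
    simp only [sqDist, farPt, rotCW, Prod.fst_add, Prod.snd_add, Prod.fst_sub, Prod.snd_sub] at *
    linear_combination 3 * h1
  rw [e3] at e
  have h6 : dist (pos d c) (pos d (farPt c q)) = Real.sqrt 3 * d := by
    refine (sq_eq_sq₀ dist_nonneg (by positivity)).1 ?_
    rw [e, mul_pow, sqrt_three_bounds.2.2]
    push_cast; ring
  have := dist_triangle_left (pos d c) (pos d (farPt c q)) z
  linarith

/-- An arc keeps the distance `2 r` from every lattice point other than its ends. -/
theorem Setup.le_dist_arc (P : Setup) (hr : 0 < P.r) {c q a : Lat} (hcq : latGraph.Adj c q)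
    {z : ℂ} (hz : z ∈ arcPoints P.d c q) (h1 : a ≠ q) (h2 : a ≠ rotCW c q) :
    2 * P.r ≤ dist z (pos P.d a) := by
  obtain ⟨g1, g2, -⟩ := sqrt_three_bounds
  have hd : 0 ≤ P.d := div_nonneg (by linarith) (by linarith)
  have e : 2 * P.r = (Real.sqrt 3 - 1) * P.d := by
    rw [Setup.d, mul_div_cancel₀]
    linarith
  rw [e]
  by_cases h3 : a = farPt c q
  · rw [h3]; exact le_dist_arc_far hd hcq hz
  · have := le_dist_arc_of_ne hd hcq hz h1 h2 h3
    nlinarith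

theorem Setup.d_pos (P : Setup) (hr : 0 < P.r) : 0 < P.d :=
  div_pos (by linarith) (by linarith [sqrt_three_bounds.1])

theorem arc_subset_edgePath {d : ℝ} (hd : 0 ≤ d) {A : Set Lat} {c q : Lat}
    (hcq : latGraph.Adj c q) (hc : c ∈ A) (h1 : q ∉ A) (h2 : rotCW c q ∉ A)
    (h3 : farPt c q ∉ A) : arcPoints d c q ⊆ edgePath d A := by
  intro z hz
  refine ⟨⟨c, hc, dist_center_of_mem_arc hd hcq hz⟩, fun a ha => ?_⟩
  refine le_dist_arc_of_ne hd hcq hz ?_ ?_ ?_ <;> rintro rfl <;> contradiction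

theorem notMem_of_arc_subset {d : ℝ} (hd : 0 < d) {A : Set Lat} {c q : Lat}
    (h : arcPoints d c q ⊆ edgePath d A) : q ∉ A ∧ rotCW c q ∉ A := by
  have key : ∀ {q}, pos d q ∈ edgePath d A → q ∉ A := fun hq hqA => by
    have := hq.2 _ hqA
    rw [dist_self] at this
    linarith
  exact ⟨key (h (start_mem_arcPoints d c q)), key (h (end_mem_arcPoints d c q))⟩

theorem farPt_nb (q : Lat) (i : ZMod 6) : farPt (nb q i) q = nb q (i + 2) := by
  have key : ∀ i, dir (i + 1) - dir i = dir (i + 2) := by decide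
  rw [farPt, rotCW_nb, nb, nb, nb, ← key]
  abel

/-! ### Paths -/

theorem pathEnd_append (q : Lat) (cs ds : List Lat) :
    pathEnd q (cs ++ ds) = pathEnd (pathEnd q cs) ds := by
  induction cs generalizing q with
  | nil => rfl
  | cons c cs ih => exact ih _

theorem pathArcs_append (q : Lat) (cs ds : List Lat) :
    pathArcs q (cs ++ ds) = pathArcs q cs ++ pathArcs (pathEnd q cs) ds := by
  induction cs generalizing q with
  | nil => rfl
  | cons c cs ih => exact congrArg _ (ih _)

theorem start_mem_pathVertices (q : Lat) (cs : List Lat) : q ∈ pathVertices q cs := by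
  cases cs <;> simp [pathVertices]

theorem end_mem_pathVertices (q : Lat) (cs : List Lat) : pathEnd q cs ∈ pathVertices q cs := by
  induction cs generalizing q with
  | nil => simp [pathVertices, pathEnd]
  | cons c cs ih => exact List.mem_cons_of_mem _ (ih _)

theorem arc_mem_pathVertices {q : Lat} {cs : List Lat} {a : Lat × Lat} (ha : a ∈ pathArcs q cs) :
    a.2 ∈ pathVertices q cs ∧ rotCW a.1 a.2 ∈ pathVertices q cs := by
  induction cs generalizing q with
  | nil => simp [pathArcs] at ha
  | cons c cs ih =>
    rcases List.mem_cons.1 ha with rfl | ha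
    · exact ⟨List.mem_cons_self, List.mem_cons_of_mem _ (start_mem_pathVertices _ _)⟩
    · exact ⟨List.mem_cons_of_mem _ (ih ha).1, List.mem_cons_of_mem _ (ih ha).2⟩

/-- Cutting a path at a visited point is the step of loop erasure. -/
theorem exists_suffix {q v : Lat} {cs : List Lat} (hv : v ∈ pathVertices q cs) :
    ∃ ds, pathEnd v ds = pathEnd q cs ∧ (pathVertices v ds).Sublist (pathVertices q cs) ∧
      ∀ a ∈ pathArcs v ds, a ∈ pathArcs q cs := by
  induction cs generalizing q with
  | nil =>
    obtain rfl : v = q := by simpa [pathVertices] using hv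
    exact ⟨[], rfl, .refl _, fun _ h => h⟩
  | cons c cs ih =>
    rcases List.mem_cons.1 hv with rfl | hv
    · exact ⟨c :: cs, rfl, .refl _, fun _ h => h⟩
    · obtain ⟨ds, h1, h2, h3⟩ := ih hv
      exact ⟨ds, h1, h2.cons _, fun a ha => List.mem_cons_of_mem _ (h3 a ha)⟩

/-- A sequence of turns can be shortened to a path without repetition. -/
theorem exists_path_of_turns {A C : Set Lat} {m t : Lat}
    (h : Relation.ReflTransGen (Turn A C) m t) : ∃ cs, pathEnd m cs = t ∧
      (pathVertices m cs).Nodup ∧ ∀ a ∈ pathArcs m cs,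
        a.1 ∈ C ∧ a.1 ∈ A ∧ latGraph.Adj a.1 a.2 ∧ a.2 ∉ A ∧ rotCW a.1 a.2 ∉ A := by
  induction h using Relation.ReflTransGen.head_induction_on with
  | refl => exact ⟨[], rfl, by simp [pathVertices], by simp [pathArcs]⟩
  | @head q q' h _ ih =>
    obtain ⟨cs, h1, h2, h3⟩ := ih
    by_cases hq : q ∈ pathVertices q' cs
    · obtain ⟨ds, e1, e2, e3⟩ := exists_suffix hq
      exact ⟨ds, e1.trans h1, h2.sublist e2, fun a ha => h3 a (e3 a ha)⟩
    · obtain ⟨c, hc, hcA, hcq, hqA, rfl, hq'⟩ := h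
      refine ⟨c :: cs, h1, List.nodup_cons.2 ⟨hq, h2⟩, fun a ha => ?_⟩
      rcases List.mem_cons.1 ha with rfl | ha
      · exact ⟨hc, hcA, hcq, hqA, hq'⟩
      · exact h3 a ha

/-- Two paths without repetition whose centers are determined by the positions coincide. -/
theorem path_unique {W : Lat → Lat → Prop} (hW : ∀ q c c', W c q → W c' q → c = c')
    {cs cs' : List Lat} {m : Lat} (he : pathEnd m cs = pathEnd m cs')
    (hn : (pathVertices m cs).Nodup) (hn' : (pathVertices m cs').Nodup)
    (h : ∀ a ∈ pathArcs m cs, W a.1 a.2) (h' : ∀ a ∈ pathArcs m cs', W a.1 a.2) : cs = cs' := by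
  induction cs generalizing m cs' with
  | nil =>
    cases cs' with
    | nil => rfl
    | cons c cs' =>
      refine absurd ?_ (List.nodup_cons.1 hn').1
      have e : m = pathEnd (rotCW c m) cs' := he
      have h1 := end_mem_pathVertices (rotCW c m) cs'
      rwa [← e] at h1
  | cons c cs ih =>
    cases cs' with
    | nil =>
      refine absurd ?_ (List.nodup_cons.1 hn).1
      have e : m = pathEnd (rotCW c m) cs := he.symm
      have h1 := end_mem_pathVertices (rotCW c m) cs
      rwa [← e] at h1
    | cons c' cs' =>
      obtain rfl := hW m c c' (h _ List.mem_cons_self) (h' _ List.mem_cons_self)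
      rw [ih (m := rotCW c m) he (List.nodup_cons.1 hn).2 (List.nodup_cons.1 hn').2
        (fun a ha => h a (List.mem_cons_of_mem _ ha))
        (fun a ha => h' a (List.mem_cons_of_mem _ ha))]

theorem nodup_of_decreasing (key : Lat → ℕ) {q : Lat} {cs : List Lat}
    (h : ∀ a ∈ pathArcs q cs, key (rotCW a.1 a.2) < key a.2) :
    (pathVertices q cs).Nodup ∧ ∀ v ∈ pathVertices q cs, key v ≤ key q := by
  induction cs generalizing q with
  | nil => simp [pathVertices]
  | cons c cs ih =>
    obtain ⟨h1, h2⟩ := ih (q := rotCW c q) fun a ha => h a (List.mem_cons_of_mem _ ha)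
    have h3 := h _ List.mem_cons_self
    dsimp only at h3
    refine ⟨List.nodup_cons.2 ⟨fun hq => ?_, h1⟩, fun v hv => ?_⟩
    · have := h2 _ hq
      omega
    · rcases List.mem_cons.1 hv with rfl | hv
      · rfl
      · have := h2 _ hv
        omega

/-! ### Uniqueness and distance along a smooth boundary. -/

/-- The center of a turn along a smooth set is determined by its start. -/
theorem SmoothSet.center_unique {A : Set Lat} (hA : SmoothSet A) {q c c' : Lat} (hq : q ∉ A)
    (hc : c ∈ A) (hcq : latGraph.Adj c q) (hn : rotCW c q ∉ A)
    (hc' : c' ∈ A) (hcq' : latGraph.Adj c' q) (hn' : rotCW c' q ∉ A) : c = c' := by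
  obtain ⟨i, rfl⟩ := adj_iff_nb.1 hcq.symm
  obtain ⟨j, rfl⟩ := adj_iff_nb.1 hcq'.symm
  rw [rotCW_nb] at hn hn'
  have hs := hA q hq
  obtain ⟨k, rfl⟩ : ∃ k, j = i + k := ⟨j - i, by ring⟩
  rcases zmod_six_cases k with rfl | rfl | rfl | rfl | rfl | rfl
  · rw [add_zero]
  · exact absurd hc' hn
  · exact absurd ((hs i).2 hc hc') hn
  · exact absurd hc' ((hs i).1 hc)
  · refine absurd ((hs (i + 4)).2 hc' ?_) hn'
    rwa [add_assoc, show (4 : ZMod 6) + 2 = 0 from rfl, add_zero]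
  · rw [add_assoc, show (5 : ZMod 6) + 1 = 0 from rfl, add_zero] at hn'
    exact absurd hc hn'

/-- Center, end and mirror image are consecutive neighbours of the start, so an occupied mirror
image would force an occupied end. -/
theorem SmoothSet.farPt_notMem {A : Set Lat} (hA : SmoothSet A) {q c : Lat} (hq : q ∉ A)
    (hc : c ∈ A) (hcq : latGraph.Adj c q) (hn : rotCW c q ∉ A) : farPt c q ∉ A := by
  obtain ⟨i, rfl⟩ := adj_iff_nb.1 hcq.symm
  rw [rotCW_nb] at hn
  rw [farPt_nb]
  exact fun h => hn ((hA q hq i).2 hc h)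

theorem exterior_unique {d : ℝ} (hd : 0 < d) {A : Set Lat} (hA : SmoothSet A) {m : Lat}
    {cs cs' : List Lat} (he : pathEnd m cs = pathEnd m cs')
    (hn : (pathVertices m cs).Nodup) (hn' : (pathVertices m cs').Nodup)
    (h : Follows d A m cs) (h' : Follows d A m cs') : cs = cs' := by
  refine path_unique (W := fun c q => c ∈ A ∧ latGraph.Adj c q ∧ q ∉ A ∧ rotCW c q ∉ A)
    (fun q c c' h1 h2 => hA.center_unique h1.2.2.1 h1.1 h1.2.1 h1.2.2.2 h2.1 h2.2.1 h2.2.2.2)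
    he hn hn' (fun a ha => ?_) (fun a ha => ?_)
  · exact ⟨(h a ha).1, (h a ha).2.1, notMem_of_arc_subset hd (h a ha).2.2⟩
  · exact ⟨(h' a ha).1, (h' a ha).2.1, notMem_of_arc_subset hd (h' a ha).2.2⟩

/-- A path of turns about points of `C` along a smooth set `A` follows every set in between. -/
theorem follows_of_turns {d : ℝ} (hd : 0 ≤ d) {A B C : Set Lat} (hA : SmoothSet A) (hCB : C ⊆ B)
    (hBA : B ⊆ A) {m : Lat} {cs : List Lat} (h : ∀ a ∈ pathArcs m cs,
      a.1 ∈ C ∧ a.1 ∈ A ∧ latGraph.Adj a.1 a.2 ∧ a.2 ∉ A ∧ rotCW a.1 a.2 ∉ A) :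
    Follows d B m cs := by
  intro a ha
  obtain ⟨h1, h2, h3, h4, h5⟩ := h a ha
  have h6 := hA.farPt_notMem h4 h2 h3 h5
  exact ⟨hCB h1, h3, arc_subset_edgePath hd h3 (hCB h1) (fun h => h4 (hBA h))
    (fun h => h5 (hBA h)) (fun h => h6 (hBA h))⟩

namespace Setup

/-- Use the start of any arc from `q` that does not end at `a`; one of two arcs will do. -/
theorem two_r_le_dist (P : Setup) (hr : 0 < P.r) {q a : Lat} (h : a ≠ q) :
    2 * P.r ≤ dist (pos P.d q) (pos P.d a) := by
  by_cases h2 : a = nb q 1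
  · have hadj : latGraph.Adj (nb q 5) q := (adj_nb q 5).symm
    refine P.le_dist_arc hr hadj (start_mem_arcPoints _ _ _) h ?_
    rw [rotCW_nb, h2, Ne, nb_inj]
    decide
  · have hadj : latGraph.Adj (nb q 0) q := (adj_nb q 0).symm
    refine P.le_dist_arc hr hadj (start_mem_arcPoints _ _ _) h ?_
    rwa [rotCW_nb]

/-- By `le_dist_arc` only the lattice points on the path can be obstructed. The start needs its own
hypothesis because the path may be empty. -/
theorem unobstructed_of_arcs (P : Setup) (hr : 0 < P.r) {T : ℕ} {q : Lat} {cs : List Lat}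
    (hq : q ∉ P.occDuring T) (h : ∀ a ∈ pathArcs q cs, latGraph.Adj a.1 a.2 ∧
      a.2 ∉ P.occDuring T ∧ rotCW a.1 a.2 ∉ P.occDuring T) : P.Unobstructed T q cs := by
  rintro z (rfl | ⟨a, ha, hz⟩) b hb
  · exact P.two_r_le_dist hr fun e => hq (e ▸ hb)
  · obtain ⟨h1, h2, h3⟩ := h a ha
    exact P.le_dist_arc hr h1 hz (fun e => h2 (e ▸ hb)) (fun e => h3 (e ▸ hb))

end Setup

/-! ### Paths along a ribbon -/

namespace ProperRibbonization

variable {S D : Finset Lat}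

theorem exists_interior_path (h : ProperRibbonization S D) {x y : Lat} (hx : x ∈ S)
    (hxy : y = x ∨ InFront S y x) : ∃ cs, pathEnd x cs = y ∧
      (∀ v ∈ pathVertices x cs, v ∈ ribbonOf S x ∧ (v = x ∨ InFront S v x) ∧
        (v = y ∨ InFront S y v)) ∧
      ∀ a ∈ pathArcs x cs, a.1 = parPt S a.2 := by
  have hxy' : Relation.ReflTransGen (RibbonArc (S : Set Lat)) x y := by
    rcases hxy with rfl | hxy
    · exact .refl
    · exact hxy.to_reflTransGen
  clear hxy
  induction hxy' using Relation.ReflTransGen.head_induction_on with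
  | refl =>
    refine ⟨[], rfl, fun v hv => ?_, by simp [pathArcs]⟩
    obtain rfl : v = y := by simpa [pathVertices] using hv
    exact ⟨mem_ribbonOf_self _ _, .inl rfl, .inl rfl⟩
  | @head u v huv hvy ih =>
    obtain ⟨hu, hv, rfl⟩ := h.ribbonArc_iff.1 huv
    obtain ⟨cs, h1, h2, h3⟩ := ih hv
    have e : rotCW (parPt S u) u = nextPt S u := rotCW_par _ _ _
    refine ⟨parPt S u :: cs, ?_, fun w hw => ?_, fun a ha => ?_⟩
    · rw [pathEnd, e, h1]
    · rcases List.mem_cons.1 hw with rfl | hw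
      · exact ⟨mem_ribbonOf_self _ _, .inl rfl, .inr (.head' huv hvy)⟩
      · rw [e] at hw
        obtain ⟨k1, k2, k3⟩ := h2 w hw
        refine ⟨SimpleGraph.Reachable.trans huv.mem_ribbonOf k1, .inr ?_, k3⟩
        rcases k2 with rfl | k2
        · exact .single huv
        · exact .head huv k2
    · rcases List.mem_cons.1 ha with rfl | ha
      · rfl
      · rw [e] at ha
        exact h3 a ha

theorem notMem_parentVertices_of_mem_ribbonOf {x₀ x : Lat}
    (hx : x ∈ ribbonOf S x₀) : x ∉ parentVertices S (ribbonOf S x₀) := fun hc => by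
  have := hop_of_mem_parentVertices hx hc
  omega

theorem parentVertices_subset_hull {x₀ y : Lat} (hx₀ : x₀ ∈ S)
    (hy : y ∈ parentVertices S (ribbonOf S x₀)) : y ∈ hull S := by
  rcases parentVertices_cases hx₀ hy with rfl | rfl | h
  · exact .inr (by norm_num [sqDist, p1])
  · exact .inr (by norm_num [sqDist, p2])
  · exact .inl h.1

theorem parPt_mem_parentVertices (h : ProperRibbonization S D) {x₀ x : Lat} (hx₀ : x₀ ∈ S)
    (hx : x ∈ ribbonOf S x₀) : parPt S x ∈ parentVertices S (ribbonOf S x₀) :=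
  h.parent_mem_parentVertices hx₀ hx (h.leveled.parentDir_spec (.inl (ribbonOf_subset hx₀ hx))
    (h.ne_zero_of_mem (ribbonOf_subset hx₀ hx))).1

/-- The mirror image lies two directions ahead of the frontmost parent, where no parent can be. -/
theorem farPt_notMem_parentVertices (h : ProperRibbonization S D) {x₀ x : Lat} (hx₀ : x₀ ∈ S)
    (hx : x ∈ ribbonOf S x₀) : farPt (parPt S x) x ∉ parentVertices S (ribbonOf S x₀) := by
  intro hc
  have hxS := ribbonOf_subset hx₀ hx
  rw [parPt, par, farPt_nb] at hc
  have h1 := h.leveled.dir_eq_parentDir_or (.inl hxS)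
    (h.isParentDir_of_hop hxS (hop_of_mem_parentVertices hx hc))
  generalize parentDir (hull S) (lev S) x = a at h1
  clear * - h1
  revert a; decide

/-- A turn about the rear parent would run into the front one. -/
theorem center_eq_parPt (h : ProperRibbonization S D) {x₀ x c : Lat} (hx₀ : x₀ ∈ S)
    (hx : x ∈ ribbonOf S x₀) (hc : c ∈ parentVertices S (ribbonOf S x₀))
    (hcx : latGraph.Adj c x) (hn : rotCW c x ∉ parentVertices S (ribbonOf S x₀)) :
    c = parPt S x := by
  have hxS := ribbonOf_subset hx₀ hx
  obtain ⟨j, rfl⟩ := adj_iff_nb.1 hcx.symm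
  rcases h.leveled.dir_eq_parentDir_or (.inl hxS)
    (h.isParentDir_of_hop hxS (hop_of_mem_parentVertices hx hc)) with e | e
  · rw [e]; rfl
  · exfalso
    apply hn
    rw [rotCW_nb, e, add_assoc, show (5 : ZMod 6) + 1 = 0 from rfl, add_zero]
    exact h.parPt_mem_parentVertices hx₀ hx

theorem nextPt_notMem_parentVertices (h : ProperRibbonization S D) {x₀ x : Lat} (hx₀ : x₀ ∈ S)
    (hx : x ∈ ribbonOf S x₀) : nextPt S x ∉ parentVertices S (ribbonOf S x₀) := by
  have hxS := ribbonOf_subset hx₀ hx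
  intro hc
  have h1 := h.nextPt_mem hxS (parentVertices_subset_hull hx₀ hc)
  have ha : RibbonArc S x (nextPt S x) := h.ribbonArc_iff.2 ⟨hxS, h1, rfl⟩
  exact notMem_parentVertices_of_mem_ribbonOf
    (SimpleGraph.Reachable.trans hx ha.mem_ribbonOf) hc

end ProperRibbonization

namespace Setup

variable {P : Setup}

theorem arc_follows_parent (hP : P.Admissible) {T : ℕ} {x₀ x : Lat} (hx₀ : x₀ ∈ P.S)
    (hx : x ∈ ribbonOf P.S x₀) (hocc : parPt P.S x ∈ P.occDuring T) :
    parPt P.S x ∈ P.parentRobots T (ribbonOf P.S x₀) ∧ latGraph.Adj (parPt P.S x) x ∧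
      arcPoints P.d (parPt P.S x) x ⊆ edgePath P.d (P.parentRobots T (ribbonOf P.S x₀)) := by
  have h := hP.proper
  have h1 : parPt P.S x ∈ P.parentRobots T (ribbonOf P.S x₀) :=
    ⟨hocc, h.parPt_mem_parentVertices hx₀ hx⟩
  have h2 : rotCW (parPt P.S x) x = nextPt P.S x := rotCW_par _ _ _
  refine ⟨h1, (adj_par _ _ _).symm,
    arc_subset_edgePath (P.d_pos hP.r_pos).le (adj_par _ _ _).symm h1 (fun hc => ?_)
      (fun hc => ?_) (fun hc => ?_)⟩
  · exact ProperRibbonization.notMem_parentVertices_of_mem_ribbonOf hx hc.2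
  · rw [h2] at hc
    exact h.nextPt_notMem_parentVertices hx₀ hx hc.2
  · exact h.farPt_notMem_parentVertices hx₀ hx hc.2

/-- Ribbon paths have no condition against repetition; the decreasing key supplies it for the
uniqueness proof. -/
theorem ribbonPath_arcs (hP : P.Admissible) {T : ℕ} {x₀ q q' : Lat} {cs : List Lat}
    (hx₀ : x₀ ∈ P.S) (h : P.IsRibbonPath T (ribbonOf P.S x₀) q q' cs) :
    ∀ a ∈ pathArcs q cs, a.1 = parPt P.S a.2 ∧ keyPt P.S (rotCW a.1 a.2) < keyPt P.S a.2 := by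
  intro a ha
  obtain ⟨h1, h2⟩ := arc_mem_pathVertices ha
  have r1 := h.2.1 _ h1
  have r2 := h.2.1 _ h2
  obtain ⟨f1, f2, -⟩ := h.2.2 a ha
  have e : a.1 = parPt P.S a.2 := hP.proper.center_eq_parPt hx₀ r1 f1.2 f2
    (ProperRibbonization.notMem_parentVertices_of_mem_ribbonOf r2)
  refine ⟨e, ?_⟩
  have e2 : rotCW a.1 a.2 = nextPt P.S a.2 := by rw [e]; exact rotCW_par _ _ _
  rw [e2] at r2 ⊢
  exact hP.proper.key_lt_of_inFront (.single (hP.proper.ribbonArc_iff.2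
    ⟨ribbonOf_subset hx₀ r1, ribbonOf_subset hx₀ r2, rfl⟩))

theorem ribbonPath_unique (hP : P.Admissible) {T : ℕ} {x₀ q q' : Lat} {cs cs' : List Lat}
    (hx₀ : x₀ ∈ P.S) (h : P.IsRibbonPath T (ribbonOf P.S x₀) q q' cs)
    (h' : P.IsRibbonPath T (ribbonOf P.S x₀) q q' cs') : cs' = cs := by
  have k := ribbonPath_arcs hP hx₀ h
  have k' := ribbonPath_arcs hP hx₀ h'
  exact path_unique (W := fun c q => c = parPt P.S q) (fun q c c' h1 h2 => h1.trans h2.symm)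
    (h'.1.trans h.1.symm) (nodup_of_decreasing (keyPt P.S) fun a ha => (k' a ha).2).1
    (nodup_of_decreasing (keyPt P.S) fun a ha => (k a ha).2).1
    (fun a ha => (k' a ha).1) (fun a ha => (k a ha).1)

theorem bridge_unique (hP : P.Admissible) {T : ℕ} {x₀ x b : Lat} (hx₀ : x₀ ∈ P.S)
    (hx : x ∈ ribbonOf P.S x₀) (he : rotCW b x = nextPt P.S x)
    (h : Follows P.d (P.parentRobots T (ribbonOf P.S x₀)) x [b]) : b = parPt P.S x := by
  obtain ⟨f1, f2, -⟩ := h (b, x) List.mem_cons_self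
  refine hP.proper.center_eq_parPt hx₀ hx f1.2 f2 ?_
  rw [he]
  exact hP.proper.nextPt_notMem_parentVertices hx₀ hx

/-- The path along a ribbon exists if the parents are present; it is unobstructed if nothing
stands on the way. -/
theorem exists_ribbonPath (hP : P.Admissible) {T : ℕ} {x y : Lat} (hx : x ∈ P.S)
    (hxy : y = x ∨ InFront P.S y x)
    (hpar : ∀ v ∈ ribbonOf (P.S : Set Lat) x, parPt P.S v ∈ P.occDuring T) :
    ∃ cs, P.IsRibbonPath T (ribbonOf P.S x) x y cs ∧
      ∀ v ∈ pathVertices x cs, (v = x ∨ InFront P.S v x) ∧ (v = y ∨ InFront P.S y v) := by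
  obtain ⟨cs, h1, h2, h3⟩ := hP.proper.exists_interior_path hx hxy
  refine ⟨cs, ⟨h1, fun v hv => (h2 v hv).1, fun a ha => ?_⟩, fun v hv => (h2 v hv).2⟩
  rw [h3 a ha]
  have hr := (h2 _ (arc_mem_pathVertices ha).1).1
  exact arc_follows_parent hP hx hr (hpar _ hr)

end Setup

/-! ### Successive picks from a finite set -/

/-- `r` is a strict total order on `A`. -/
structure LinearOn (r : Lat → Lat → Prop) (A : Finset Lat) : Prop where
  irrefl : ∀ x ∈ A, ¬ r x x
  trans : ∀ x ∈ A, ∀ y ∈ A, ∀ z ∈ A, r x y → r y z → r x z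
  total : ∀ x ∈ A, ∀ y ∈ A, x ≠ y → r x y ∨ r y x

open Classical in
/-- The number of elements of `A` that precede `x`. -/
def rank (r : Lat → Lat → Prop) (A : Finset Lat) (x : Lat) : ℕ := (A.filter fun y => r y x).card

/-- `Classical.epsilon` gives some least element; asymmetry makes it this one. -/
theorem pickFirst_eq {r : Lat → Lat → Prop} {B : Set Lat} {x : Lat} (hx : x ∈ B)
    (h : ∀ y ∈ B, y ≠ x → r x y) (ha : ∀ y ∈ B, r x y → ¬ r y x) : pickFirst r B = x := by
  obtain ⟨h1, h2⟩ := Classical.epsilon_spec (p := fun x => x ∈ B ∧ ∀ y ∈ B, y ≠ x → r x y)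
    ⟨x, hx, h⟩
  by_contra hne
  exact ha _ h1 (h _ h1 hne) (h2 x hx (Ne.symm hne))

namespace LinearOn

variable {r : Lat → Lat → Prop} {A : Finset Lat}

theorem subset (h : LinearOn r A) {B : Finset Lat} (hB : B ⊆ A) : LinearOn r B :=
  ⟨fun x hx => h.irrefl x (hB hx),
    fun x hx y hy z hz => h.trans x (hB hx) y (hB hy) z (hB hz),
    fun x hx y hy => h.total x (hB hx) y (hB hy)⟩

theorem asymm (h : LinearOn r A) {x y : Lat} (hx : x ∈ A) (hy : y ∈ A) (hxy : r x y) :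
    ¬ r y x := fun hyx => h.irrefl x hx (h.trans x hx y hy x hx hxy hyx)

theorem rank_lt_rank (h : LinearOn r A) {x y : Lat} (hx : x ∈ A) (hy : y ∈ A) (hxy : r x y) :
    rank r A x < rank r A y := by
  classical
  refine Finset.card_lt_card ((Finset.ssubset_iff_of_subset fun z hz => ?_).2 ⟨x, ?_, ?_⟩)
  · rw [Finset.mem_filter] at hz ⊢
    exact ⟨hz.1, h.trans z hz.1 x hx y hy hz.2 hxy⟩
  · exact Finset.mem_filter.2 ⟨hx, hxy⟩
  · exact fun hc => h.irrefl x hx (Finset.mem_filter.1 hc).2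

theorem rank_lt_iff (h : LinearOn r A) {x y : Lat} (hx : x ∈ A) (hy : y ∈ A) :
    rank r A x < rank r A y ↔ r x y := by
  refine ⟨fun hlt => ?_, h.rank_lt_rank hx hy⟩
  have hne : x ≠ y := by rintro rfl; exact lt_irrefl _ hlt
  refine (h.total x hx y hy hne).resolve_right fun hc => ?_
  exact lt_asymm hlt (h.rank_lt_rank hy hx hc)

theorem rank_injOn (h : LinearOn r A) : Set.InjOn (rank r A) A := by
  intro x hx y hy e
  by_contra hne
  rcases h.total x hx y hy hne with hc | hc
  · exact (h.rank_lt_rank hx hy hc).ne e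
  · exact (h.rank_lt_rank hy hx hc).ne e.symm

theorem rank_lt_card (h : LinearOn r A) {x : Lat} (hx : x ∈ A) : rank r A x < A.card := by
  classical
  exact Finset.card_lt_card ((Finset.ssubset_iff_of_subset (Finset.filter_subset _ _)).2
    ⟨x, hx, fun hc => h.irrefl x hx (Finset.mem_filter.1 hc).2⟩)

theorem image_rank (h : LinearOn r A) : A.image (rank r A) = Finset.range A.card := by
  refine Finset.eq_of_subset_of_card_le (fun k hk => ?_) ?_
  · obtain ⟨x, hx, rfl⟩ := Finset.mem_image.1 hk
    exact Finset.mem_range.2 (h.rank_lt_card hx)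
  · rw [Finset.card_image_of_injOn h.rank_injOn, Finset.card_range]

theorem exists_rank_eq (h : LinearOn r A) {k : ℕ} (hk : k < A.card) :
    ∃ x ∈ A, rank r A x = k :=
  Finset.mem_image.1 (by rw [h.image_rank]; exact Finset.mem_range.2 hk)

theorem card_rank_lt (h : LinearOn r A) {m : ℕ} (hm : m ≤ A.card) :
    (A.filter fun x => rank r A x < m).card = m := by
  have : (A.filter fun x => rank r A x < m).image (rank r A) = Finset.range m := by
    ext k
    simp only [Finset.mem_image, Finset.mem_filter, Finset.mem_range]
    constructor
    · rintro ⟨x, ⟨-, hx⟩, rfl⟩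
      exact hx
    · intro hk
      obtain ⟨x, hx, rfl⟩ := h.exists_rank_eq (hk.trans_le hm)
      exact ⟨x, ⟨hx, hk⟩, rfl⟩
  have hinj : Set.InjOn (rank r A) (A.filter fun x => rank r A x < m) :=
    h.rank_injOn.mono (Finset.coe_subset.2 (Finset.filter_subset _ _))
  have e := Finset.card_image_of_injOn hinj
  rw [this, Finset.card_range] at e
  exact e.symm

theorem pickFirst_of_rank (h : LinearOn r A) {k : ℕ} {B : Set Lat}
    (hB : ∀ x, x ∈ B ↔ x ∈ A ∧ k ≤ rank r A x) {x : Lat} (hx : x ∈ A) (hk : rank r A x = k) :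
    pickFirst r B = x := by
  refine pickFirst_eq ((hB x).2 ⟨hx, hk.ge⟩) (fun y hy hne => ?_) (fun y hy => ?_)
  · obtain ⟨hyA, hyk⟩ := (hB y).1 hy
    rw [← h.rank_lt_iff hx hyA, hk]
    refine hyk.lt_of_ne fun e => hne ?_
    exact h.rank_injOn hyA hx (e.symm.trans hk.symm)
  · exact h.asymm hx ((hB y).1 hy).1

theorem mem_remaining (h : LinearOn r A) {k : ℕ} (hk : k ≤ A.card) (x : Lat) :
    x ∈ remaining r A k ↔ x ∈ A ∧ k ≤ rank r A x := by
  induction k generalizing x with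
  | zero => simp [remaining]
  | succ k ih =>
    obtain ⟨y, hy, hyk⟩ := h.exists_rank_eq hk
    have e := h.pickFirst_of_rank (ih (by omega)) hy hyk
    rw [remaining, e, Set.mem_sdiff, ih (by omega), Set.mem_singleton_iff, and_assoc]
    refine and_congr_right fun hx => ?_
    have : x = y ↔ rank r A x = rank r A y := ⟨fun e => e ▸ rfl, fun e => h.rank_injOn hx hy e⟩
    rw [this]
    omega

/-- After `k` picks exactly the elements of rank at least `k` remain, so picks are indexed by rank,
shifted by one. -/
theorem pick_spec (h : LinearOn r A) {k : ℕ} (hk : k < A.card) :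
    pick r A (k + 1) ∈ A ∧ rank r A (pick r A (k + 1)) = k := by
  obtain ⟨y, hy, hyk⟩ := h.exists_rank_eq hk
  have e : pick r A (k + 1) = y := h.pickFirst_of_rank (h.mem_remaining hk.le) hy hyk
  rw [e]
  exact ⟨hy, hyk⟩

theorem exists_pick_iff (h : LinearOn r A) {k : ℕ} (hk : k ≤ A.card) (x : Lat) :
    (∃ j < k, pick r A (j + 1) = x) ↔ x ∈ A ∧ rank r A x < k := by
  constructor
  · rintro ⟨j, hj, rfl⟩
    have := h.pick_spec (hj.trans_le hk)
    exact ⟨this.1, this.2.trans_lt hj⟩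
  · rintro ⟨hx, hxk⟩
    refine ⟨_, hxk, ?_⟩
    have := h.pick_spec (hxk.trans_le hk)
    exact h.rank_injOn this.1 hx this.2

end LinearOn

theorem LinearOn.congr {r r' : Lat → Lat → Prop} {A : Finset Lat} (hl : LinearOn r A)
    (h : ∀ x ∈ A, ∀ y ∈ A, r x y ↔ r' x y) : LinearOn r' A :=
  ⟨fun x hx => by rw [← h x hx x hx]; exact hl.irrefl x hx,
    fun x hx y hy z hz => by
      rw [← h x hx y hy, ← h y hy z hz, ← h x hx z hz]; exact hl.trans x hx y hy z hz,
    fun x hx y hy => by rw [← h x hx y hy, ← h y hy x hx]; exact hl.total x hx y hy⟩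

/-! ### The orders of the movement sequences -/

theorem linearOn_lowBefore {A : Finset Lat} (hA : (A : Set Lat) ⊆ H2) : LinearOn LowBefore A :=
  ⟨fun x _ => not_lowBefore_self x, fun _ _ _ _ _ _ => lowBefore_trans,
    fun _ hx _ hy => lowBefore_total (hA hx) (hA hy)⟩

namespace Setup

variable {P : Setup}

/-- Comparing first the ribbons and then the positions gives a total order of the shape. -/
theorem linearOn_of_order (hP : P.Admissible) {lt' : Set Lat → Set Lat → Prop}
    (hi : ∀ R ∈ ribbons (P.S : Set Lat), ¬ lt' R R)
    (ht : ∀ R₁ ∈ ribbons (P.S : Set Lat), ∀ R₂ ∈ ribbons (P.S : Set Lat),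
      ∀ R₃ ∈ ribbons (P.S : Set Lat), lt' R₁ R₂ → lt' R₂ R₃ → lt' R₁ R₃)
    (hc : ∀ R₁ ∈ ribbons (P.S : Set Lat), ∀ R₂ ∈ ribbons (P.S : Set Lat),
      R₁ ≠ R₂ → lt' R₁ R₂ ∨ lt' R₂ R₁) :
    LinearOn (fun x y => lt' (ribbonOf P.S x) (ribbonOf P.S y) ∨
      (ribbonOf (P.S : Set Lat) x = ribbonOf P.S y ∧ InFront P.S x y)) P.S := by
  have hm : ∀ x ∈ P.S, ribbonOf (P.S : Set Lat) x ∈ ribbons P.S := fun x hx =>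
    ribbonOf_mem_ribbons hx
  refine ⟨fun x hx => ?_, fun x hx y hy z hz => ?_, fun x hx y hy hne => ?_⟩
  · rintro (h1 | h1)
    · exact hi _ (hm x hx) h1
    · exact hP.proper.not_inFront_self x h1.2
  · rintro (h1 | ⟨h1, h1'⟩) (h2 | ⟨h2, h2'⟩)
    · exact .inl (ht _ (hm x hx) _ (hm y hy) _ (hm z hz) h1 h2)
    · rw [h2] at h1; exact .inl h1
    · rw [← h1] at h2; exact .inl h2
    · exact .inr ⟨h1.trans h2, Relation.TransGen.trans h2' h1'⟩
  · by_cases e : ribbonOf (P.S : Set Lat) x = ribbonOf P.S y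
    · rcases hP.proper.trichotomy (ribbonOf_eq_iff.1 e) with h1 | h1 | h1
      · exact .inl (.inr ⟨e, h1⟩)
      · exact absurd h1 hne
      · exact .inr (.inr ⟨e.symm, h1⟩)
    · exact (hc _ (hm x hx) _ (hm y hy) e).imp .inl .inl

theorem linearOn_retreat (hP : P.Admissible) : LinearOn P.RetreatBefore P.S :=
  linearOn_of_order hP (lt' := fun R R' => P.lt R' R) hP.order.irrefl
    (fun R₁ h1 R₂ h2 R₃ h3 h12 h23 => hP.order.trans R₃ h3 R₂ h2 R₁ h1 h23 h12)
    (fun R₁ h1 R₂ h2 hne => (hP.order.total R₁ h1 R₂ h2 hne).symm)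

theorem linearOn_assembly (hP : P.Admissible) :
    LinearOn (fun x y => P.lt (ribbonOf P.S x) (ribbonOf P.S y) ∨
      (ribbonOf (P.S : Set Lat) x = ribbonOf P.S y ∧ InFront P.S x y)) P.S :=
  linearOn_of_order hP (lt' := P.lt) hP.order.irrefl hP.order.trans hP.order.total

theorem activation_iff (hP : P.Admissible) {x y : Lat} (hx : x ∈ P.I) (hy : y ∈ P.I) :
    (TreeLt H2 (ribbonOf H2 y) (ribbonOf H2 x) ∨
      (ribbonOf H2 x = ribbonOf H2 y ∧ InFront H2 y x)) ↔ LowBefore y x := by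
  rw [← lowBefore_iff_order (hP.idle.subset_H2 hy) (hP.idle.subset_H2 hx),
    eq_comm (a := ribbonOf H2 x)]

theorem linearOn_activation (hP : P.Admissible) :
    LinearOn (fun x y => TreeLt H2 (ribbonOf H2 y) (ribbonOf H2 x) ∨
      (ribbonOf H2 x = ribbonOf H2 y ∧ InFront H2 y x)) P.I := by
  have h := linearOn_lowBefore hP.idle.subset_H2
  refine LinearOn.congr (r := fun x y => LowBefore y x) ⟨h.irrefl, ?_, ?_⟩
    fun x hx y hy => (activation_iff hP hx hy).symm
  · exact fun x hx y hy z hz h1 h2 => h.trans z hz y hy x hx h2 h1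
  · exact fun x hx y hy hne => (h.total x hx y hy hne).symm

end Setup

/-! ### Counting recycled robots -/

namespace Setup

variable {P : Setup}

open Classical in
/-- The vertices of the ribbon of `x`. -/
def ribbonFinset (P : Setup) (x : Lat) : Finset Lat :=
  P.S.filter fun y => ribbonOf (P.S : Set Lat) y = ribbonOf P.S x

theorem mem_ribbonFinset {x y : Lat} (hx : x ∈ P.S) :
    y ∈ P.ribbonFinset x ↔ y ∈ ribbonOf (P.S : Set Lat) x := by
  rw [ribbonFinset, Finset.mem_filter, ribbonOf_eq_iff]
  exact ⟨fun h => h.2, fun h => ⟨ribbonOf_subset hx h, h⟩⟩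

theorem linearOn_inFront (hP : P.Admissible) {x : Lat} (hx : x ∈ P.S) :
    LinearOn (InFront P.S) (P.ribbonFinset x) := by
  refine ⟨fun y _ => hP.proper.not_inFront_self y,
    fun y _ z _ w _ h1 h2 => Relation.TransGen.trans h2 h1, fun y hy z hz hne => ?_⟩
  rw [mem_ribbonFinset hx] at hy hz
  have : y ∈ ribbonOf (P.S : Set Lat) z := by rw [ribbonOf_eq hz]; exact hy
  rcases hP.proper.trichotomy this with h1 | h1 | h1
  · exact .inl h1
  · exact absurd h1 hne
  · exact .inr h1

/-- The recycled robots of a ribbon are its foremost ones, as many as it has holes. -/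
theorem isRecycled_iff {x y : Lat} (hx : x ∈ P.S)
    (hy : y ∈ ribbonOf (P.S : Set Lat) x) :
    P.IsRecycled y ↔
      rank (InFront P.S) (P.ribbonFinset x) y < ((P.ribbonFinset x).filter (· ∈ P.D)).card := by
  have e1 : ribbonIndex P.S y = rank (InFront P.S) (P.ribbonFinset x) y := by
    rw [ribbonIndex, rank, ← Set.ncard_coe_finset]
    congr 1
    ext z
    rw [Set.mem_ofPred_eq, Finset.coe_filter, Set.mem_ofPred_eq, mem_ribbonFinset hx]
    exact ⟨fun h => ⟨SimpleGraph.Reachable.trans hy h.mem_ribbonOf, h⟩, fun h => h.2⟩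
  have e2 : (ribbonOf (P.S : Set Lat) y ∩ P.D).ncard =
      ((P.ribbonFinset x).filter (· ∈ P.D)).card := by
    rw [← Set.ncard_coe_finset, ribbonOf_eq hy]
    congr 1
    ext z
    rw [Set.mem_inter_iff, Finset.coe_filter, Set.mem_ofPred_eq, mem_ribbonFinset hx]
    rfl
  rw [IsRecycled, e1, e2]

theorem isRecycled_of_inFront (hP : P.Admissible) {x y : Lat} (hx : x ∈ P.S)
    (hyx : InFront P.S y x) (hr : P.IsRecycled x) : P.IsRecycled y := by
  have hy := hyx.mem_ribbonOf
  rw [isRecycled_iff hx (mem_ribbonOf_self _ _)] at hr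
  rw [isRecycled_iff hx hy]
  exact ((linearOn_inFront hP hx).rank_lt_rank ((mem_ribbonFinset hx).2 hy)
    ((mem_ribbonFinset hx).2 (mem_ribbonOf_self _ _)) hyx).trans hr

open Classical in
theorem card_recycled_ribbon (hP : P.Admissible) {x : Lat} (hx : x ∈ P.S) :
    ((P.ribbonFinset x).filter P.IsRecycled).card =
      ((P.ribbonFinset x).filter (· ∈ P.D)).card := by
  refine Eq.trans ?_ ((linearOn_inFront hP hx).card_rank_lt
    (Finset.card_filter_le (P.ribbonFinset x) (· ∈ P.D)))
  congr 1
  refine Finset.filter_congr fun y hy => ?_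
  rw [isRecycled_iff hx ((mem_ribbonFinset hx).1 hy)]

open Classical in
/-- A set that contains with every point those in front of it has at least as many recycled
robots as hole points. -/
theorem card_holes_le (hP : P.Admissible) {U : Finset Lat} (hU : U ⊆ P.S)
    (hf : ∀ x ∈ U, ∀ y, InFront P.S y x → y ∈ U) :
    (U.filter (· ∈ P.D)).card ≤ (U.filter P.IsRecycled).card := by
  rw [Finset.card_eq_sum_card_fiberwise (f := ribbonOf (P.S : Set Lat))
      (t := P.S.image (ribbonOf (P.S : Set Lat)))
      fun x hx => Finset.mem_coe.2 (Finset.mem_image_of_mem _ (hU (Finset.mem_filter.1 hx).1)),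
    Finset.card_eq_sum_card_fiberwise (f := ribbonOf (P.S : Set Lat)) (s := U.filter P.IsRecycled)
      (t := P.S.image (ribbonOf (P.S : Set Lat)))
      fun x hx => Finset.mem_coe.2 (Finset.mem_image_of_mem _ (hU (Finset.mem_filter.1 hx).1))]
  refine Finset.sum_le_sum fun R hR => ?_
  obtain ⟨x, hx, rfl⟩ := Finset.mem_image.1 hR
  -- Ribbon by ribbon: if some robot of `U` is not recycled, all recycled ones of its ribbon stand
  -- in front of it and hence in `U`; otherwise all robots of this ribbon in `U` are recycled.
  by_cases hall : ∃ v ∈ U, ribbonOf (P.S : Set Lat) v = ribbonOf P.S x ∧ ¬ P.IsRecycled v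
  · obtain ⟨v, hv, hvx, hvr⟩ := hall
    have hv' : v ∈ ribbonOf (P.S : Set Lat) x := ribbonOf_eq_iff.1 hvx
    calc _ ≤ ((P.ribbonFinset x).filter (· ∈ P.D)).card := by
          refine Finset.card_le_card fun y hy => ?_
          simp only [Finset.mem_filter, ribbonFinset] at hy ⊢
          exact ⟨⟨hU hy.1.1, hy.2⟩, hy.1.2⟩
      _ = ((P.ribbonFinset x).filter P.IsRecycled).card := (card_recycled_ribbon hP hx).symm
      _ ≤ _ := by
          refine Finset.card_le_card fun y hy => ?_
          simp only [Finset.mem_filter, ribbonFinset] at hy ⊢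
          refine ⟨⟨?_, hy.2⟩, hy.1.2⟩
          have hyv : y ∈ ribbonOf (P.S : Set Lat) v := by
            rw [hvx]; exact ribbonOf_eq_iff.1 hy.1.2
          rcases hP.proper.trichotomy hyv with h1 | rfl | h1
          · exact hf v hv y h1
          · exact hv
          · exact absurd (isRecycled_of_inFront hP hy.1.1 h1 hy.2) hvr
  · refine Finset.card_le_card fun y hy => ?_
    simp only [Finset.mem_filter] at hy ⊢
    refine ⟨⟨hy.1.1, ?_⟩, hy.2⟩
    by_contra hc
    exact hall ⟨y, hy.1.1, hy.2, hc⟩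

open Classical in
/-- A union of ribbons has as many recycled robots as hole points. -/
theorem card_holes_eq (hP : P.Admissible) {U : Finset Lat} (hU : U ⊆ P.S)
    (hf : ∀ x ∈ U, ∀ y ∈ ribbonOf (P.S : Set Lat) x, y ∈ U) :
    (U.filter (· ∈ P.D)).card = (U.filter P.IsRecycled).card := by
  rw [Finset.card_eq_sum_card_fiberwise (f := ribbonOf (P.S : Set Lat))
      (t := U.image (ribbonOf (P.S : Set Lat)))
      fun x hx => Finset.mem_coe.2 (Finset.mem_image_of_mem _ (Finset.mem_filter.1 hx).1),
    Finset.card_eq_sum_card_fiberwise (f := ribbonOf (P.S : Set Lat)) (s := U.filter P.IsRecycled)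
      (t := U.image (ribbonOf (P.S : Set Lat)))
      fun x hx => Finset.mem_coe.2 (Finset.mem_image_of_mem _ (Finset.mem_filter.1 hx).1)]
  refine Finset.sum_congr rfl fun R hR => ?_
  obtain ⟨x, hx, rfl⟩ := Finset.mem_image.1 hR
  have key : ∀ q : Lat → Prop, ((U.filter q).filter
      fun y => ribbonOf (P.S : Set Lat) y = ribbonOf P.S x) = (P.ribbonFinset x).filter q := by
    intro q
    ext y
    simp only [Finset.mem_filter, ribbonFinset]
    constructor
    · exact fun h => ⟨⟨hU h.1.1, h.2⟩, h.1.2⟩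
    · exact fun h => ⟨⟨hf x hx y (ribbonOf_eq_iff.1 h.1.2), h.2⟩, h.1.2⟩
  rw [key P.IsRecycled, card_recycled_ribbon hP (hU hx)]
  congr 1
  convert key (· ∈ P.D)

-- Complement of `card_holes_le`: a set closed to the front has room outside the holes for all its
-- rearranged robots.
open Classical in
theorem card_rearranged_le (hP : P.Admissible) {U : Finset Lat} (hU : U ⊆ P.S)
    (hf : ∀ x ∈ U, ∀ y, InFront P.S y x → y ∈ U) :
    (U.filter fun v => ¬ P.IsRecycled v).card ≤ (U \ P.D).card := by
  have h1 := card_holes_le hP hU hf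
  have h2 := Finset.card_filter_add_card_filter_not (s := U) P.IsRecycled
  have h3 := Finset.card_filter_add_card_filter_not (s := U) (· ∈ P.D)
  rw [← Finset.sdiff_eq_filter] at h3
  omega

open Classical in
theorem card_rearranged_eq (hP : P.Admissible) {U : Finset Lat} (hU : U ⊆ P.S)
    (hf : ∀ x ∈ U, ∀ y ∈ ribbonOf (P.S : Set Lat) x, y ∈ U) :
    (U.filter fun v => ¬ P.IsRecycled v).card = (U \ P.D).card := by
  have h1 := card_holes_eq hP hU hf
  have h2 := Finset.card_filter_add_card_filter_not (s := U) P.IsRecycled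
  have h3 := Finset.card_filter_add_card_filter_not (s := U) (· ∈ P.D)
  rw [← Finset.sdiff_eq_filter] at h3
  omega

end Setup

theorem pickFirst_congr {r r' : Lat → Lat → Prop} {B : Set Lat}
    (h : ∀ x ∈ B, ∀ y ∈ B, r x y ↔ r' x y) : pickFirst r B = pickFirst r' B := by
  unfold pickFirst
  congr 1
  funext x
  refine propext (and_congr_right fun hx => forall_congr' fun y => forall_congr' fun hy => ?_)
  rw [h x hx y hy]

namespace Setup

variable {P : Setup}

/-! ### The additive stage -/

/-- The robots that move in the additive stage start here. -/
def activated (P : Setup) : Finset Lat := (Finset.Icc 1 P.N).image P.s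

theorem coe_activated (P : Setup) : (P.activated : Set Lat) = P.s '' Set.Icc 1 P.N := by
  simp [activated]

theorem mem_activated (hP : P.Admissible) {x : Lat} : x ∈ P.activated ↔
    x ∈ P.I ∧ rank (fun x y => TreeLt H2 (ribbonOf H2 y) (ribbonOf H2 x) ∨
      (ribbonOf H2 x = ribbonOf H2 y ∧ InFront H2 y x)) P.I x < P.N := by
  rw [← (linearOn_activation hP).exists_pick_iff (k := P.N) hP.enough, activated, Finset.mem_image]
  constructor
  · rintro ⟨k, hk, rfl⟩
    rw [Finset.mem_Icc] at hk
    exact ⟨k - 1, by omega, by rw [Nat.sub_add_cancel hk.1]; rfl⟩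
  · rintro ⟨j, hj, rfl⟩
    exact ⟨j + 1, Finset.mem_Icc.2 (by omega), rfl⟩

theorem activated_subset (hP : P.Admissible) : P.activated ⊆ P.I := fun _ hx =>
  ((mem_activated hP).1 hx).1

theorem activated_low (hP : P.Admissible) : (P.activated : Set Lat) ⊆ H2 := fun _ hx =>
  hP.idle.subset_H2 (activated_subset hP hx)

theorem card_activated (hP : P.Admissible) : P.activated.card = P.N := by
  classical
  rw [← (linearOn_activation hP).card_rank_lt (m := P.N) hP.enough]
  congr 1
  ext x
  rw [mem_activated hP, Finset.mem_filter]

theorem lowBefore_of_notMem_activated (hP : P.Admissible) {x y : Lat} (hx : x ∈ P.activated)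
    (hy : y ∈ P.I) (hy' : y ∉ P.activated) : LowBefore y x := by
  rw [mem_activated hP] at hx hy'
  rw [← activation_iff hP hx.1 hy, ← (linearOn_activation hP).rank_lt_iff hx.1 hy]
  have : ¬ _ < _ := fun h => hy' ⟨hy, h⟩
  omega

theorem notMem_seeds_of_low {z : Lat} (hz : z ∈ H2) : z ∉ seeds := by
  have : z.2 ≤ -2 := hz
  rw [mem_seeds]
  omega

theorem notMem_shape_of_low (hP : P.Admissible) {z : Lat} (hz : z ∈ H2) : z ∉ P.S := by
  intro h
  have h1 : z.2 ≤ -2 := hz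
  have h2 := hP.proper.two_le_row h
  omega

theorem notMem_seeds_of_mem (hP : P.Admissible) {z : Lat} (hz : z ∈ P.S) : z ∉ seeds := by
  have h2 := hP.proper.two_le_row hz
  rw [mem_seeds]
  omega

/-- The activated robots leave `I` and the assembled ones enter `S` in order of rank, so both
occupied parts are cut off at rank `T`. -/
theorem occAfter_additive (hP : P.Admissible) {T : ℕ} (hT : T ≤ P.N) (z : Lat) :
    z ∈ P.occAfter T ↔ z ∈ seeds ∨
      (z ∈ P.I ∧ T ≤ rank (fun x y => TreeLt H2 (ribbonOf H2 y) (ribbonOf H2 x) ∨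
        (ribbonOf H2 x = ribbonOf H2 y ∧ InFront H2 y x)) P.I z) ∨
      (z ∈ P.S ∧ rank (fun x y => P.lt (ribbonOf P.S x) (ribbonOf P.S y) ∨
        (ribbonOf (P.S : Set Lat) x = ribbonOf P.S y ∧ InFront P.S x y)) P.S z < T) := by
  induction T with
  | zero => simp [occAfter]
  | succ T ih =>
    have h1 := linearOn_activation hP
    have h2 := linearOn_assembly hP
    obtain ⟨a1, a2⟩ := h1.pick_spec (lt_of_lt_of_le hT hP.enough)
    obtain ⟨b1, b2⟩ := h2.pick_spec hT
    change P.s (T + 1) ∈ _ at a1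
    change rank _ _ (P.s (T + 1)) = _ at a2
    change P.t (T + 1) ∈ _ at b1
    change rank _ _ (P.t (T + 1)) = _ at b2
    have ha : z ∈ P.I → (z = P.s (T + 1) ↔ rank _ P.I z = T) := fun hz =>
      ⟨fun e => e ▸ a2, fun e => h1.rank_injOn hz a1 (e.trans a2.symm)⟩
    have hb : z ∈ P.S → (z = P.t (T + 1) ↔ rank _ P.S z = T) := fun hz =>
      ⟨fun e => e ▸ b2, fun e => h2.rank_injOn hz b1 (e.trans b2.symm)⟩
    have hlow := hP.idle.subset_H2 a1
    have hs1 : z ∈ seeds → z ≠ P.s (T + 1) := fun hz e => notMem_seeds_of_low hlow (e ▸ hz)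
    have hs2 : z ∈ P.S → z ≠ P.s (T + 1) := fun hz e => notMem_shape_of_low hP hlow (e ▸ hz)
    rw [occAfter, source, target, if_pos hT, if_pos hT, Set.mem_insert_iff, Set.mem_sdiff,
      Set.mem_singleton_iff, ih (by omega)]
    constructor
    · rintro (h | ⟨h | h | h, hne⟩)
      · exact .inr (.inr ⟨h ▸ b1, by rw [(hb (h ▸ b1)).1 h]; omega⟩)
      · exact .inl h
      · refine .inr (.inl ⟨h.1, ?_⟩)
        have := (ha h.1).not.1 hne
        omega
      · exact .inr (.inr ⟨h.1, by omega⟩)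
    · rintro (h | h | h)
      · exact .inr ⟨.inl h, hs1 h⟩
      · exact .inr ⟨.inr (.inl ⟨h.1, by omega⟩), (ha h.1).not.2 (by omega)⟩
      · by_cases e : z = P.t (T + 1)
        · exact .inl e
        · have := (hb h.1).not.1 e
          exact .inr ⟨.inr (.inr ⟨h.1, by omega⟩), hs2 h.1⟩

theorem occAfter_N (hP : P.Admissible) (z : Lat) :
    z ∈ P.occAfter P.N ↔ z ∈ seeds ∨ (z ∈ P.I ∧ z ∉ P.activated) ∨ z ∈ P.S := by
  rw [occAfter_additive hP le_rfl, mem_activated hP]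
  refine or_congr_right (or_congr ?_ ?_)
  · refine and_congr_right fun h => ?_
    rw [not_and, not_lt]
    exact ⟨fun h1 _ => h1, fun h1 => h1 h⟩
  · exact ⟨fun h => h.1, fun h => ⟨h, (linearOn_assembly hP).rank_lt_card h⟩⟩

/-! ### The subtractive stage -/

theorem sr_spec (hP : P.Admissible) {k : ℕ} (hk : k < P.N) :
    P.sr (k + 1) ∈ P.S ∧ rank P.RetreatBefore P.S (P.sr (k + 1)) = k :=
  (linearOn_retreat hP).pick_spec hk

open Classical in
/-- The starting points of the first `k` subtractive epochs. -/
def retreated (P : Setup) (k : ℕ) : Finset Lat :=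
  P.S.filter fun y => rank P.RetreatBefore P.S y < k

open Classical in
/-- The number of recycled robots among the first `k`. -/
def recycledCount (P : Setup) (k : ℕ) : ℕ := ((P.retreated k).filter P.IsRecycled).card

open Classical in
/-- The number of rearranged robots among the first `k`. -/
def rearrangedCount (P : Setup) (k : ℕ) : ℕ :=
  ((P.retreated k).filter fun y => ¬ P.IsRecycled y).card

theorem mem_retreated {k : ℕ} {y : Lat} :
    y ∈ P.retreated k ↔ y ∈ P.S ∧ rank P.RetreatBefore P.S y < k := by
  rw [retreated, Finset.mem_filter]

theorem retreated_succ (hP : P.Admissible) {k : ℕ} (hk : k < P.N) :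
    P.retreated (k + 1) = insert (P.sr (k + 1)) (P.retreated k) := by
  obtain ⟨h1, h2⟩ := sr_spec hP hk
  ext y
  rw [Finset.mem_insert, mem_retreated, mem_retreated]
  constructor
  · rintro ⟨hy, hyk⟩
    by_cases e : rank P.RetreatBefore P.S y = k
    · exact .inl ((linearOn_retreat hP).rank_injOn hy h1 (e.trans h2.symm))
    · exact .inr ⟨hy, by omega⟩
  · rintro (rfl | h)
    · exact ⟨h1, by omega⟩
    · exact ⟨h.1, by omega⟩

theorem sr_notMem_retreated (hP : P.Admissible) {k : ℕ} (hk : k < P.N) :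
    P.sr (k + 1) ∉ P.retreated k := by
  rw [mem_retreated, (sr_spec hP hk).2]
  omega

theorem counts_of_recycled (hP : P.Admissible) {k : ℕ} (hk : k < P.N)
    (hr : P.IsRecycled (P.sr (k + 1))) : P.recycledCount (k + 1) = P.recycledCount k + 1 ∧
      P.rearrangedCount (k + 1) = P.rearrangedCount k := by
  classical
  rw [recycledCount, rearrangedCount, retreated_succ hP hk, Finset.filter_insert, if_pos hr,
    Finset.filter_insert, if_neg (not_not.2 hr), Finset.card_insert_of_notMem]
  · exact ⟨rfl, rfl⟩
  · exact fun h => sr_notMem_retreated hP hk (Finset.mem_filter.1 h).1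

theorem counts_of_rearranged (hP : P.Admissible) {k : ℕ} (hk : k < P.N)
    (hr : ¬ P.IsRecycled (P.sr (k + 1))) : P.recycledCount (k + 1) = P.recycledCount k ∧
      P.rearrangedCount (k + 1) = P.rearrangedCount k + 1 := by
  classical
  rw [recycledCount, rearrangedCount, retreated_succ hP hk, Finset.filter_insert, if_neg hr,
    Finset.filter_insert, if_pos hr, Finset.card_insert_of_notMem]
  · exact ⟨rfl, rfl⟩
  · exact fun h => sr_notMem_retreated hP hk (Finset.mem_filter.1 h).1

theorem retreated_subset (P : Setup) (k : ℕ) : P.retreated k ⊆ P.S := fun _ h =>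
  (mem_retreated.1 h).1

theorem retreatBefore_of_inFront {x y : Lat} (h : InFront P.S y x) : P.RetreatBefore y x :=
  .inr ⟨ribbonOf_eq h.mem_ribbonOf, h⟩

/-- Robots retreat from the front of each ribbon, so the vacated set is closed to the front. -/
theorem rearrangedCount_le (hP : P.Admissible) (k : ℕ) :
    P.rearrangedCount k ≤ (P.retreated k \ P.D).card := by
  refine card_rearranged_le hP (P.retreated_subset k) fun x hx y hyx => ?_
  rw [mem_retreated] at *
  exact ⟨hyx.mem, ((linearOn_retreat hP).rank_lt_rank hyx.mem hx.1
    (retreatBefore_of_inFront hyx)).trans hx.2⟩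

open Classical in
theorem recycledCount_le (hP : P.Admissible) {k : ℕ} (hk : k ≤ P.N) :
    P.recycledCount k ≤ k := by
  refine (Finset.card_filter_le _ _).trans_eq ?_
  exact (linearOn_retreat hP).card_rank_lt hk

theorem linearOn_remaining (hP : P.Admissible) : LinearOn P.RetreatBefore (P.S \ P.D) :=
  (linearOn_retreat hP).subset Finset.sdiff_subset

/-- The reassembly points in the shape are free when they are needed. -/
theorem rank_lt_of_rank_lt (hP : P.Admissible) {k : ℕ} {y : Lat} (hy : y ∈ P.S \ P.D)
    (h : rank P.RetreatBefore (P.S \ P.D) y < P.rearrangedCount k) :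
    rank P.RetreatBefore P.S y < k := by
  classical
  by_contra hc
  have hyS := (Finset.mem_sdiff.1 hy).1
  -- If `y` were not yet vacated, all vacated points outside the holes would come before it.
  have : (P.retreated k \ P.D).card ≤ rank P.RetreatBefore (P.S \ P.D) y := by
    refine Finset.card_le_card fun z hz => ?_
    rw [Finset.mem_sdiff, mem_retreated] at hz
    rw [Finset.mem_filter, Finset.mem_sdiff]
    refine ⟨⟨hz.1.1, hz.2⟩, ?_⟩
    rw [← (linearOn_retreat hP).rank_lt_iff hz.1.1 hyS]
    omega
  have := rearrangedCount_le hP k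
  omega

theorem rearrangedCount_le_card (hP : P.Admissible) (k : ℕ) :
    P.rearrangedCount k ≤ (P.S \ P.D).card :=
  (rearrangedCount_le hP k).trans
    (Finset.card_le_card (Finset.sdiff_subset_sdiff (P.retreated_subset k) le_rfl))

/-- Recycled and rearranged robots draw their targets from two disjoint pools, each in increasing
order, so the next target has as rank the number of earlier robots of that kind. -/
theorem trNext_spec (hP : P.Admissible) {k : ℕ} (hk : k < P.N) {used : Set Lat}
    (hu : ∀ z, z ∈ used ↔
      (z ∈ P.activated ∧ rank LowBefore P.activated z < P.recycledCount k) ∨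
      (z ∈ P.S \ P.D ∧ rank P.RetreatBefore (P.S \ P.D) z < P.rearrangedCount k)) :
    (P.IsRecycled (P.sr (k + 1)) → P.trNext used (k + 1) ∈ P.activated ∧
      rank LowBefore P.activated (P.trNext used (k + 1)) = P.recycledCount k) ∧
    (¬ P.IsRecycled (P.sr (k + 1)) → P.trNext used (k + 1) ∈ P.S \ P.D ∧
      rank P.RetreatBefore (P.S \ P.D) (P.trNext used (k + 1)) = P.rearrangedCount k) := by
  constructor
  · intro hr
    have hl := linearOn_lowBefore (activated_low hP)
    have h1 := recycledCount_le hP hk.le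
    obtain ⟨x, hx, hxk⟩ := hl.exists_rank_eq (k := P.recycledCount k)
      (by rw [card_activated hP]; omega)
    rw [trNext, if_pos hr, ← coe_activated, pickFirst_congr (r' := LowBefore),
      hl.pickFirst_of_rank (k := P.recycledCount k) (fun z => ?_) hx hxk]
    · exact ⟨hx, hxk⟩
    · rw [Set.mem_sdiff, hu, Finset.mem_coe]
      refine and_congr_right fun hz => ?_
      have : z ∉ P.S \ P.D := fun h =>
        notMem_shape_of_low hP (activated_low hP hz) (Finset.mem_sdiff.1 h).1
      rw [← not_lt]
      tauto
    · exact fun x hx y hy => lowBefore_iff_order (activated_low hP hx.1) (activated_low hP hy.1)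
  · intro hr
    have hl := linearOn_remaining hP
    have h1 := rearrangedCount_le_card hP (k + 1)
    rw [(counts_of_rearranged hP hk hr).2] at h1
    obtain ⟨x, hx, hxk⟩ := hl.exists_rank_eq (k := P.rearrangedCount k) (by omega)
    rw [trNext, if_neg hr,
      hl.pickFirst_of_rank (k := P.rearrangedCount k) (fun z => ?_) hx hxk]
    · exact ⟨hx, hxk⟩
    · rw [Set.mem_sdiff, hu, ← Finset.coe_sdiff, Finset.mem_coe]
      refine and_congr_right fun hz => ?_
      have : z ∉ P.activated := fun h =>
        notMem_shape_of_low hP (activated_low hP h) (Finset.mem_sdiff.1 hz).1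
      rw [← not_lt]
      tauto

theorem mem_trUsed (hP : P.Admissible) {k : ℕ} (hk : k ≤ P.N) (z : Lat) : z ∈ P.trUsed k ↔
    (z ∈ P.activated ∧ rank LowBefore P.activated z < P.recycledCount k) ∨
    (z ∈ P.S \ P.D ∧ rank P.RetreatBefore (P.S \ P.D) z < P.rearrangedCount k) := by
  induction k generalizing z with
  | zero => simp [trUsed, recycledCount, rearrangedCount, retreated]
  | succ k ih =>
    obtain ⟨h1, h2⟩ := trNext_spec hP hk (ih (by omega))
    rw [trUsed, Set.mem_insert_iff, ih (by omega)]
    by_cases hr : P.IsRecycled (P.sr (k + 1))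
    · obtain ⟨e1, e2⟩ := counts_of_recycled hP hk hr
      obtain ⟨a1, a2⟩ := h1 hr
      have key : z ∈ P.activated → (z = P.trNext (P.trUsed k) (k + 1) ↔
          rank LowBefore P.activated z = P.recycledCount k) := fun hz =>
        ⟨fun e => e ▸ a2, fun e =>
          (linearOn_lowBefore (activated_low hP)).rank_injOn hz a1 (e.trans a2.symm)⟩
      rw [e1, e2, ← or_assoc]
      refine or_congr_left ?_
      rw [Nat.lt_succ_iff_lt_or_eq]
      constructor
      · rintro (h | h)
        · exact ⟨h ▸ a1, .inr ((key (h ▸ a1)).1 h)⟩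
        · exact ⟨h.1, .inl h.2⟩
      · rintro ⟨h, h' | h'⟩
        · exact .inr ⟨h, h'⟩
        · exact .inl ((key h).2 h')
    · obtain ⟨e1, e2⟩ := counts_of_rearranged hP hk hr
      obtain ⟨a1, a2⟩ := h2 hr
      have key : z ∈ P.S \ P.D → (z = P.trNext (P.trUsed k) (k + 1) ↔
          rank P.RetreatBefore (P.S \ P.D) z = P.rearrangedCount k) := fun hz =>
        ⟨fun e => e ▸ a2, fun e => (linearOn_remaining hP).rank_injOn hz a1 (e.trans a2.symm)⟩
      rw [e1, e2, or_left_comm]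
      refine or_congr_right ?_
      rw [Nat.lt_succ_iff_lt_or_eq]
      constructor
      · rintro (h | h)
        · exact ⟨h ▸ a1, .inr ((key (h ▸ a1)).1 h)⟩
        · exact ⟨h.1, .inl h.2⟩
      · rintro ⟨h, h' | h'⟩
        · exact .inr ⟨h, h'⟩
        · exact .inl ((key h).2 h')

theorem tr_of_recycled (hP : P.Admissible) {k : ℕ} (hk : k < P.N)
    (hr : P.IsRecycled (P.sr (k + 1))) : P.tr (k + 1) ∈ P.activated ∧
      rank LowBefore P.activated (P.tr (k + 1)) = P.recycledCount k :=
  (trNext_spec hP hk (mem_trUsed hP hk.le)).1 hr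

theorem tr_of_rearranged (hP : P.Admissible) {k : ℕ} (hk : k < P.N)
    (hr : ¬ P.IsRecycled (P.sr (k + 1))) : P.tr (k + 1) ∈ P.S \ P.D ∧
      rank P.RetreatBefore (P.S \ P.D) (P.tr (k + 1)) = P.rearrangedCount k :=
  (trNext_spec hP hk (mem_trUsed hP hk.le)).2 hr

theorem sr_notMem_trUsed (hP : P.Admissible) {k : ℕ} (hk : k < P.N) :
    P.sr (k + 1) ∉ P.trUsed k := by
  obtain ⟨h1, h2⟩ := sr_spec hP hk
  rw [mem_trUsed hP hk.le]
  rintro (h | h)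
  · exact notMem_shape_of_low hP (activated_low hP h.1) h1
  · have := rank_lt_of_rank_lt hP h.1 h.2
    omega

theorem occAfter_subtractive (hP : P.Admissible) {k : ℕ} (hk : k ≤ P.N) (z : Lat) :
    z ∈ P.occAfter (P.N + k) ↔ z ∈ seeds ∨ (z ∈ P.I ∧ z ∉ P.activated) ∨
      (z ∈ P.S ∧ z ∉ P.retreated k) ∨ z ∈ P.trUsed k := by
  induction k generalizing z with
  | zero => simp [occAfter_N hP, trUsed, retreated]
  | succ k ih =>
    have hs := (sr_spec hP hk).1
    have e1 : P.source (P.N + k + 1) = P.sr (k + 1) := by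
      rw [source, if_neg (by omega)]
      congr 1
      omega
    have e2 : P.target (P.N + k + 1) = P.trNext (P.trUsed k) (k + 1) := by
      rw [target, if_neg (by omega), show P.N + k + 1 - P.N = k + 1 by omega]
      rfl
    rw [← add_assoc, occAfter, e1, e2, Set.mem_insert_iff, Set.mem_sdiff, ih (by omega),
      Set.mem_singleton_iff, trUsed, Set.mem_insert_iff, retreated_succ hP hk, Finset.mem_insert]
    have h1 : z ∈ seeds → ¬ z = P.sr (k + 1) := fun h e => notMem_seeds_of_mem hP hs (e ▸ h)
    have h2 : z ∈ P.I → ¬ z = P.sr (k + 1) := fun h e =>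
      notMem_shape_of_low hP (hP.idle.subset_H2 h) (e ▸ hs)
    have h3 : z ∈ P.trUsed k → ¬ z = P.sr (k + 1) := fun h e => sr_notMem_trUsed hP hk (e ▸ h)
    clear ih e1 e2
    generalize (z = P.sr (k + 1)) = u at *
    generalize (z = P.trNext (P.trUsed k) (k + 1)) = w at *
    generalize (z ∈ seeds) = a at *
    generalize (z ∈ P.I) = b at *
    generalize (z ∈ P.activated) = c at *
    generalize (z ∈ P.S) = e at *
    generalize (z ∈ P.retreated k) = f at *
    generalize (z ∈ P.trUsed k) = g at *
    tauto

/-! ### Free and occupied points during a subtractive epoch. -/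

/-- The occupied points while the `k + 1`-st subtractive robot moves. -/
theorem mem_occDuring (hP : P.Admissible) {k : ℕ} (hk : k < P.N) (z : Lat) :
    z ∈ P.occDuring (P.N + k + 1) ↔ z ∈ seeds ∨ (z ∈ P.I ∧ z ∉ P.activated) ∨
      (z ∈ P.S ∧ z ∉ P.retreated (k + 1)) ∨ z ∈ P.trUsed k := by
  have hs := (sr_spec hP hk).1
  have e1 : P.source (P.N + k + 1) = P.sr (k + 1) := by
    rw [source, if_neg (by omega)]
    congr 1
    omega
  rw [occDuring, e1, Nat.add_sub_cancel, Set.mem_sdiff, occAfter_subtractive hP hk.le,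
    Set.mem_singleton_iff, retreated_succ hP hk, Finset.mem_insert]
  have h1 : z ∈ seeds → ¬ z = P.sr (k + 1) := fun h e => notMem_seeds_of_mem hP hs (e ▸ h)
  have h2 : z ∈ P.I → ¬ z = P.sr (k + 1) := fun h e =>
    notMem_shape_of_low hP (hP.idle.subset_H2 h) (e ▸ hs)
  have h3 : z ∈ P.trUsed k → ¬ z = P.sr (k + 1) := fun h e => sr_notMem_trUsed hP hk (e ▸ h)
  clear e1
  generalize (z = P.sr (k + 1)) = u at *
  generalize (z ∈ seeds) = a at *
  generalize (z ∈ P.I) = b at *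
  generalize (z ∈ P.activated) = c at *
  generalize (z ∈ P.S) = e at *
  generalize (z ∈ P.retreated k) = f at *
  generalize (z ∈ P.trUsed k) = g at *
  tauto

open Classical in
/-- The points of the shape that retreat before the ribbon of `x`. -/
def outer (P : Setup) (x : Lat) : Finset Lat :=
  P.S.filter fun y => P.lt (ribbonOf P.S x) (ribbonOf P.S y)

open Classical in
theorem mem_outer {x y : Lat} :
    y ∈ P.outer x ↔ y ∈ P.S ∧ P.lt (ribbonOf P.S x) (ribbonOf P.S y) := by
  rw [outer, Finset.mem_filter]

open Classical in
theorem card_outer (hP : P.Admissible) (x : Lat) :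
    ((P.outer x).filter fun v => ¬ P.IsRecycled v).card = (P.outer x \ P.D).card := by
  refine card_rearranged_eq hP (fun y hy => (mem_outer.1 hy).1) fun y hy z hz => ?_
  rw [mem_outer] at *
  rw [ribbonOf_eq hz]
  exact ⟨ribbonOf_subset hy.1 hz, hy.2⟩

/-- The ribbons beyond the current one have retreated completely, and `card_outer` gives them one
rearranged robot for each point outside the holes. -/
theorem card_outer_le (hP : P.Admissible) {k : ℕ} (hk : k < P.N) :
    (P.outer (P.sr (k + 1)) \ P.D).card ≤ P.rearrangedCount k := by
  classical
  obtain ⟨h1, h2⟩ := sr_spec hP hk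
  rw [← card_outer hP]
  refine Finset.card_le_card (Finset.filter_subset_filter _ fun y hy => ?_)
  rw [mem_outer] at hy
  rw [mem_retreated]
  have := (linearOn_retreat hP).rank_lt_rank hy.1 h1 (.inl hy.2)
  exact ⟨hy.1, by omega⟩

theorem rank_lt_card_outer (hP : P.Admissible) {x y : Lat} (hx : x ∈ P.S) (hy : y ∈ P.outer x)
    (hyD : y ∉ P.D) : rank P.RetreatBefore (P.S \ P.D) y < (P.outer x \ P.D).card := by
  classical
  have hy' := mem_outer.1 hy
  refine Finset.card_lt_card ((Finset.ssubset_iff_of_subset fun z hz => ?_).2 ⟨y, ?_, ?_⟩)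
  · rw [Finset.mem_filter, Finset.mem_sdiff] at hz
    rw [Finset.mem_sdiff, mem_outer]
    refine ⟨⟨hz.1.1, ?_⟩, hz.1.2⟩
    rcases hz.2 with h | h
    · exact hP.order.trans _ (ribbonOf_mem_ribbons hx) _ (ribbonOf_mem_ribbons hy'.1) _
        (ribbonOf_mem_ribbons hz.1.1) hy'.2 h
    · rw [h.1]; exact hy'.2
  · exact Finset.mem_sdiff.2 ⟨hy, hyD⟩
  · exact fun hc => (linearOn_retreat hP).irrefl y hy'.1 (Finset.mem_filter.1 hc).2

/-- The robots of the larger ribbons fill exactly the points that are not holes. -/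
theorem outer_occupied (hP : P.Admissible) {k : ℕ} (hk : k < P.N) {y : Lat}
    (hy : y ∈ P.outer (P.sr (k + 1))) (hyD : y ∉ P.D) : y ∈ P.trUsed k := by
  rw [mem_trUsed hP hk.le]
  refine .inr ⟨Finset.mem_sdiff.2 ⟨(mem_outer.1 hy).1, hyD⟩, ?_⟩
  exact (rank_lt_card_outer hP (sr_spec hP hk).1 hy hyD).trans_le (card_outer_le hP hk)

/-- The target has been vacated, possibly by the active robot itself. It is not on a larger ribbon,
since the points outside the holes there were used up before. -/
theorem tr_mem_of_rearranged (hP : P.Admissible) {k : ℕ} (hk : k < P.N)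
    (hr : ¬ P.IsRecycled (P.sr (k + 1))) :
    P.tr (k + 1) = P.sr (k + 1) ∨ InFront P.S (P.tr (k + 1)) (P.sr (k + 1)) := by
  obtain ⟨h1, h2⟩ := sr_spec hP hk
  obtain ⟨t1, t2⟩ := tr_of_rearranged hP hk hr
  have t3 := rank_lt_of_rank_lt hP (k := k + 1) t1
    (by rw [(counts_of_rearranged hP hk hr).2]; omega)
  obtain ⟨tS, tD⟩ := Finset.mem_sdiff.1 t1
  by_cases e : P.tr (k + 1) = P.sr (k + 1)
  · exact .inl e
  right
  have hb : P.RetreatBefore (P.tr (k + 1)) (P.sr (k + 1)) := by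
    rw [← (linearOn_retreat hP).rank_lt_iff tS h1]
    have : rank P.RetreatBefore P.S (P.tr (k + 1)) ≠ rank P.RetreatBefore P.S (P.sr (k + 1)) :=
      fun he => e ((linearOn_retreat hP).rank_injOn tS h1 he)
    omega
  rcases hb with hb | hb
  · have h3 := rank_lt_card_outer hP h1 (mem_outer.2 ⟨tS, hb⟩) tD
    have h4 := card_outer_le hP hk
    omega
  · exact hb.2

theorem mem_retreated_of_inFront (hP : P.Admissible) {k : ℕ} (hk : k < P.N) {v : Lat}
    (hv : v = P.sr (k + 1) ∨ InFront P.S v (P.sr (k + 1))) : v ∈ P.retreated (k + 1) := by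
  obtain ⟨h1, h2⟩ := sr_spec hP hk
  rw [mem_retreated]
  rcases hv with rfl | hv
  · exact ⟨h1, by omega⟩
  · have := (linearOn_retreat hP).rank_lt_rank hv.mem h1 (retreatBefore_of_inFront hv)
    exact ⟨hv.mem, by omega⟩

theorem notMem_occDuring_of_retreated (hP : P.Admissible) {k : ℕ} (hk : k < P.N) {v : Lat}
    (hv : v ∈ P.retreated (k + 1)) (hu : v ∉ P.trUsed k) : v ∉ P.occDuring (P.N + k + 1) := by
  have hS := (mem_retreated.1 hv).1
  rw [mem_occDuring hP hk]
  rintro (h | h | h | h)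
  · exact notMem_seeds_of_mem hP hS h
  · exact notMem_shape_of_low hP (hP.idle.subset_H2 h.1) hS
  · exact h.2 hv
  · exact hu h

/-- Everything up to the source has retreated, and earlier targets precede the present one, so none
lies between it and the source. -/
theorem free_of_rearranged (hP : P.Admissible) {k : ℕ} (hk : k < P.N)
    (hr : ¬ P.IsRecycled (P.sr (k + 1))) {v : Lat}
    (hv : v = P.sr (k + 1) ∨ InFront P.S v (P.sr (k + 1)))
    (hv' : v = P.tr (k + 1) ∨ InFront P.S (P.tr (k + 1)) v) :
    v ∉ P.occDuring (P.N + k + 1) := by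
  have hm := mem_retreated_of_inFront hP hk hv
  refine notMem_occDuring_of_retreated hP hk hm fun hc => ?_
  have hvS := (mem_retreated.1 hm).1
  obtain ⟨t1, t2⟩ := tr_of_rearranged hP hk hr
  rcases (mem_trUsed hP hk.le v).1 hc with h | h
  · exact notMem_shape_of_low hP (activated_low hP h.1) hvS
  · rcases hv' with rfl | hv'
    · omega
    · have := (linearOn_remaining hP).rank_lt_rank t1 h.1 (retreatBefore_of_inFront hv')
      omega

/-- All robots in front of a recycled one are recycled too. So every rearranged robot so far came
from a larger ribbon and was placed there, and no target on this ribbon has been used. -/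
theorem free_of_recycled (hP : P.Admissible) {k : ℕ} (hk : k < P.N)
    (hr : P.IsRecycled (P.sr (k + 1))) {v : Lat}
    (hv : v = P.sr (k + 1) ∨ InFront P.S v (P.sr (k + 1))) :
    v ∉ P.occDuring (P.N + k + 1) := by
  classical
  have hm := mem_retreated_of_inFront hP hk hv
  obtain ⟨h1, h2⟩ := sr_spec hP hk
  refine notMem_occDuring_of_retreated hP hk hm fun hc => ?_
  have hvS := (mem_retreated.1 hm).1
  have hvR : ribbonOf (P.S : Set Lat) v = ribbonOf P.S (P.sr (k + 1)) := by
    rcases hv with rfl | hv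
    · rfl
    · exact ribbonOf_eq hv.mem_ribbonOf
  rcases (mem_trUsed hP hk.le v).1 hc with h | h
  · exact notMem_shape_of_low hP (activated_low hP h.1) hvS
  · have h3 : P.rearrangedCount k ≤ (P.outer (P.sr (k + 1)) \ P.D).card := by
      rw [← card_outer hP]
      refine Finset.card_le_card fun y hy => ?_
      rw [Finset.mem_filter, mem_retreated] at hy
      rw [Finset.mem_filter, mem_outer]
      refine ⟨⟨hy.1.1, ?_⟩, hy.2⟩
      have hb : P.RetreatBefore y (P.sr (k + 1)) := by
        rw [← (linearOn_retreat hP).rank_lt_iff hy.1.1 h1]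
        omega
      exact hb.resolve_right fun hb => hy.2 (isRecycled_of_inFront hP h1 hb.2 hr)
    have h4 : (P.outer (P.sr (k + 1)) \ P.D).card ≤ rank P.RetreatBefore (P.S \ P.D) v := by
      refine Finset.card_le_card fun z hz => ?_
      rw [Finset.mem_sdiff, mem_outer] at hz
      rw [Finset.mem_filter, Finset.mem_sdiff]
      refine ⟨⟨hz.1.1, hz.2⟩, .inl ?_⟩
      rw [hvR]
      exact hz.1.2
    omega

theorem inner_occupied (hP : P.Admissible) {k : ℕ} (hk : k < P.N) {y : Lat} (hy : y ∈ P.S)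
    (hlt : P.lt (ribbonOf P.S y) (ribbonOf P.S (P.sr (k + 1)))) :
    y ∈ P.occDuring (P.N + k + 1) := by
  obtain ⟨h1, h2⟩ := sr_spec hP hk
  rw [mem_occDuring hP hk]
  refine .inr (.inr (.inl ⟨hy, fun hc => ?_⟩))
  rw [mem_retreated] at hc
  have := (linearOn_retreat hP).rank_lt_rank h1 hy (.inl hlt)
  omega

/-- The parent ribbon precedes in the complete tree order and has not begun to retreat; for the root
ribbon the parents are seeds. -/
theorem parPt_occupied (hP : P.Admissible) {k : ℕ} (hk : k < P.N) {v : Lat}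
    (hv : v ∈ ribbonOf (P.S : Set Lat) (P.sr (k + 1))) :
    parPt P.S v ∈ P.occDuring (P.N + k + 1) := by
  have h1 := (sr_spec hP hk).1
  rcases ProperRibbonization.parentVertices_cases h1
    (hP.proper.parPt_mem_parentVertices h1 hv) with h | h | h
  · rw [h, mem_occDuring hP hk]; left; simp [seeds]
  · rw [h, mem_occDuring hP hk]; left; simp [seeds]
  · exact inner_occupied hP hk h.1 (hP.order.extends_tree _ (ribbonOf_mem_ribbons h.1) _
      (ribbonOf_mem_ribbons h1) h.2)

/-- In a recycling epoch the occupied and virtually occupied points are the shape, the seeds, and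
the points of the idle half-plane that precede the target. -/
theorem extOccDuring_eq (hP : P.Admissible) {k : ℕ} (hk : k < P.N)
    (hr : P.IsRecycled (P.sr (k + 1))) :
    P.extOccDuring (P.N + k + 1) = obstacles P.S (P.tr (k + 1)) ∧
      lowSet (P.tr (k + 1)) ⊆ P.occDuring (P.N + k + 1) := by
  obtain ⟨t1, t2⟩ := tr_of_recycled hP hk hr
  have hl := linearOn_lowBefore (activated_low hP)
  have hlow : lowSet (P.tr (k + 1)) ⊆ P.occDuring (P.N + k + 1) := by
    rintro z ⟨hz, hzt⟩
    rw [mem_occDuring hP hk]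
    have hzI := hP.idle.mem_of_lowBefore (activated_subset hP t1) hz hzt
    -- A point before the target either never lost its idle robot or got a recycled one back.
    by_cases hza : z ∈ P.activated
    · refine .inr (.inr (.inr ((mem_trUsed hP hk.le z).2 (.inl ⟨hza, ?_⟩))))
      rw [← t2]
      exact hl.rank_lt_rank hza t1 hzt
    · exact .inr (.inl ⟨hzI, hza⟩)
  refine ⟨Set.Subset.antisymm ?_ ?_, hlow⟩
  · rintro z (hz | hz)
    · rcases (mem_occDuring hP hk z).1 hz with h | h | h | h
      · exact .inl (.inr h)
      · exact .inr ⟨hP.idle.subset_H2 h.1, lowBefore_of_notMem_activated hP t1 h.1 h.2⟩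
      · exact .inl (.inl h.1)
      · rcases (mem_trUsed hP hk.le z).1 h with h | h
        · refine .inr ⟨activated_low hP h.1, ?_⟩
          rw [← hl.rank_lt_iff h.1 t1, t2]
          exact h.2
        · exact .inl (.inl (Finset.mem_sdiff.1 h.1).1)
    · exact .inl (.inl hz)
  · rintro z ((hz | hz) | hz)
    · exact .inr hz
    · exact .inl ((mem_occDuring hP hk z).2 (.inl hz))
    · exact .inl (hlow hz)

end Setup

namespace Setup

variable {P : Setup}

/-! ### The two kinds of subtractive epochs -/

theorem occDuring_subset_obstacles (hP : P.Admissible) {k : ℕ} (hk : k < P.N)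
    (hr : P.IsRecycled (P.sr (k + 1))) :
    P.occDuring (P.N + k + 1) ⊆ obstacles P.S (P.tr (k + 1)) := by
  rw [← (extOccDuring_eq hP hk hr).1]
  exact Set.subset_union_left

/-- From the merging point one reaches the target by turns about robots. -/
theorem turns_to_target (hP : P.Admissible) {k : ℕ} (hk : k < P.N)
    (hr : P.IsRecycled (P.sr (k + 1))) {x : Lat}
    (hx : x ∈ ribbonOf (P.S : Set Lat) (P.sr (k + 1))) (hn : nextPt P.S x ∉ P.S) :
    Relation.ReflTransGen
      (Turn (obstacles P.S (P.tr (k + 1))) (P.occDuring (P.N + k + 1)))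
      (nextPt P.S x) (P.tr (k + 1)) := by
  have h := hP.proper
  have h1 := (sr_spec hP hk).1
  have hxS := ribbonOf_subset h1 hx
  have ht : (P.tr (k + 1)).2 ≤ -2 := activated_low hP (tr_of_recycled hP hk hr).1
  have lift : ∀ C : Set Lat, (∀ c ∈ C, ∀ q, latGraph.Adj c q →
      q ∉ obstacles P.S (P.tr (k + 1)) → c ∈ P.occDuring (P.N + k + 1)) → ∀ a b,
      Relation.ReflTransGen (Turn (obstacles P.S (P.tr (k + 1))) C) a b →
      Relation.ReflTransGen
        (Turn (obstacles P.S (P.tr (k + 1))) (P.occDuring (P.N + k + 1))) a b := by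
    intro C hC a b hab
    induction hab with
    | refl => exact .refl
    | tail _ hs ih =>
      obtain ⟨c, hc, hcA, hcq, hq, hs⟩ := hs
      exact ih.tail ⟨c, hC c hc _ hcq hq, hcA, hcq, hq, hs⟩
  refine (lift _ (fun c hc q hcq hq => ?_) _ _ (h.exists_turns_to_root
    (A := obstacles P.S (P.tr (k + 1))) (fun q hq => mem_obstacles_iff_hull hq) hxS hn)).trans
    (lift _ (fun c hc q _ _ => ?_) _ _ (exists_turns_from_root h ht))
  · obtain ⟨hcS, hcR⟩ := hc
    have hcR' : ribbonOf (P.S : Set Lat) c ≠ ribbonOf P.S (P.sr (k + 1)) := by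
      intro e
      rw [← ribbonOf_eq hx] at e
      have hm := ribbonOf_eq_iff.1 e
      have hl := h.level_eq_of_mem_ribbonOf hxS hm
      exact hcR ⟨hl.ge, by rwa [ProperRibbonization.ancestor_self hl]⟩
    -- The center borders a free point outside `S`, so it is not a hole; hence it is occupied even
    -- on a ribbon that has already been rearranged.
    have hcD : c ∉ P.D := h.boundary_notMem c hcS ⟨q, fun hc => hq (.inl (.inl hc)), hcq⟩
    rcases hP.order.total _ (ribbonOf_mem_ribbons hcS) _ (ribbonOf_mem_ribbons h1) hcR' with
      hlt | hlt
    · exact inner_occupied hP hk hcS hlt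
    · rw [mem_occDuring hP hk]
      exact .inr (.inr (.inr (outer_occupied hP hk (mem_outer.2 ⟨hcS, hlt⟩) hcD)))
  · rcases hc with hc | hc
    · exact (mem_occDuring hP hk c).2 (.inl hc)
    · exact (extOccDuring_eq hP hk hr).2 hc

theorem mergingPoint_notMem_obstacles (hP : P.Admissible) {x t : Lat} (hx : x ∈ P.S)
    (hn : nextPt P.S x ∉ P.S) : nextPt P.S x ∉ obstacles P.S t := by
  have hrow := hP.proper.two_le_row hx
  have hadj : latGraph.Adj x (nextPt P.S x) := adj_nxt _ _ _
  rw [adj_coord] at hadj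
  rw [mem_obstacles_iff_hull (by omega)]
  exact fun h => hn (hP.proper.nextPt_mem hx h)

theorem recycled_epoch (hP : P.Admissible) {k : ℕ} (hk : k < P.N)
    (hr : P.IsRecycled (P.sr (k + 1))) :
    P.tr (k + 1) ∈ H2 ∧ ∃ x m : Lat,
      IsFirstVertex P.S (ribbonOf P.S (P.sr (k + 1))) x ∧
      (∀ x', IsFirstVertex P.S (ribbonOf P.S (P.sr (k + 1))) x' → x' = x) ∧
      IsMergingPoint P.S (ribbonOf P.S (P.sr (k + 1))) m ∧
      (∀ m', IsMergingPoint P.S (ribbonOf P.S (P.sr (k + 1))) m' → m' = m) ∧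
      ∃ (int : List Lat) (b : Lat) (ext : List Lat),
        P.IsRecyclePath (P.N + k + 1) (ribbonOf P.S (P.sr (k + 1))) x m (P.sr (k + 1))
          (P.tr (k + 1)) int b ext ∧
        (∀ int' b' ext', P.IsRecyclePath (P.N + k + 1) (ribbonOf P.S (P.sr (k + 1))) x m
          (P.sr (k + 1)) (P.tr (k + 1)) int' b' ext' → int' = int ∧ b' = b ∧ ext' = ext) ∧
        Follows P.d (P.occDuring (P.N + k + 1)) m ext ∧
        pathEnd (P.sr (k + 1)) (int ++ b :: ext) = P.tr (k + 1) ∧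
        P.Unobstructed (P.N + k + 1) (P.sr (k + 1)) (int ++ b :: ext) := by
  have h := hP.proper
  have h1 := (sr_spec hP hk).1
  have hd := P.d_pos hP.r_pos
  have ht : P.tr (k + 1) ∈ H2 := activated_low hP (tr_of_recycled hP hk hr).1
  obtain ⟨x, hx, hn⟩ := h.exists_first h1
  have hxS := ribbonOf_subset h1 hx
  have hA := smoothSet_obstacles h ht
  have hsub := occDuring_subset_obstacles hP hk hr
  obtain ⟨int, hint, hfree⟩ := exists_ribbonPath hP (T := P.N + k + 1) h1
    (h.inFront_of_first hx hn) fun v hv => parPt_occupied hP hk hv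
  obtain ⟨ext, e1, e2, e3⟩ := exists_path_of_turns (turns_to_target hP hk hr hx hn)
  have hrot : rotCW (parPt P.S x) x = nextPt P.S x := rotCW_par _ _ _
  have hext : Follows P.d (P.extOccDuring (P.N + k + 1)) (nextPt P.S x) ext := by
    rw [(extOccDuring_eq hP hk hr).1]
    exact follows_of_turns hd.le hA hsub le_rfl e3
  have hfree' : ∀ v ∈ pathVertices (P.sr (k + 1)) int, v ∉ P.occDuring (P.N + k + 1) :=
    fun v hv => free_of_recycled hP hk hr (hfree v hv).1
  have hend : pathEnd (P.sr (k + 1)) int = x := hint.1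
  refine ⟨ht, x, nextPt P.S x, (h.isFirstVertex_iff h1).2 ⟨hx, hn⟩, fun x' hx' => ?_,
    (h.isMergingPoint_iff h1 hx hn).2 rfl, fun m' hm' => (h.isMergingPoint_iff h1 hx hn).1 hm',
    int, parPt P.S x, ext, ⟨hint, ⟨hrot, fun a ha => ?_⟩, e1, e2, hext⟩, ?_,
    follows_of_turns hd.le hA le_rfl hsub e3, ?_, ?_⟩
  · rw [h.isFirstVertex_iff h1] at hx'
    exact h.first_unique (SimpleGraph.Reachable.trans (SimpleGraph.Reachable.symm hx) hx'.1)
      hx'.2 hn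
  · obtain rfl : a = (parPt P.S x, x) := by simpa [pathArcs] using ha
    exact arc_follows_parent hP h1 hx (parPt_occupied hP hk hx)
  · rintro int' b' ext' ⟨g1, ⟨g2, g3⟩, g4, g5, g6⟩
    refine ⟨ribbonPath_unique hP h1 hint g1, bridge_unique hP h1 hx g2 g3, ?_⟩
    rw [(extOccDuring_eq hP hk hr).1] at g6 hext
    exact exterior_unique hd hA (g4.trans e1.symm) g5 e2 g6 hext
  · rw [pathEnd_append, hend, pathEnd, hrot, e1]
  · refine P.unobstructed_of_arcs hP.r_pos (hfree' _ (start_mem_pathVertices _ _))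
      fun a ha => ?_
    rw [pathArcs_append, hend, List.mem_append, pathArcs, List.mem_cons, hrot] at ha
    rcases ha with ha | rfl | ha
    · have hv := arc_mem_pathVertices ha
      exact ⟨(hint.2.2 a ha).2.1, hfree' _ hv.1, hfree' _ hv.2⟩
    · refine ⟨(adj_par _ _ _).symm, ?_, ?_⟩
      · have := end_mem_pathVertices (P.sr (k + 1)) int
        rw [hend] at this
        exact hfree' _ this
      · dsimp only
        rw [hrot]
        exact fun hc => mergingPoint_notMem_obstacles hP hxS hn (hsub hc)
    · obtain ⟨-, -, g3, g4, g5⟩ := e3 a ha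
      exact ⟨g3, fun hc => g4 (hsub hc), fun hc => g5 (hsub hc)⟩

theorem rearranged_epoch (hP : P.Admissible) {k : ℕ} (hk : k < P.N)
    (hr : ¬ P.IsRecycled (P.sr (k + 1))) :
    P.tr (k + 1) ∈ ribbonOf (P.S : Set Lat) (P.sr (k + 1)) ∧ P.tr (k + 1) ∈ P.S \ P.D ∧
      ∃ cs : List Lat,
        P.IsRibbonPath (P.N + k + 1) (ribbonOf P.S (P.sr (k + 1))) (P.sr (k + 1))
          (P.tr (k + 1)) cs ∧
        (∀ cs', P.IsRibbonPath (P.N + k + 1) (ribbonOf P.S (P.sr (k + 1))) (P.sr (k + 1))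
          (P.tr (k + 1)) cs' → cs' = cs) ∧
        P.Unobstructed (P.N + k + 1) (P.sr (k + 1)) cs := by
  have h1 := (sr_spec hP hk).1
  have hf := tr_mem_of_rearranged hP hk hr
  obtain ⟨cs, hcs, hfree⟩ := exists_ribbonPath hP (T := P.N + k + 1) h1 hf
    fun v hv => parPt_occupied hP hk hv
  have hfree' : ∀ v ∈ pathVertices (P.sr (k + 1)) cs, v ∉ P.occDuring (P.N + k + 1) :=
    fun v hv => free_of_rearranged hP hk hr (hfree v hv).1 (hfree v hv).2
  refine ⟨?_, (tr_of_rearranged hP hk hr).1, cs, hcs,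
    fun cs' hcs' => ribbonPath_unique hP h1 hcs hcs', P.unobstructed_of_arcs hP.r_pos
      (hfree' _ (start_mem_pathVertices _ _)) fun a ha => ?_⟩
  · rcases hf with e | hf
    · rw [e]; exact mem_ribbonOf_self _ _
    · exact hf.mem_ribbonOf
  · have hv := arc_mem_pathVertices ha
    exact ⟨(hcs.2.2 a ha).2.1, hfree' _ hv.1, hfree' _ hv.2⟩

theorem sr_mem_occAfter (hP : P.Admissible) {k : ℕ} (hk : k < P.N) :
    P.sr (k + 1) ∈ P.occAfter (P.N + k) := by
  rw [occAfter_subtractive hP hk.le]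
  exact .inr (.inr (.inl ⟨(sr_spec hP hk).1, sr_notMem_retreated hP hk⟩))

end Setup

end AddSubtract

end

theorem mainTheorem7 (P : AddSubtract.Setup) (hP : P.Admissible) (T : ℕ)
    (hT₁ : P.N + 1 ≤ T) (hT₂ : T ≤ 2 * P.N) :
    P.sr (T - P.N) ∈ P.occAfter (T - 1) ∧
    (P.IsRecycled (P.sr (T - P.N)) →
      P.tr (T - P.N) ∈ AddSubtract.H2 ∧
      ∃ x m : AddSubtract.Lat,
        AddSubtract.IsFirstVertex P.S (AddSubtract.ribbonOf P.S (P.sr (T - P.N))) x ∧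
        (∀ x', AddSubtract.IsFirstVertex P.S
          (AddSubtract.ribbonOf P.S (P.sr (T - P.N))) x' → x' = x) ∧
        AddSubtract.IsMergingPoint P.S (AddSubtract.ribbonOf P.S (P.sr (T - P.N))) m ∧
        (∀ m', AddSubtract.IsMergingPoint P.S
          (AddSubtract.ribbonOf P.S (P.sr (T - P.N))) m' → m' = m) ∧
        ∃ (int : List AddSubtract.Lat) (b : AddSubtract.Lat) (ext : List AddSubtract.Lat),
          P.IsRecyclePath T (AddSubtract.ribbonOf P.S (P.sr (T - P.N))) x m
            (P.sr (T - P.N)) (P.tr (T - P.N)) int b ext ∧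
          (∀ int' b' ext', P.IsRecyclePath T (AddSubtract.ribbonOf P.S (P.sr (T - P.N))) x m
            (P.sr (T - P.N)) (P.tr (T - P.N)) int' b' ext' →
              int' = int ∧ b' = b ∧ ext' = ext) ∧
          AddSubtract.Follows P.d (P.occDuring T) m ext ∧
          AddSubtract.pathEnd (P.sr (T - P.N)) (int ++ b :: ext) = P.tr (T - P.N) ∧
          P.Unobstructed T (P.sr (T - P.N)) (int ++ b :: ext)) ∧
    (¬ P.IsRecycled (P.sr (T - P.N)) →
      P.tr (T - P.N) ∈ AddSubtract.ribbonOf P.S (P.sr (T - P.N)) ∧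
      P.tr (T - P.N) ∈ P.S \ P.D ∧
      ∃ cs : List AddSubtract.Lat,
        P.IsRibbonPath T (AddSubtract.ribbonOf P.S (P.sr (T - P.N)))
          (P.sr (T - P.N)) (P.tr (T - P.N)) cs ∧
        (∀ cs', P.IsRibbonPath T (AddSubtract.ribbonOf P.S (P.sr (T - P.N)))
          (P.sr (T - P.N)) (P.tr (T - P.N)) cs' → cs' = cs) ∧
        P.Unobstructed T (P.sr (T - P.N)) cs) := by
  -- With `k` counted from zero, `k` is the number of completed subtractive epochs.
  obtain ⟨k, rfl⟩ : ∃ k, T = P.N + k + 1 := ⟨T - P.N - 1, by omega⟩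
  have hk : k < P.N := by omega
  rw [show P.N + k + 1 - P.N = k + 1 by omega, Nat.add_sub_cancel]
  exact ⟨AddSubtract.Setup.sr_mem_occAfter hP hk, AddSubtract.Setup.recycled_epoch hP hk,
    AddSubtract.Setup.rearranged_epoch hP hk⟩
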